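/- Let $k \ge 1$ be an integer, $q = e^{\pi i/(k+2)}$, $[i] = \frac{q^i - q^{-i}}{q - q^{-1}}$ and $\delta = -[2]$. Consider the $\mathbb{C}$-linear monoidal category with object set $\mathbb{N}$ in which $\mathrm{Hom}(m,n)$ has as basis the isotopy classes of planar diagrams without loops, with $m$ dots at the bottom and $n$ dots at the top joined in pairs by non-crossing lines; composition is vertical stacking, where every closed loop is replaced by the factor $\delta$, and the tensor product is horizontal juxtaposition. Let $TL$ be its additive and idempotent completion, with the induced monoidal structure. For $0 \le i \le k+1$ let $f_i : i \to i$ be the Jones–Wenzl projections, defined by $f_0 = 1_0$, $f_1 = 1_1$ and $$f_i = f_{i-1}\otimes 1_1 + \tfrac{[i-1]}{[i]}\,(f_{i-1}\otimes 1_1)\circ U_{i-1}\circ (f_{i-1}\otimes 1_1) \qquad (2 \le i \le k+1),$$ where $U_{i-1} : i \to i$ is the cap-cup diagram on the last two of the $i$ strands, and let $F_i = (i, f_i) \in TL$. Let $\widetilde{TL} = TL/(F_{k+1})$ be the quotient of $TL$ by the ideal of morphisms generated by (the identity of) $F_{k+1}$, i.e. the smallest class of morphisms containing it and closed under sums, under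 composition with arbitrary morphisms on either side and under tensoring with arbitrary objects on either side. Let $\Sigma = \bigoplus_{i=0}^{k} F_i \in \widetilde{TL}$, with the algebra structure whose unit $u : \mathbb{1} = F_0 \hookrightarrow \Sigma$ is the inclusion and whose multiplication $m : \Sigma\otimes\Sigma \to \Sigma$ is the sum of the maps $f_{i+j}\circ(f_i\otimes f_j) : F_i \otimes F_j \to F_{i+j} \hookrightarrow \Sigma$ over all $0\le i, j \le k$ with $i + j \le k$ (and is zero on $F_i\otimes F_j$ if $i+j>k$). A Frobenius structure on an algebra $(A,u,m)$ with a left dual $A^\vee$ and coevaluation $c : \mathbb{1} \to A \otimes A^\vee$ in a monoidal category is a pair $(W, n)$ of an object $W$ and a morphism $n : A \to W$ such that $$A \xrightarrow{1_A\otimes c} A\otimes A\otimes A^\vee \xrightarrow{(n\circ m)\otimes 1_{A^\vee}} W\otimes A^\vee$$ is an isomorphism; it is called classical if $W = \mathbb{1}$. Then $\Sigma$ admits no classical Frobenius structure. Moreover, every morphism $n : \Sigma \to \mathbb{1}$ in $\widetilde{TL}$ vanishes on the summands $F_i$ with $0 < i \le k$. -/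

import Mathlib

namespace TemperleyLieb

/-- Position of a dot on the boundary of the rectangle, read counterclockwise from the bottom left
corner: the `m` bottom dots from left to right, then the `n` top dots from right to left. -/
def pos {m n : ℕ} : Fin m ⊕ Fin n → ℕ
  | Sum.inl i => i
  | Sum.inr j => m + (n - 1 - j)

/-- A planar diagram `m → n` without loops, up to isotopy: `m` bottom dots and `n` top dots,
joined in pairs by non-crossing lines. `rel x y` says that `x` and `y` lie on the same line. -/
@[ext] structure Diagram (m n : ℕ) where
  rel : Setoid (Fin m ⊕ Fin n)
  pair : ∀ x, ∃! y, y ≠ x ∧ rel x y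
  planar : ∀ a b c d, pos a < pos b → pos b < pos c → pos c < pos d → rel a c → ¬ rel b d

/-! ### Labelings -/

/-- A labeling is compatible with a setoid if it is constant on classes. -/
def Compat {X : Type} (s : Setoid X) (l : X → Bool) : Prop := ∀ x y, s x y → l x = l y

theorem setoid_eq_of_compat {X : Type} {s t : Setoid X} (h : ∀ l, Compat s l ↔ Compat t l) :
    s = t := by
  classical
  have key : ∀ {s t : Setoid X}, (∀ l, Compat t l → Compat s l) → ∀ x y, s x y → t x y := by
    intro s t h x y hxy
    have h1 : Compat t (fun z => decide (t x z)) := by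
      intro u v huv
      simp only [decide_eq_decide]
      exact ⟨fun h => t.trans h huv, fun h => t.trans h (t.symm huv)⟩
    have h2 := h _ h1 x y hxy
    simp only [decide_eq_decide] at h2
    exact h2.1 (t.refl x)
  ext x y
  exact ⟨key (fun l => (h l).2) x y, key (fun l => (h l).1) x y⟩

theorem card_compat {X T : Type} [Finite T] (S : Setoid T) (o : X → T) (l : X → Bool) [Decidable (Compat (S.comap o) l)] :
    Nat.card {L : T → Bool // Compat S L ∧ L ∘ o = l} =
      if Compat (S.comap o) l then
        2 ^ Nat.card {c : Quotient S // ∀ x, c ≠ Quotient.mk S (o x)} else 0 := by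
  classical
  have := Fintype.ofFinite T
  split_ifs with hl
  · have hex : ∀ c : Quotient S, ∃ b : Bool, ∀ x, c = Quotient.mk S (o x) → b = l x := by
      intro c
      by_cases hc : ∃ x, c = Quotient.mk S (o x)
      · obtain ⟨x, rfl⟩ := hc
        exact ⟨l x, fun y hy => hl x y (Quotient.exact (s := S) hy)⟩
      · exact ⟨true, fun x hx => (hc ⟨x, hx⟩).elim⟩
    choose b hb using hex
    have e : {L : T → Bool // Compat S L ∧ L ∘ o = l} ≃
        ({c : Quotient S // ∀ x, c ≠ Quotient.mk S (o x)} → Bool) :=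
      { toFun := fun L c => Quotient.lift L.1 (fun x y h => L.2.1 x y h) c.1
        invFun := fun M => ⟨fun t => if h : ∀ x, Quotient.mk S t ≠ Quotient.mk S (o x) then
            M ⟨Quotient.mk S t, h⟩ else b (Quotient.mk S t), by
            intro x y h
            have : Quotient.mk S x = Quotient.mk S y := Quotient.sound h
            simp only [this], by
            funext x
            have : ¬ ∀ y, Quotient.mk S (o x) ≠ Quotient.mk S (o y) := fun h => h x rfl
            simp only [Function.comp, dif_neg this]
            exact hb _ x rfl⟩
        left_inv := by
          rintro ⟨L, hL, hLo⟩
          apply Subtype.ext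
          funext t
          simp only
          split_ifs with h
          · rfl
          · push Not at h
            obtain ⟨x, hx⟩ := h
            rw [hb _ x hx, ← hLo]
            exact hL _ _ (S.symm (Quotient.exact hx))
        right_inv := by
          intro M
          funext ⟨c, hc⟩
          induction c using Quotient.ind with | _ t => ?_
          simp only [Quotient.lift_mk]
          rw [dif_pos hc] }
    rw [Nat.card_congr e, Nat.card_fun]
    simp
  · have : IsEmpty {L : T → Bool // Compat S L ∧ L ∘ o = l} := by
      constructor
      rintro ⟨L, hL, rfl⟩
      exact hl fun x y h => hL _ _ h
    simp

namespace Diagram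
variable {m n p r : ℕ}

/-! ### Stacking -/

/-- The lower diagram inside the stack of two diagrams. -/
def lo : Fin m ⊕ Fin n → Fin m ⊕ (Fin n ⊕ Fin p) := Sum.map id Sum.inl

/-- The upper diagram inside the stack of two diagrams. -/
def hi : Fin n ⊕ Fin p → Fin m ⊕ (Fin n ⊕ Fin p) := Sum.inr

/-- The outer dots of the stack of two diagrams. -/
def outer : Fin m ⊕ Fin p → Fin m ⊕ (Fin n ⊕ Fin p) := Sum.map id Sum.inr

/-- Stack `g` on top of `f`: two of the dots are related if they lie on the same component
of the stacked picture. -/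
def glue (f : Diagram m n) (g : Diagram n p) : Setoid (Fin m ⊕ (Fin n ⊕ Fin p)) :=
  Relation.EqvGen.setoid fun x y =>
    (∃ a b, f.rel a b ∧ x = lo a ∧ y = lo b) ∨ (∃ a b, g.rel a b ∧ x = hi a ∧ y = hi b)

/-- The number of loops created by stacking: the components of the stacked picture
that contain no outer dot. -/
noncomputable def loops (f : Diagram m n) (g : Diagram n p) : ℕ :=
  Nat.card {c : Quotient (glue f g) // ∀ x, c ≠ Quotient.mk (glue f g) (outer x)}

theorem glue_lo {f : Diagram m n} {g : Diagram n p} {a b} (h : f.rel a b) :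
    glue f g (lo a) (lo b) := Relation.EqvGen.rel _ _ (Or.inl ⟨a, b, h, rfl, rfl⟩)

theorem glue_hi {f : Diagram m n} {g : Diagram n p} {a b} (h : g.rel a b) :
    glue f g (hi a) (hi b) := Relation.EqvGen.rel _ _ (Or.inr ⟨a, b, h, rfl, rfl⟩)

/-- A property transported along both kinds of lines is transported along components. -/
theorem glue_induction {f : Diagram m n} {g : Diagram n p} {P : Fin m ⊕ (Fin n ⊕ Fin p) → Prop}
    (h1 : ∀ a b, f.rel a b → P (lo a) → P (lo b)) (h2 : ∀ a b, g.rel a b → P (hi a) → P (hi b))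
    {x y} (h : glue f g x y) : P x ↔ P y := by
  have h' : Relation.EqvGen (fun x y => (∃ a b, f.rel a b ∧ x = lo a ∧ y = lo b) ∨
    (∃ a b, g.rel a b ∧ x = hi a ∧ y = hi b)) x y := h
  clear h
  induction h' with
  | rel x y h =>
    rcases h with ⟨a, b, h, rfl, rfl⟩ | ⟨a, b, h, rfl, rfl⟩
    · exact ⟨h1 _ _ h, h1 _ _ (f.rel.symm h)⟩
    · exact ⟨h2 _ _ h, h2 _ _ (g.rel.symm h)⟩
  | refl => exact Iff.rfl
  | symm x y h ih => exact ih.symm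
  | trans x y z h1 h2 ih1 ih2 => exact ih1.trans ih2

theorem compat_glue {f : Diagram m n} {g : Diagram n p} {L : Fin m ⊕ (Fin n ⊕ Fin p) → Bool} :
    Compat (glue f g) L ↔ Compat f.rel (L ∘ lo) ∧ Compat g.rel (L ∘ hi) := by
  constructor
  · intro h
    exact ⟨fun a b hab => h _ _ (glue_lo hab), fun a b hab => h _ _ (glue_hi hab)⟩
  · rintro ⟨h1, h2⟩ x y hxy
    exact (glue_induction (P := fun z => L x = L z) (fun a b hab h => h.trans (h1 a b hab))
      (fun a b hab h => h.trans (h2 a b hab)) hxy).1 rfl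

/-- The matrix of a relation on dots, indexed by labelings of the bottom and top dots. -/
noncomputable def relMat (s : Setoid (Fin m ⊕ Fin n)) :
    Matrix (Fin m → Bool) (Fin n → Bool) ℕ :=
  open Classical in fun a b => if Compat s (Sum.elim a b) then 1 else 0

theorem relMat_injective {s t : Setoid (Fin m ⊕ Fin n)} (h : relMat s = relMat t) : s = t := by
  apply setoid_eq_of_compat
  intro l
  have := congrFun (congrFun h (l ∘ Sum.inl)) (l ∘ Sum.inr)
  simp only [relMat, Sum.elim_comp_inl_inr] at this
  split_ifs at this <;> simp_all

theorem relMat_mul (f : Diagram m n) (g : Diagram n p) :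
    relMat f.rel * relMat g.rel = 2 ^ loops f g • relMat ((glue f g).comap outer) := by
  classical
  ext a c
  have := card_compat (glue f g) outer (Sum.elim a c)
  simp only [Matrix.mul_apply, relMat, Matrix.smul_apply, smul_eq_mul, mul_ite, mul_one, mul_zero]
  simp only [loops, ← this, ← ite_and, Finset.sum_boole, Nat.cast_id]
  rw [← Fintype.card_subtype, ← Nat.card_eq_fintype_card]
  refine Nat.card_congr
    { toFun := fun b => ⟨Sum.elim a (Sum.elim b.1 c), compat_glue.2 ⟨?_, ?_⟩, ?_⟩
      invFun := fun L => ⟨fun i => L.1 (Sum.inr (Sum.inl i)), ?_⟩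
      left_inv := ?_
      right_inv := ?_ }
  · convert b.2.2 using 1
    funext x; rcases x with x | x <;> rfl
  · exact b.2.1
  · funext x; rcases x with x | x <;> rfl
  · obtain ⟨L, hL, hLo⟩ := L
    rw [compat_glue] at hL
    have ha : ∀ i, L (Sum.inl i) = a i := fun i => congrFun hLo (Sum.inl i)
    have hc : ∀ i, L (Sum.inr (Sum.inr i)) = c i := fun i => congrFun hLo (Sum.inr i)
    refine ⟨?_, ?_⟩
    · convert hL.2 using 1
      funext x; rcases x with x | x
      · rfl
      · exact (hc x).symm
    · convert hL.1 using 1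
      funext x; rcases x with x | x
      · exact (ha x).symm
      · rfl
  · intro b; rfl
  · rintro ⟨L, hL, hLo⟩
    apply Subtype.ext
    have ha : ∀ i, L (Sum.inl i) = a i := fun i => congrFun hLo (Sum.inl i)
    have hc : ∀ i, L (Sum.inr (Sum.inr i)) = c i := fun i => congrFun hLo (Sum.inr i)
    funext x; rcases x with x | x | x
    · exact (ha x).symm
    · rfl
    · exact (hc x).symm

theorem relMat_smul_cancel {a b : ℕ} {s t : Setoid (Fin m ⊕ Fin n)}
    (h : 2 ^ a • relMat s = 2 ^ b • relMat t) : a = b ∧ s = t := by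
  have h1 := congrFun (congrFun h (fun _ => true)) (fun _ => true)
  have hc : ∀ s : Setoid (Fin m ⊕ Fin n),
      Compat s (Sum.elim (fun _ => true) (fun _ => true)) := by
    intro s x y _; rcases x with x | x <;> rcases y with y | y <;> rfl
  simp only [relMat, Matrix.smul_apply, hc, if_true, smul_eq_mul, mul_one] at h1
  have h2 := Nat.pow_right_injective le_rfl h1
  subst h2
  refine ⟨rfl, relMat_injective ?_⟩
  ext x y
  have := congrFun (congrFun h x) y
  simpa using this

end Diagram
namespace Diagram
variable {m n p r : ℕ}

/-! ### The stack of two diagrams is a diagram -/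

theorem pos_injective : Function.Injective (pos : Fin m ⊕ Fin n → ℕ) := by
  rintro (x | x) (y | y) h <;> simp only [pos] at h <;> congr 1 <;> (try apply Fin.ext) <;> omega

/-- The other end of the line through a dot. -/
noncomputable def partner (f : Diagram m n) (x : Fin m ⊕ Fin n) : Fin m ⊕ Fin n :=
  (f.pair x).choose

theorem partner_ne (f : Diagram m n) (x) : f.partner x ≠ x := (f.pair x).choose_spec.1.1

theorem rel_partner (f : Diagram m n) (x) : f.rel x (f.partner x) := (f.pair x).choose_spec.1.2

theorem eq_partner {f : Diagram m n} {x y} (h : f.rel x y) (hne : y ≠ x) : y = f.partner x :=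
  (f.pair x).choose_spec.2 y ⟨hne, h⟩

theorem partner_partner (f : Diagram m n) (x) : f.partner (f.partner x) = x :=
  (eq_partner (f.rel.symm (f.rel_partner x)) (f.partner_ne x).symm).symm

/-- The indicator of a proposition, modulo two. -/
noncomputable def ind (P : Prop) : ZMod 2 := open Classical in if P then 1 else 0

theorem ind_pos {P : Prop} (h : P) : ind P = 1 := if_pos h

theorem ind_neg {P : Prop} (h : ¬ P) : ind P = 0 := if_neg h

theorem sum_saturated (f : Diagram m n) (S : Fin m ⊕ Fin n → Prop)
    (hS : ∀ x, S x → S (f.partner x)) : ∑ x, ind (S x) = 0 := by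
  classical
  unfold ind
  rw [← Finset.sum_filter]
  refine Finset.sum_involution (fun x _ => f.partner x) ?_ ?_ ?_ ?_
  · intros; decide
  · intro a _ _; exact f.partner_ne a
  · intro a ha; simpa using hS a (by simpa using ha)
  · intro a _; exact f.partner_partner a

/-- Parity of the number of marked dots to the left of a dot. -/
noncomputable def row {n : ℕ} (S : Fin n → Prop) (i : Fin n) : ZMod 2 :=
  ∑ j, ind (S j ∧ j < i)

/-- Parity of the number of marked dots in the same row to the left of a dot. -/
noncomputable def lev (S : Fin m ⊕ Fin n → Prop) : Fin m ⊕ Fin n → ZMod 2 :=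
  Sum.elim (row (fun i => S (Sum.inl i))) (row (fun i => S (Sum.inr i)))

theorem lev_eq (S : Fin m ⊕ Fin n → Prop) (h0 : ∑ x, ind (S x) = 0)
    (x) (hx : ¬ S x) : lev S x = ∑ y, ind (S y ∧ pos y < pos x) := by
  rcases x with i | j
  · rw [Fintype.sum_sum_type]
    simp only [lev, Sum.elim_inl, row, pos]
    rw [Finset.sum_eq_zero (s := (Finset.univ : Finset (Fin n)))]
    · rw [add_zero]; rfl
    · intro j _
      refine ind_neg ?_; rintro ⟨-, h⟩; omega
  · rw [Fintype.sum_sum_type] at h0 ⊢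
    simp only [lev, Sum.elim_inr, row, pos]
    have e1 : ∀ i : Fin m, ind (S (Sum.inl i) ∧ (i : ℕ) < m + (n - 1 - j)) = ind (S (Sum.inl i)) := by
      intro i
      have : (i : ℕ) < m + (n - 1 - j) := by omega
      simp [this]
    rw [Finset.sum_congr rfl (fun i _ => e1 i)]
    have e2 : ∀ i : Fin n, ind (S (Sum.inr i)) = ind (S (Sum.inr i) ∧ i < j) +
        ind (S (Sum.inr i) ∧ m + (n - 1 - i) < m + (n - 1 - j)) := by
      intro i
      by_cases hS : S (Sum.inr i)
      · rcases lt_trichotomy i j with h | h | h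
        · rw [ind_pos hS, ind_pos ⟨hS, h⟩, ind_neg (by omega), add_zero]
        · subst h; exact (hx hS).elim
        · rw [ind_pos hS, ind_neg (by omega), ind_pos ⟨hS, by omega⟩, zero_add]
      · rw [ind_neg hS, ind_neg (fun h => hS h.1), ind_neg (fun h => hS h.1), zero_add]
    rw [Finset.sum_congr rfl (fun i _ => e2 i), Finset.sum_add_distrib] at h0
    have e3 : ∀ a b c : ZMod 2, a + (b + c) = 0 → b = a + c := by decide
    exact e3 _ _ _ h0

theorem lev_congr (f : Diagram m n) (S : Fin m ⊕ Fin n → Prop) (hS : ∀ x y, f.rel x y → S x → S y)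
    {x y} (h : f.rel x y) (hx : ¬ S x) : lev S x = lev S y := by
  classical
  wlog hlt : pos x < pos y generalizing x y
  · rcases Nat.lt_or_ge (pos y) (pos x) with h' | h'
    · exact (this (f.rel.symm h) (fun h2 => hx (hS _ _ (f.rel.symm h) h2)) h').symm
    · rw [pos_injective (le_antisymm h' (not_lt.1 hlt))]
  have hS' : ∀ x, S x → S (f.partner x) := fun x => hS _ _ (f.rel_partner x)
  have hy : ¬ S y := fun h2 => hx (hS _ _ (f.rel.symm h) h2)
  rw [lev_eq S (f.sum_saturated S hS') x hx, lev_eq S (f.sum_saturated S hS') y hy]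
  have e : ∀ z, ind (S z ∧ pos z < pos y) =
      ind (S z ∧ pos z < pos x) + ind (S z ∧ pos x < pos z ∧ pos z < pos y) := by
    intro z
    by_cases hz : S z
    · rcases lt_trichotomy (pos z) (pos x) with h1 | h1 | h1
      · rw [ind_pos ⟨hz, h1.trans hlt⟩, ind_pos ⟨hz, h1⟩, ind_neg (by omega), add_zero]
      · rw [pos_injective h1] at hz; exact (hx hz).elim
      · rw [ind_neg (P := _ ∧ pos z < pos x) (by omega), zero_add]
        simp [h1]
    · rw [ind_neg (fun h => hz h.1), ind_neg (fun h => hz h.1), ind_neg (fun h => hz h.1), zero_add]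
  rw [Finset.sum_congr rfl (fun z _ => e z), Finset.sum_add_distrib]
  have : ∑ z, ind (S z ∧ pos x < pos z ∧ pos z < pos y) = 0 := by
    refine sum_saturated f (fun z => S z ∧ pos x < pos z ∧ pos z < pos y) ?_
    rintro z ⟨hz, h1, h2⟩
    have hz' := hS' z hz
    have hr := f.rel_partner z
    refine ⟨hz', ?_, ?_⟩
    · rcases lt_trichotomy (pos x) (pos (f.partner z)) with h3 | h3 | h3
      · exact h3
      · rw [← pos_injective h3] at hz'; exact (hx hz').elim
      · exact (f.planar _ _ _ _ h3 h1 h2 (f.rel.symm hr) h).elim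
    · rcases lt_trichotomy (pos (f.partner z)) (pos y) with h3 | h3 | h3
      · exact h3
      · rw [pos_injective h3] at hz'; exact (hy hz').elim
      · exact (f.planar _ _ _ _ h1 h2 h3 h hr).elim
  rw [this, add_zero]

/-- A component of the stacked picture has an even number of outer dots. -/
theorem sum_outer (f : Diagram m n) (g : Diagram n p) (K : Fin m ⊕ (Fin n ⊕ Fin p) → Prop)
    (hK : ∀ s t, glue f g s t → K s → K t) : ∑ x, ind (K (outer x)) = 0 := by
  have h1 := f.sum_saturated (fun x => K (lo x)) (fun x h => hK _ _ (glue_lo (f.rel_partner x)) h)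
  have h2 := g.sum_saturated (fun x => K (hi x)) (fun x h => hK _ _ (glue_hi (g.rel_partner x)) h)
  rw [Fintype.sum_sum_type] at h1 h2 ⊢
  have e : ∀ a b c : ZMod 2, a + b = 0 → b + c = 0 → a + c = 0 := by decide
  exact e _ _ _ h1 h2

theorem card_le_two_of_degree {V : Type} [Fintype V] [DecidableEq V] (G : SimpleGraph V)
    [DecidableRel G.Adj] (hG : G.Connected) (O : V → Prop) [DecidablePred O]
    (h : ∀ u, G.degree u + (if O u then 1 else 0) ≤ 2) : (Finset.univ.filter O).card ≤ 2 := by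
  have hsum := Finset.sum_le_sum (s := Finset.univ) (fun u _ => h u)
  rw [Finset.sum_add_distrib, G.sum_degrees_eq_twice_card_edges] at hsum
  have hE := hG.card_vert_le_card_edgeSet_add_one
  rw [Nat.card_eq_fintype_card, Nat.card_eq_fintype_card, ← SimpleGraph.edgeFinset_card] at hE
  simp only [Finset.sum_const, Finset.card_univ, smul_eq_mul, Finset.sum_boole, Nat.cast_id] at hsum
  have h2 : (Finset.univ.filter fun x => O x).card ≤ 2 := by omega
  exact h2

/-- A component of the stacked picture has at most two outer dots. -/
theorem outer_le_two (f : Diagram m n) (g : Diagram n p) {x y z : Fin m ⊕ Fin p}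
    (hy : glue f g (outer x) (outer y)) (hz : glue f g (outer x) (outer z))
    (hxy : x ≠ y) (hxz : x ≠ z) (hyz : y ≠ z) : False := by
  classical
  let V := {t // glue f g (outer x) t}
  let R : Fin m ⊕ (Fin n ⊕ Fin p) → Fin m ⊕ (Fin n ⊕ Fin p) → Prop := fun s t =>
    (∃ a b, f.rel a b ∧ s = lo a ∧ t = lo b) ∨ (∃ a b, g.rel a b ∧ s = hi a ∧ t = hi b)
  have hRs : ∀ s t, R s t → R t s := by
    rintro s t (⟨a, b, h, h1, h2⟩ | ⟨a, b, h, h1, h2⟩)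
    · exact Or.inl ⟨b, a, f.rel.symm h, h2, h1⟩
    · exact Or.inr ⟨b, a, g.rel.symm h, h2, h1⟩
  let G : SimpleGraph V :=
    { Adj := fun u v => u ≠ v ∧ R u.1 v.1
      symm := ⟨fun u v h => ⟨h.1.symm, hRs _ _ h.2⟩⟩
      loopless := ⟨fun u h => h.1 rfl⟩ }
  have hreach : ∀ t (h : glue f g (outer x) t), G.Reachable ⟨outer x, (glue f g).refl _⟩ ⟨t, h⟩ := by
    have step : ∀ s t, R s t → glue f g s t →
        (∃ h : glue f g (outer x) s, G.Reachable ⟨outer x, (glue f g).refl _⟩ ⟨s, h⟩) →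
        ∃ h : glue f g (outer x) t, G.Reachable ⟨outer x, (glue f g).refl _⟩ ⟨t, h⟩ := by
      rintro s t hR hst ⟨h, hr⟩
      refine ⟨(glue f g).trans h hst, ?_⟩
      by_cases hst' : s = t
      · subst hst'; exact hr
      · refine hr.trans (SimpleGraph.Adj.reachable ⟨?_, hR⟩)
        intro h'; exact hst' (congrArg Subtype.val h')
    intro t ht
    obtain ⟨h, hr⟩ := (glue_induction
      (P := fun t => ∃ h : glue f g (outer x) t, G.Reachable ⟨outer x, (glue f g).refl _⟩ ⟨t, h⟩)
      (fun a b h => step _ _ (Or.inl ⟨a, b, h, rfl, rfl⟩) (glue_lo h))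
      (fun a b h => step _ _ (Or.inr ⟨a, b, h, rfl, rfl⟩) (glue_hi h)) ht).1
      ⟨(glue f g).refl _, SimpleGraph.Reachable.refl _⟩
    exact hr
  have hconn : G.Connected :=
    { preconnected := fun u v => (hreach u.1 u.2).symm.trans (hreach v.1 v.2)
      nonempty := ⟨⟨outer x, (glue f g).refl _⟩⟩ }
  let nb : Fin m ⊕ (Fin n ⊕ Fin p) → Finset (Fin m ⊕ (Fin n ⊕ Fin p)) := fun t => match t with
    | Sum.inl i => {lo (f.partner (Sum.inl i))}
    | Sum.inr (Sum.inl j) => {lo (f.partner (Sum.inr j)), hi (g.partner (Sum.inl j))}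
    | Sum.inr (Sum.inr l) => {hi (g.partner (Sum.inr l))}
  have hnb : ∀ s t, s ≠ t → R s t → t ∈ nb s := by
    rintro s t hst (⟨a, b, h, rfl, rfl⟩ | ⟨a, b, h, rfl, rfl⟩)
    · have hb := eq_partner h (fun h' => hst (by rw [h']))
      subst hb
      rcases a with a | a
      · exact Finset.mem_singleton_self _
      · exact Finset.mem_insert_self _ _
    · have hb := eq_partner h (fun h' => hst (by rw [h']))
      subst hb
      rcases a with a | a
      · exact Finset.mem_insert_of_mem (Finset.mem_singleton_self _)
      · exact Finset.mem_singleton_self _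
  let O : V → Prop := fun u => ∃ w : Fin m ⊕ Fin p, u.1 = outer w
  have hdeg : ∀ u : V, G.degree u + (if O u then 1 else 0) ≤ 2 := by
    rintro ⟨u, hu⟩
    have h1 : G.degree ⟨u, hu⟩ ≤ (nb u).card := by
      rw [← SimpleGraph.card_neighborFinset_eq_degree,
        ← Finset.card_map (Function.Embedding.subtype _)]
      apply Finset.card_le_card
      intro t ht
      simp only [Finset.mem_map, SimpleGraph.mem_neighborFinset] at ht
      obtain ⟨v, hv, rfl⟩ := ht
      exact hnb _ _ (fun h' => hv.1 (Subtype.ext h')) hv.2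
    have h2 : (nb u).card + (if O ⟨u, hu⟩ then 1 else 0) ≤ 2 := by
      rcases u with u | u | u
      · simp only [nb, Finset.card_singleton]; split_ifs <;> omega
      · have : ¬ O ⟨Sum.inr (Sum.inl u), hu⟩ := by
          rintro ⟨w | w, hw⟩ <;> simp [outer] at hw
        rw [if_neg this]
        exact Finset.card_le_two
      · simp only [nb, Finset.card_singleton]; split_ifs <;> omega
    omega
  have h2 := card_le_two_of_degree G hconn O (fun u => by convert hdeg u)
  have h3 : 3 ≤ (Finset.univ.filter O).card := by
    have hinj : ∀ a b : Fin m ⊕ Fin p, (outer a : Fin m ⊕ (Fin n ⊕ Fin p)) = outer b → a = b := by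
      rintro (a | a) (b | b) h <;> simp [outer] at h <;> rw [h]
    let v : ∀ w, glue f g (outer x) (outer w) → V := fun w h => ⟨outer w, h⟩
    have hsub : ({v x ((glue f g).refl _), v y hy, v z hz} : Finset V) ⊆ Finset.univ.filter O := by
      intro u hu
      simp only [Finset.mem_insert, Finset.mem_singleton] at hu
      simp only [Finset.mem_filter, Finset.mem_univ, true_and]
      rcases hu with rfl | rfl | rfl
      exacts [⟨_, rfl⟩, ⟨_, rfl⟩, ⟨_, rfl⟩]
    refine le_trans ?_ (Finset.card_le_card hsub)
    rw [Finset.card_eq_three.2 ⟨_, _, _, ?_, ?_, ?_, rfl⟩]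
    · intro h; exact hxy (hinj _ _ (congrArg Subtype.val h))
    · intro h; exact hxz (hinj _ _ (congrArg Subtype.val h))
    · intro h; exact hyz (hinj _ _ (congrArg Subtype.val h))
  omega

/-- Vertical stacking: `f` below, `g` on top, with the loops removed. -/
def comp (f : Diagram m n) (g : Diagram n p) : Diagram m p where
  rel := (glue f g).comap outer
  pair := by
    classical
    intro x
    have h := sum_outer f g (fun t => glue f g (outer x) t) (fun s t h h' => (glue f g).trans h' h)
    have hex : ∃ y, y ≠ x ∧ glue f g (outer x) (outer y) := by
      by_contra hno
      push Not at hno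
      rw [Finset.sum_eq_single x] at h
      · rw [ind_pos ((glue f g).refl _)] at h; exact one_ne_zero h
      · intro y _ hy; exact ind_neg (hno y hy)
      · intro h'; exact (h' (Finset.mem_univ _)).elim
    obtain ⟨y, hy, hr⟩ := hex
    refine ⟨y, ⟨hy, hr⟩, ?_⟩
    rintro z ⟨hz, hr'⟩
    by_contra hne
    exact outer_le_two f g hr hr' hy.symm hz.symm (Ne.symm hne)
  planar := by
    classical
    intro a b c d hab hbc hcd hac hbd
    have hac' : glue f g (outer a) (outer c) := hac
    have hbd' : glue f g (outer b) (outer d) := hbd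
    let K : Fin m ⊕ (Fin n ⊕ Fin p) → Prop := fun t => glue f g (outer a) t
    have hK : ∀ s t, glue f g s t → K s → K t := fun s t h h' => (glue f g).trans h' h
    have hne : ∀ {x y : Fin m ⊕ Fin p}, pos x < pos y → x ≠ y := by
      rintro x y h rfl; exact lt_irrefl _ h
    have hKac : ∀ x, K (outer x) ↔ x = a ∨ x = c := by
      intro x
      constructor
      · intro hx
        by_contra hno
        push Not at hno
        exact outer_le_two f g hac' hx (hne (hab.trans hbc)) hno.1.symm hno.2.symm
      · rintro (rfl | rfl)
        exacts [(glue f g).refl _, hac']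
    have hb : ¬ K (outer b) := by
      rw [hKac]; rintro (h | h)
      exacts [hne hab h.symm, hne hbc h]
    have hd : ¬ K (outer d) := by
      rw [hKac]; rintro (h | h)
      exacts [hne (hab.trans (hbc.trans hcd)) h.symm, hne hcd h.symm]
    let lv : Fin m ⊕ (Fin n ⊕ Fin p) → ZMod 2 := Sum.elim (row fun i => K (Sum.inl i))
      (Sum.elim (row fun i => K (Sum.inr (Sum.inl i))) (row fun i => K (Sum.inr (Sum.inr i))))
    have hlo : ∀ x, lv (lo x) = lev (fun x => K (lo x)) x := by rintro (x | x) <;> rfl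
    have hhi : ∀ x, lv (hi x) = lev (fun x => K (hi x)) x := by rintro (x | x) <;> rfl
    have hou : ∀ x, lv (outer x) = lev (fun x => K (outer x)) x := by rintro (x | x) <;> rfl
    have key : lv (outer b) = lv (outer d) := by
      refine ((glue_induction (P := fun t => ¬ K t ∧ lv (outer b) = lv t) ?_ ?_ hbd').1
        ⟨hb, rfl⟩).2
      · rintro s t h ⟨h1, h2⟩
        refine ⟨fun h3 => h1 (hK _ _ (glue_lo (f.rel.symm h)) h3), ?_⟩
        rw [h2, hlo, hlo]
        exact f.lev_congr _ (fun x y h => hK _ _ (glue_lo h)) h h1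
      · rintro s t h ⟨h1, h2⟩
        refine ⟨fun h3 => h1 (hK _ _ (glue_hi (g.rel.symm h)) h3), ?_⟩
        rw [h2, hhi, hhi]
        exact g.lev_congr _ (fun x y h => hK _ _ (glue_hi h)) h h1
    have h0 := sum_outer f g K hK
    rw [hou, hou, lev_eq _ h0 _ hb, lev_eq _ h0 _ hd] at key
    simp only [hKac] at key
    rw [Finset.sum_eq_single a, Finset.sum_eq_add a c (hne (hab.trans hbc)),
      ind_pos ⟨Or.inl rfl, hab⟩, ind_pos ⟨Or.inl rfl, hab.trans (hbc.trans hcd)⟩,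
      ind_pos ⟨Or.inr rfl, hcd⟩] at key
    · exact absurd key (by decide)
    · rintro x _ ⟨h1, h2⟩; exact ind_neg (by simp [h1, h2])
    · simp
    · simp
    · intro x _ h1
      refine ind_neg ?_
      rintro ⟨rfl | rfl, h2⟩
      · exact h1 rfl
      · omega
    · simp

end Diagram
namespace Diagram
variable {m n p r m₁ m₂ m₃ n₁ n₂ n₃ p₁ p₂ : ℕ}

theorem relMat_comp (f : Diagram m n) (g : Diagram n p) :
    relMat f.rel * relMat g.rel = 2 ^ loops f g • relMat (comp f g).rel := relMat_mul f g

theorem ext_compat {f g : Diagram m n}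
    (h : ∀ a b, Compat f.rel (Sum.elim a b) ↔ Compat g.rel (Sum.elim a b)) : f = g := by
  apply Diagram.ext
  apply setoid_eq_of_compat
  intro l
  have := h (l ∘ Sum.inl) (l ∘ Sum.inr)
  rwa [Sum.elim_comp_inl_inr] at this

theorem comp_assoc' (f : Diagram m n) (g : Diagram n p) (h : Diagram p r) :
    loops f g + loops (comp f g) h = loops g h + loops f (comp g h) ∧
      comp (comp f g) h = comp f (comp g h) := by
  have key := Matrix.mul_assoc (relMat f.rel) (relMat g.rel) (relMat h.rel)
  rw [relMat_comp, relMat_comp, Matrix.smul_mul, Matrix.mul_smul, relMat_comp, relMat_comp,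
    smul_smul, smul_smul, ← pow_add, ← pow_add] at key
  exact ⟨(relMat_smul_cancel key).1, Diagram.ext (relMat_smul_cancel key).2⟩

/-- The identity diagram: `n` vertical lines. -/
def id (n : ℕ) : Diagram n n where
  rel := Setoid.ker (Sum.elim _root_.id _root_.id)
  pair := by
    rintro (x | x)
    · refine ⟨Sum.inr x, ⟨by simp, rfl⟩, ?_⟩
      rintro (y | y) ⟨h1, h2⟩
      · exact (h1 (congrArg Sum.inl (Eq.symm h2))).elim
      · exact congrArg Sum.inr (Eq.symm h2)
    · refine ⟨Sum.inl x, ⟨by simp, rfl⟩, ?_⟩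
      rintro (y | y) ⟨h1, h2⟩
      · exact congrArg Sum.inl (Eq.symm h2)
      · exact (h1 (congrArg Sum.inr (Eq.symm h2))).elim
  planar := by
    rintro (a | a) (b | b) (c | c) (d | d) h1 h2 h3 h4 h5 <;>
    simp only [Setoid.ker_def, Sum.elim_inl, Sum.elim_inr, id_eq] at h4 h5 <;> subst h4 <;>
    subst h5 <;> simp only [pos] at h1 h2 h3 <;> omega

theorem compat_id {a b : Fin n → Bool} : Compat (id n).rel (Sum.elim a b) ↔ a = b := by
  constructor
  · intro h; funext i; exact h (Sum.inl i) (Sum.inr i) rfl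
  · rintro rfl x y h
    have h' : Sum.elim _root_.id _root_.id x = Sum.elim _root_.id _root_.id y := h
    rcases x with x | x <;> rcases y with y | y <;> exact congrArg a h'

theorem relMat_id : relMat (id n).rel = 1 := by
  classical
  ext a b
  simp [relMat, compat_id, Matrix.one_apply]

theorem id_comp' (f : Diagram m n) : loops (id m) f = 0 ∧ comp (id m) f = f := by
  have key := relMat_comp (id m) f
  rw [relMat_id, Matrix.one_mul] at key
  have := relMat_smul_cancel (a := 0) (s := f.rel) ((by simp : _ = relMat f.rel).trans key)
  exact ⟨this.1.symm, Diagram.ext this.2.symm⟩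

theorem comp_id' (f : Diagram m n) : loops f (id n) = 0 ∧ comp f (id n) = f := by
  have key := relMat_comp f (id n)
  rw [relMat_id, Matrix.mul_one] at key
  have := relMat_smul_cancel (a := 0) (s := f.rel) ((by simp : _ = relMat f.rel).trans key)
  exact ⟨this.1.symm, Diagram.ext this.2.symm⟩

/-! ### Horizontal juxtaposition -/

/-- The dots of two diagrams next to each other. -/
def split : (Fin m₁ ⊕ Fin n₁) ⊕ (Fin m₂ ⊕ Fin n₂) ≃ Fin (m₁ + m₂) ⊕ Fin (n₁ + n₂) :=
  (Equiv.sumSumSumComm _ _ _ _).trans (Equiv.sumCongr finSumFinEquiv finSumFinEquiv)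

/-- The relation on the dots of two diagrams next to each other. -/
def sumRel (f : Diagram m₁ n₁) (g : Diagram m₂ n₂) :
    Setoid ((Fin m₁ ⊕ Fin n₁) ⊕ (Fin m₂ ⊕ Fin n₂)) where
  r := Sum.LiftRel f.rel g.rel
  iseqv :=
    { refl := by
        rintro (x | x)
        exacts [Sum.LiftRel.inl (f.rel.refl x), Sum.LiftRel.inr (g.rel.refl x)]
      symm := by
        rintro _ _ (h | h)
        exacts [Sum.LiftRel.inl (f.rel.symm h), Sum.LiftRel.inr (g.rel.symm h)]
      trans := by
        rintro _ _ _ (h | h) (h' | h')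
        exacts [Sum.LiftRel.inl (f.rel.trans h h'), Sum.LiftRel.inr (g.rel.trans h h')] }

theorem pos_split_inl (x : Fin m₁ ⊕ Fin n₁) :
    pos (split (Sum.inl x) : Fin (m₁ + m₂) ⊕ Fin (n₁ + n₂)) =
      if x.isLeft then pos x else pos x + (m₂ + n₂) := by
  rcases x with x | x
  · simp [split, pos]
  · simp [split, pos]; omega

theorem pos_split_inr (x : Fin m₂ ⊕ Fin n₂) :
    pos (split (Sum.inr x) : Fin (m₁ + m₂) ⊕ Fin (n₁ + n₂)) = m₁ + pos x := by
  rcases x with x | x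
  · simp [split, pos]
  · simp [split, pos]; omega

theorem pos_lt (x : Fin m ⊕ Fin n) : pos x < m + n ∧ (x.isLeft ↔ pos x < m) := by
  rcases x with x | x
  · simp [pos]; omega
  · simp [pos]; omega

/-- Horizontal juxtaposition: `f` on the left, `g` on the right. -/
def tensor (f : Diagram m₁ n₁) (g : Diagram m₂ n₂) : Diagram (m₁ + m₂) (n₁ + n₂) where
  rel := (sumRel f g).comap split.symm
  pair := by
    intro x
    obtain ⟨x, rfl⟩ := split.surjective x
    rcases x with x | x
    · refine ⟨split (Sum.inl (f.partner x)), ⟨?_, ?_⟩, ?_⟩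
      · simp [f.partner_ne x]
      · rw [Setoid.comap_rel, Equiv.symm_apply_apply, Equiv.symm_apply_apply]
        exact Sum.LiftRel.inl (f.rel_partner x)
      · rintro y ⟨h1, h2⟩
        obtain ⟨y, rfl⟩ := split.surjective y
        rw [Setoid.comap_rel, Equiv.symm_apply_apply, Equiv.symm_apply_apply] at h2
        rcases h2 with h2 | h2
        rw [eq_partner h2 (fun h => h1 (by rw [h]))]
    · refine ⟨split (Sum.inr (g.partner x)), ⟨?_, ?_⟩, ?_⟩
      · simp [g.partner_ne x]
      · rw [Setoid.comap_rel, Equiv.symm_apply_apply, Equiv.symm_apply_apply]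
        exact Sum.LiftRel.inr (g.rel_partner x)
      · rintro y ⟨h1, h2⟩
        obtain ⟨y, rfl⟩ := split.surjective y
        rw [Setoid.comap_rel, Equiv.symm_apply_apply, Equiv.symm_apply_apply] at h2
        rcases h2 with h2 | h2
        rw [eq_partner h2 (fun h => h1 (by rw [h]))]
  planar := by
    intro a b c d h1 h2 h3 h4 h5
    obtain ⟨a, rfl⟩ := split.surjective a
    obtain ⟨b, rfl⟩ := split.surjective b
    obtain ⟨c, rfl⟩ := split.surjective c
    obtain ⟨d, rfl⟩ := split.surjective d
    rw [Setoid.comap_rel, Equiv.symm_apply_apply, Equiv.symm_apply_apply] at h4 h5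
    rcases h4 with @⟨a, c, h4⟩ | @⟨a, c, h4⟩ <;> rcases h5 with @⟨b, d, h5⟩ | @⟨b, d, h5⟩ <;>
    simp only [pos_split_inl, pos_split_inr] at h1 h2 h3 <;>
    have ha := pos_lt a <;> have hb := pos_lt b <;> have hc := pos_lt c <;> have hd := pos_lt d
    · refine f.planar a b c d ?_ ?_ ?_ h4 h5 <;> split_ifs at h1 h2 h3 <;> simp_all <;> omega
    · split_ifs at h1 h2 h3 <;> simp_all <;> omega
    · split_ifs at h1 h2 h3 <;> simp_all <;> omega
    · exact g.planar a b c d (by omega) (by omega) (by omega) h4 h5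

theorem compat_tensor {f : Diagram m₁ n₁} {g : Diagram m₂ n₂} {a b} :
    Compat (tensor f g).rel (Sum.elim a b) ↔
      Compat f.rel (Sum.elim (fun i => a (Fin.castAdd m₂ i)) (fun i => b (Fin.castAdd n₂ i))) ∧
      Compat g.rel (Sum.elim (fun i => a (Fin.natAdd m₁ i)) (fun i => b (Fin.natAdd n₁ i))) := by
  have e1 : ∀ x : Fin m₁ ⊕ Fin n₁, Sum.elim (fun i => a (Fin.castAdd m₂ i))
      (fun i => b (Fin.castAdd n₂ i)) x = Sum.elim a b (split (Sum.inl x)) := by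
    rintro (x | x) <;> simp [split]
  have e2 : ∀ x : Fin m₂ ⊕ Fin n₂, Sum.elim (fun i => a (Fin.natAdd m₁ i))
      (fun i => b (Fin.natAdd n₁ i)) x = Sum.elim a b (split (Sum.inr x)) := by
    rintro (x | x) <;> simp [split]
  constructor
  · intro h
    refine ⟨fun x y hxy => ?_, fun x y hxy => ?_⟩
    · rw [e1, e1]; apply h
      change sumRel f g (split.symm (split (Sum.inl x))) (split.symm (split (Sum.inl y)))
      rw [Equiv.symm_apply_apply, Equiv.symm_apply_apply]
      exact Sum.LiftRel.inl hxy
    · rw [e2, e2]; apply h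
      change sumRel f g (split.symm (split (Sum.inr x))) (split.symm (split (Sum.inr y)))
      rw [Equiv.symm_apply_apply, Equiv.symm_apply_apply]
      exact Sum.LiftRel.inr hxy
  · rintro ⟨h1, h2⟩ x y hxy
    obtain ⟨x, rfl⟩ := split.surjective x
    obtain ⟨y, rfl⟩ := split.surjective y
    change sumRel f g (split.symm (split x)) (split.symm (split y)) at hxy
    rw [Equiv.symm_apply_apply, Equiv.symm_apply_apply] at hxy
    rcases hxy with h | h
    · rw [← e1, ← e1]; exact h1 _ _ h
    · rw [← e2, ← e2]; exact h2 _ _ h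

theorem relMat_tensor (f : Diagram m₁ n₁) (g : Diagram m₂ n₂) (a b) :
    relMat (tensor f g).rel a b =
      relMat f.rel (fun i => a (Fin.castAdd m₂ i)) (fun i => b (Fin.castAdd n₂ i)) *
      relMat g.rel (fun i => a (Fin.natAdd m₁ i)) (fun i => b (Fin.natAdd n₁ i)) := by
  classical
  simp only [relMat, compat_tensor]
  split_ifs <;> simp_all

theorem tensor_comp' (f : Diagram m₁ n₁) (g : Diagram m₂ n₂) (f' : Diagram n₁ p₁)
    (g' : Diagram n₂ p₂) :
    loops (tensor f g) (tensor f' g') = loops f f' + loops g g' ∧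
      comp (tensor f g) (tensor f' g') = tensor (comp f f') (comp g g') := by
  have key : relMat (tensor f g).rel * relMat (tensor f' g').rel =
      2 ^ (loops f f' + loops g g') • relMat (tensor (comp f f') (comp g g')).rel := by
    ext a c
    rw [Matrix.smul_apply, relMat_tensor]
    have h1 := congrFun (congrFun (relMat_comp f f') (fun i => a (Fin.castAdd m₂ i)))
      (fun i => c (Fin.castAdd p₂ i))
    have h2 := congrFun (congrFun (relMat_comp g g') (fun i => a (Fin.natAdd m₁ i)))
      (fun i => c (Fin.natAdd p₁ i))
    rw [Matrix.smul_apply, Matrix.mul_apply] at h1 h2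
    rw [pow_add, smul_eq_mul, mul_mul_mul_comm, ← smul_eq_mul (2 ^ loops f f'),
      ← smul_eq_mul (2 ^ loops g g'), ← h1, ← h2, Finset.sum_mul_sum, ← Finset.sum_product',
      Finset.univ_product_univ, Matrix.mul_apply, ← (Fin.appendEquiv n₁ n₂).sum_comp]
    refine Finset.sum_congr rfl (fun b _ => ?_)
    simp only [relMat_tensor, Fin.appendEquiv, Equiv.coe_fn_mk, Fin.append_left, Fin.append_right]
    ring
  rw [relMat_comp] at key
  exact ⟨(relMat_smul_cancel key).1, Diagram.ext (relMat_smul_cancel key).2⟩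

theorem tensor_id' : tensor (id m) (id n) = id (m + n) := by
  apply ext_compat
  intro a b
  rw [compat_tensor, compat_id, compat_id, compat_id]
  constructor
  · rintro ⟨h1, h2⟩
    funext i
    refine Fin.addCases (fun i => ?_) (fun i => ?_) i
    exacts [congrFun h1 i, congrFun h2 i]
  · rintro rfl; exact ⟨rfl, rfl⟩

/-- Transport along equalities of the numbers of dots. -/
def cast {m' n' : ℕ} (hm : m = m') (hn : n = n') (f : Diagram m n) : Diagram m' n' := hm ▸ hn ▸ f

theorem compat_cast {m' n' : ℕ} (hm : m = m') (hn : n = n') (f : Diagram m n) {a b} :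
    Compat (cast hm hn f).rel (Sum.elim a b) ↔
      Compat f.rel (Sum.elim (fun i => a (Fin.cast hm i)) (fun i => b (Fin.cast hn i))) := by
  subst hm hn; rfl

theorem tensor_assoc' (f : Diagram m₁ n₁) (g : Diagram m₂ n₂) (h : Diagram m₃ n₃) :
    cast (Nat.add_assoc _ _ _) (Nat.add_assoc _ _ _) (tensor (tensor f g) h) =
      tensor f (tensor g h) := by
  apply ext_compat
  intro a b
  have e : ∀ (a b c : ℕ) (i : Fin c), Fin.cast (Nat.add_assoc a b c) (Fin.natAdd (a + b) i) =
      Fin.natAdd a (Fin.natAdd b i) := fun a b c i => Fin.ext (Nat.add_assoc _ _ _)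
  simp only [compat_cast, compat_tensor, and_assoc, e]
  rfl

theorem tensor_zero' (f : Diagram m n) : tensor f (id 0) = f := by
  apply ext_compat
  intro a b
  rw [compat_tensor, compat_id, and_iff_left (Subsingleton.elim _ _)]
  rfl

theorem zero_tensor' (f : Diagram m n) :
    cast (Nat.zero_add _) (Nat.zero_add _) (tensor (id 0) f) = f := by
  apply ext_compat
  intro a b
  rw [compat_cast, compat_tensor, compat_id, and_iff_right (Subsingleton.elim _ _)]
  simp only [Fin.natAdd_zero, Fin.cast_cast]
  rfl

/-- The cup: a single line joining two top dots. -/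
def cup : Diagram 0 2 where
  rel := ⊤
  pair := by
    rintro (x | x)
    · exact x.elim0
    · fin_cases x
      · refine ⟨Sum.inr 1, ⟨by simp, trivial⟩, ?_⟩
        rintro (y | y) ⟨h, -⟩
        · exact y.elim0
        · fin_cases y
          · exact (h rfl).elim
          · rfl
      · refine ⟨Sum.inr 0, ⟨by simp, trivial⟩, ?_⟩
        rintro (y | y) ⟨h, -⟩
        · exact y.elim0
        · fin_cases y
          · rfl
          · exact (h rfl).elim
  planar := by
    rintro (a | a) (b | b) (c | c) (d | d) h1 h2 h3 <;> simp only [pos] at h1 h2 h3 <;> omega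

/-- The cap: a single line joining two bottom dots. -/
def cap : Diagram 2 0 where
  rel := ⊤
  pair := by
    rintro (x | x)
    · fin_cases x
      · refine ⟨Sum.inl 1, ⟨by simp, trivial⟩, ?_⟩
        rintro (y | y) ⟨h, -⟩
        · fin_cases y
          · exact (h rfl).elim
          · rfl
        · exact y.elim0
      · refine ⟨Sum.inl 0, ⟨by simp, trivial⟩, ?_⟩
        rintro (y | y) ⟨h, -⟩
        · fin_cases y
          · rfl
          · exact (h rfl).elim
        · exact y.elim0
    · exact x.elim0
  planar := by
    rintro (a | a) (b | b) (c | c) (d | d) h1 h2 h3 <;> simp only [pos] at h1 h2 h3 <;> omega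

end Diagram
namespace Diagram

theorem relMat_cup (a b) : relMat cup.rel a b = if b 0 = b 1 then 1 else 0 := by
  have : Compat cup.rel (Sum.elim a b) ↔ b 0 = b 1 := by
    constructor
    · intro h; exact h (Sum.inr 0) (Sum.inr 1) trivial
    · rintro h (x | x) (y | y) -
      · exact x.elim0
      · exact x.elim0
      · exact y.elim0
      · fin_cases x <;> fin_cases y <;> simp [h]
  simp only [relMat, this]

theorem relMat_cap (a b) : relMat cap.rel a b = if a 0 = a 1 then 1 else 0 := by
  have : Compat cap.rel (Sum.elim a b) ↔ a 0 = a 1 := by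
    constructor
    · intro h; exact h (Sum.inl 0) (Sum.inl 1) trivial
    · rintro h (x | x) (y | y) -
      · fin_cases x <;> fin_cases y <;> simp [h]
      · exact y.elim0
      · exact x.elim0
      · exact x.elim0
  simp only [relMat, this]

theorem cup_cap : loops cup cap = 1 ∧ comp cup cap = id 0 := by
  have key := relMat_comp cup cap
  have h2 : relMat cup.rel * relMat cap.rel = 2 ^ 1 • relMat (id 0).rel := by
    ext a b
    rw [relMat_id, Matrix.mul_apply]
    simp only [relMat_cup, relMat_cap]
    revert a b; decide
  have := relMat_smul_cancel (key.symm.trans h2)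
  exact ⟨this.1, Diagram.ext this.2⟩

/-- A line with a cup on its right. -/
def lineCup : Diagram 1 3 := tensor (m₁ := 1) (m₂ := 0) (n₁ := 1) (n₂ := 2) (id 1) cup

/-- A line with a cup on its left. -/
def cupLine : Diagram 1 3 := tensor (m₁ := 0) (m₂ := 1) (n₁ := 2) (n₂ := 1) cup (id 1)

/-- A line with a cap on its right. -/
def lineCap : Diagram 3 1 := tensor (m₁ := 1) (m₂ := 2) (n₁ := 1) (n₂ := 0) (id 1) cap

/-- A line with a cap on its left. -/
def capLine : Diagram 3 1 := tensor (m₁ := 2) (m₂ := 1) (n₁ := 0) (n₂ := 1) cap (id 1)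

theorem relMat_lineCup (a b) :
    relMat lineCup.rel a b = if a 0 = b 0 ∧ b 1 = b 2 then 1 else 0 := by
  refine (relMat_tensor (m₁ := 1) (m₂ := 0) (n₁ := 1) (n₂ := 2) (id 1) cup a b).trans ?_
  rw [relMat_id, relMat_cup, Matrix.one_apply]
  revert a b; decide

theorem relMat_cupLine (a b) :
    relMat cupLine.rel a b = if b 0 = b 1 ∧ a 0 = b 2 then 1 else 0 := by
  refine (relMat_tensor (m₁ := 0) (m₂ := 1) (n₁ := 2) (n₂ := 1) cup (id 1) a b).trans ?_
  rw [relMat_id, relMat_cup, Matrix.one_apply]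
  revert a b; decide

theorem relMat_lineCap (a b) :
    relMat lineCap.rel a b = if a 0 = b 0 ∧ a 1 = a 2 then 1 else 0 := by
  refine (relMat_tensor (m₁ := 1) (m₂ := 2) (n₁ := 1) (n₂ := 0) (id 1) cap a b).trans ?_
  rw [relMat_id, relMat_cap, Matrix.one_apply]
  revert a b; decide

theorem relMat_capLine (a b) :
    relMat capLine.rel a b = if a 0 = a 1 ∧ a 2 = b 0 then 1 else 0 := by
  refine (relMat_tensor (m₁ := 2) (m₂ := 1) (n₁ := 0) (n₂ := 1) cap (id 1) a b).trans ?_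
  rw [relMat_id, relMat_cap, Matrix.one_apply]
  revert a b; decide

theorem zigzag_left : loops lineCup capLine = 0 ∧ comp lineCup capLine = id 1 := by
  have key := relMat_comp lineCup capLine
  have h2 : relMat lineCup.rel * relMat capLine.rel = 2 ^ 0 • relMat (id 1).rel := by
    ext a b
    rw [relMat_id, Matrix.mul_apply]
    simp only [relMat_lineCup, relMat_capLine, Matrix.smul_apply, Matrix.one_apply]
    revert a b; decide
  have := relMat_smul_cancel (key.symm.trans h2)
  exact ⟨this.1, Diagram.ext this.2⟩

theorem zigzag_right : loops cupLine lineCap = 0 ∧ comp cupLine lineCap = id 1 := by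
  have key := relMat_comp cupLine lineCap
  have h2 : relMat cupLine.rel * relMat lineCap.rel = 2 ^ 0 • relMat (id 1).rel := by
    ext a b
    rw [relMat_id, Matrix.mul_apply]
    simp only [relMat_cupLine, relMat_lineCap, Matrix.smul_apply, Matrix.one_apply]
    revert a b; decide
  have := relMat_smul_cancel (key.symm.trans h2)
  exact ⟨this.1, Diagram.ext this.2⟩

end Diagram

/-! ### Linear combinations of diagrams, with every loop replaced by a scalar -/

section Linear
variable {m n p r m₁ m₂ m₃ n₁ n₂ n₃ p₁ p₂ : ℕ}

/-- Formal complex linear combinations of diagrams `m → n`. -/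
abbrev LinHom (m n : ℕ) : Type := Diagram m n →₀ ℂ

/-- A diagram as a linear combination. -/
noncomputable def dg (f : Diagram m n) : LinHom m n := Finsupp.single f 1

/-- Bilinear extension of vertical stacking, where every loop contributes a factor `δ`. -/
noncomputable def lcomp (δ : ℂ) : LinHom m n →ₗ[ℂ] LinHom n p →ₗ[ℂ] LinHom m p :=
  Finsupp.linearCombination ℂ fun f => Finsupp.linearCombination ℂ fun g =>
    δ ^ Diagram.loops f g • dg (Diagram.comp f g)

/-- Bilinear extension of horizontal juxtaposition. -/
noncomputable def ltensor :
    LinHom m₁ n₁ →ₗ[ℂ] LinHom m₂ n₂ →ₗ[ℂ] LinHom (m₁ + m₂) (n₁ + n₂) :=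
  Finsupp.linearCombination ℂ fun f => Finsupp.linearCombination ℂ fun g =>
    dg (Diagram.tensor f g)

/-- The identity on `n` strands. -/
noncomputable def lid (n : ℕ) : LinHom n n := dg (Diagram.id n)

theorem lcomp_dg (δ : ℂ) (f : Diagram m n) (g : Diagram n p) :
    lcomp δ (dg f) (dg g) = δ ^ Diagram.loops f g • dg (Diagram.comp f g) := by
  simp [lcomp, dg]

theorem ltensor_dg (f : Diagram m₁ n₁) (g : Diagram m₂ n₂) :
    ltensor (dg f) (dg g) = dg (Diagram.tensor f g) := by
  simp [ltensor, dg]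

theorem lin_induction {P : LinHom m n → Prop} (f : LinHom m n) (h0 : P 0)
    (hadd : ∀ f g, P f → P g → P (f + g)) (hs : ∀ (c : ℂ) (f : Diagram m n), P (c • dg f)) : P f := by
  refine Finsupp.induction_linear f h0 hadd (fun a b => ?_)
  simpa [dg] using hs b a

theorem lcomp_assoc (δ : ℂ) (f : LinHom m n) (g : LinHom n p) (h : LinHom p r) :
    lcomp δ (lcomp δ f g) h = lcomp δ f (lcomp δ g h) := by
  induction f using lin_induction with
  | h0 => simp
  | hadd f f' h1 h2 => simp only [map_add, LinearMap.add_apply, h1, h2]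
  | hs c f =>
    induction g using lin_induction with
    | h0 => simp
    | hadd f f' h1 h2 => simp only [map_add, LinearMap.add_apply, h1, h2]
    | hs d g =>
      induction h using lin_induction with
      | h0 => simp
      | hadd f f' h1 h2 => simp only [map_add, h1, h2]
      | hs e h =>
        have := Diagram.comp_assoc' f g h
        simp only [map_smul, LinearMap.smul_apply, lcomp_dg, smul_smul, this.2]
        congr 1
        have h1 : δ ^ f.loops g * δ ^ (f.comp g).loops h = δ ^ g.loops h * δ ^ f.loops (g.comp h) := by
          rw [← pow_add, ← pow_add, this.1]
        linear_combination (c * d * e) * h1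

theorem lid_lcomp (δ : ℂ) (f : LinHom m n) : lcomp δ (lid m) f = f := by
  induction f using lin_induction with
  | h0 => simp
  | hadd f f' h1 h2 => simp only [map_add, h1, h2]
  | hs c f => simp [lid, lcomp_dg, (Diagram.id_comp' f).1, (Diagram.id_comp' f).2]

theorem lcomp_lid (δ : ℂ) (f : LinHom m n) : lcomp δ f (lid n) = f := by
  induction f using lin_induction with
  | h0 => simp
  | hadd f f' h1 h2 => simp only [map_add, LinearMap.add_apply, h1, h2]
  | hs c f => simp [lid, lcomp_dg, (Diagram.comp_id' f).1, (Diagram.comp_id' f).2]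

theorem ltensor_lcomp (δ : ℂ) (f : LinHom m₁ n₁) (g : LinHom m₂ n₂) (f' : LinHom n₁ p₁)
    (g' : LinHom n₂ p₂) : lcomp δ (ltensor f g) (ltensor f' g') =
      ltensor (lcomp δ f f') (lcomp δ g g') := by
  induction f using lin_induction with
  | h0 => simp
  | hadd f f' h1 h2 => simp only [map_add, LinearMap.add_apply, h1, h2]
  | hs c f =>
    induction g using lin_induction with
    | h0 => simp
    | hadd f f' h1 h2 => simp only [map_add, LinearMap.add_apply, h1, h2]
    | hs d g =>
      induction f' using lin_induction with
      | h0 => simp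
      | hadd f f' h1 h2 => simp only [map_add, LinearMap.add_apply, h1, h2]
      | hs e f' =>
        induction g' using lin_induction with
        | h0 => simp
        | hadd f f' h1 h2 => simp only [map_add, h1, h2]
        | hs t g' =>
          have := Diagram.tensor_comp' f g f' g'
          simp only [map_smul, LinearMap.smul_apply, lcomp_dg, ltensor_dg, smul_smul, this.2,
            this.1, pow_add]
          congr 1
          ring

theorem ltensor_lid : ltensor (lid m) (lid n) = lid (m + n) := by
  simp only [lid, ltensor_dg, Diagram.tensor_id']

/-- Transport along equalities of the numbers of dots. -/
def lcast {m' n' : ℕ} (hm : m = m') (hn : n = n') (f : LinHom m n) : LinHom m' n' := hm ▸ hn ▸ f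

theorem lcast_add {m' n' : ℕ} (hm : m = m') (hn : n = n') (f g : LinHom m n) :
    lcast hm hn (f + g) = lcast hm hn f + lcast hm hn g := by subst hm hn; rfl

theorem lcast_smul {m' n' : ℕ} (hm : m = m') (hn : n = n') (c : ℂ) (f : LinHom m n) :
    lcast hm hn (c • f) = c • lcast hm hn f := by subst hm hn; rfl

theorem lcast_zero {m' n' : ℕ} (hm : m = m') (hn : n = n') :
    lcast hm hn (0 : LinHom m n) = 0 := by subst hm hn; rfl

theorem lcast_dg {m' n' : ℕ} (hm : m = m') (hn : n = n') (f : Diagram m n) :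
    lcast hm hn (dg f) = dg (Diagram.cast hm hn f) := by subst hm hn; rfl

theorem ltensor_assoc (f : LinHom m₁ n₁) (g : LinHom m₂ n₂) (h : LinHom m₃ n₃) :
    lcast (Nat.add_assoc _ _ _) (Nat.add_assoc _ _ _) (ltensor (ltensor f g) h) =
      ltensor f (ltensor g h) := by
  induction f using lin_induction with
  | h0 => simp [lcast_zero]
  | hadd f f' h1 h2 => simp only [map_add, LinearMap.add_apply, lcast_add, h1, h2]
  | hs c f =>
    induction g using lin_induction with
    | h0 => simp [lcast_zero]
    | hadd f f' h1 h2 => simp only [map_add, LinearMap.add_apply, lcast_add, h1, h2]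
    | hs d g =>
      induction h using lin_induction with
      | h0 => simp [lcast_zero]
      | hadd f f' h1 h2 => simp only [map_add, lcast_add, h1, h2]
      | hs e h =>
        simp only [map_smul, LinearMap.smul_apply, ltensor_dg, lcast_smul, lcast_dg,
          Diagram.tensor_assoc']

theorem ltensor_zero (f : LinHom m n) : ltensor f (lid 0) = f := by
  induction f using lin_induction with
  | h0 => simp
  | hadd f f' h1 h2 => rw [map_add, LinearMap.add_apply, h1, h2]
  | hs c f =>
    rw [map_smul, LinearMap.smul_apply, lid, ltensor_dg, Diagram.tensor_zero']

theorem zero_ltensor (f : LinHom m n) :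
    lcast (Nat.zero_add _) (Nat.zero_add _) (ltensor (lid 0) f) = f := by
  induction f using lin_induction with
  | h0 => simp [lcast_zero]
  | hadd f f' h1 h2 => rw [map_add, lcast_add, h1, h2]
  | hs c f =>
    rw [map_smul, lid, ltensor_dg, lcast_smul, lcast_dg, Diagram.zero_tensor']

end Linear

/-! ### Quantum integers -/

/-- `q = exp(π i / (k + 2))`. -/
noncomputable def qq (k : ℕ) : ℂ := Complex.exp (Real.pi * Complex.I / (k + 2))

/-- The quantum integer `[i]`. -/
noncomputable def qint (k i : ℕ) : ℂ := (qq k ^ i - (qq k ^ i)⁻¹) / (qq k - (qq k)⁻¹)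

/-- The value `δ = -[2]` of a loop. -/
noncomputable def delta (k : ℕ) : ℂ := -qint k 2

theorem qq_ne_zero (k : ℕ) : qq k ≠ 0 := Complex.exp_ne_zero _

theorem qq_pow_sub_ne (k i : ℕ) (h1 : 1 ≤ i) (h2 : i ≤ k + 1) :
    qq k ^ i - (qq k ^ i)⁻¹ ≠ 0 := by
  intro h
  have hq := pow_ne_zero i (qq_ne_zero k)
  have h3 : qq k ^ i * qq k ^ i = 1 := by
    have := sub_eq_zero.1 h
    nth_rewrite 1 [this]
    exact inv_mul_cancel₀ hq
  rw [← pow_add, qq, ← Complex.exp_nat_mul, Complex.exp_eq_one_iff] at h3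
  obtain ⟨z, hz⟩ := h3
  have hk : ((k : ℂ) + 2) ≠ 0 := by
    have : ((k + 2 : ℕ) : ℂ) ≠ 0 := Nat.cast_ne_zero.2 (by omega)
    simpa using this
  have hpi : (Real.pi : ℂ) * Complex.I ≠ 0 :=
    mul_ne_zero (Complex.ofReal_ne_zero.2 Real.pi_ne_zero) Complex.I_ne_zero
  have h4 : ((i : ℤ) : ℂ) = ((z * (k + 2) : ℤ) : ℂ) := by
    push_cast at hz ⊢
    field_simp at hz
    have h5 : (Real.pi : ℂ) * Complex.I * (2 * ((i : ℂ) - z * (k + 2))) = 0 := by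
      linear_combination (Real.pi : ℂ) * Complex.I * hz
    rcases mul_eq_zero.1 h5 with h5 | h5
    · exact (hpi h5).elim
    · linear_combination h5 / 2
  have h6 : (i : ℤ) = z * (k + 2) := by exact_mod_cast h4
  have hz0 : 0 < z := by
    by_contra hz0
    nlinarith
  nlinarith

theorem qq_sub_ne (k : ℕ) : qq k - (qq k)⁻¹ ≠ 0 := by
  simpa using qq_pow_sub_ne k 1 le_rfl (by omega)

theorem qint_ne_zero (k i : ℕ) (h1 : 1 ≤ i) (h2 : i ≤ k + 1) : qint k i ≠ 0 :=
  div_ne_zero (qq_pow_sub_ne k i h1 h2) (qq_sub_ne k)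

theorem qint_one (k : ℕ) : qint k 1 = 1 := by
  rw [qint, pow_one, div_self (qq_sub_ne k)]

theorem qint_rec (k n : ℕ) : qint k 2 * qint k (n + 1) = qint k n + qint k (n + 2) := by
  have h := qq_sub_ne k
  have hq := qq_ne_zero k
  have h2 : qint k 2 = qq k + (qq k)⁻¹ := by
    rw [qint, div_eq_iff h]; field_simp; ring
  rw [h2]
  simp only [qint]
  rw [← add_div, mul_div_assoc']
  congr 1
  simp only [pow_succ]
  field_simp
  ring

/-! ### Jones-Wenzl projections -/

/-- The cap-cup morphism on two strands. -/
noncomputable def capCup : LinHom 2 2 := dg (Diagram.comp Diagram.cap Diagram.cup)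

/-- The Jones-Wenzl projections: `f₀ = 1`, `f₁ = 1` and
`fᵢ = fᵢ₋₁ ⊗ 1 + ([i-1]/[i]) (fᵢ₋₁ ⊗ 1) Uᵢ₋₁ (fᵢ₋₁ ⊗ 1)`,
where `Uᵢ₋₁` is the cap-cup on the last two of `i` strands. -/
noncomputable def jw (k : ℕ) : (n : ℕ) → LinHom n n
  | 0 => lid 0
  | 1 => lid 1
  | n + 2 => ltensor (jw k (n + 1)) (lid 1) + (qint k (n + 1) / qint k (n + 2)) •
      lcomp (delta k) (lcomp (delta k) (ltensor (jw k (n + 1)) (lid 1)) (ltensor (lid n) capCup))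
        (ltensor (jw k (n + 1)) (lid 1))

theorem loops_cap_cup : Diagram.loops Diagram.cap Diagram.cup = 0 := by
  have key := congrFun (congrFun (Diagram.relMat_comp Diagram.cap Diagram.cup)
    (fun _ => true)) (fun _ => true)
  rw [Matrix.mul_apply, Matrix.smul_apply] at key
  simp only [Diagram.relMat_cap, Diagram.relMat_cup] at key
  by_contra h
  obtain ⟨l, hl⟩ := Nat.exists_eq_succ_of_ne_zero h
  rw [hl, pow_succ, smul_eq_mul] at key
  simp at key
  have h2 : 2 ∣ 1 := ⟨2 ^ l * _, by rw [← mul_assoc, mul_comm 2]; exact key⟩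
  omega

theorem capCup_eq (k : ℕ) : capCup = lcomp (delta k) (dg Diagram.cap) (dg Diagram.cup) := by
  rw [lcomp_dg, loops_cap_cup, pow_zero, one_smul, capCup]

theorem lcup_lcap (k : ℕ) :
    lcomp (delta k) (dg Diagram.cup) (dg Diagram.cap) = delta k • lid 0 := by
  rw [lcomp_dg, Diagram.cup_cap.1, Diagram.cup_cap.2, pow_one, lid]

theorem capCup_sq (k : ℕ) : lcomp (delta k) capCup capCup = delta k • capCup := by
  rw [capCup_eq k, lcomp_assoc, ← lcomp_assoc _ (dg Diagram.cup), lcup_lcap]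
  simp [lid_lcomp]

/-- Cap-cup on the last two of three strands. -/
noncomputable def lineU : LinHom 3 3 := ltensor (m₁ := 1) (n₁ := 1) (lid 1) capCup

/-- Cap-cup on the first two of three strands. -/
noncomputable def uLine : LinHom 3 3 := ltensor (m₁ := 2) (n₁ := 2) capCup (lid 1)

theorem lineU_eq (k : ℕ) : lineU = lcomp (delta k) (dg Diagram.lineCap) (dg Diagram.lineCup) := by
  have := ltensor_lcomp (m₁ := 1) (n₁ := 1) (p₁ := 1) (delta k) (lid 1) (dg Diagram.cap) (lid 1) (dg Diagram.cup)
  rw [lid_lcomp, ← capCup_eq, lid, ltensor_dg, ltensor_dg] at this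
  exact this.symm

theorem uLine_eq (k : ℕ) : uLine = lcomp (delta k) (dg Diagram.capLine) (dg Diagram.cupLine) := by
  have := ltensor_lcomp (m₂ := 1) (n₂ := 1) (p₂ := 1) (delta k) (dg Diagram.cap) (lid 1) (dg Diagram.cup) (lid 1)
  rw [lid_lcomp, ← capCup_eq, lid, ltensor_dg, ltensor_dg] at this
  exact this.symm

theorem lineU_uLine_lineU (k : ℕ) :
    lcomp (delta k) (lcomp (delta k) lineU uLine) lineU = lineU := by
  have h1 : lcomp (delta k) (dg Diagram.lineCup) (dg Diagram.capLine) = lid 1 := by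
    rw [lcomp_dg, Diagram.zigzag_left.1, Diagram.zigzag_left.2, pow_zero, one_smul, lid]
  have h2 : lcomp (delta k) (dg Diagram.cupLine) (dg Diagram.lineCap) = lid 1 := by
    rw [lcomp_dg, Diagram.zigzag_right.1, Diagram.zigzag_right.2, pow_zero, one_smul, lid]
  rw [lineU_eq k, uLine_eq k]
  simp only [lcomp_assoc]
  rw [← lcomp_assoc _ (dg Diagram.cupLine), h2, lid_lcomp, ← lcomp_assoc _ (dg Diagram.lineCup),
    h1, lid_lcomp]

section JW
variable {k : ℕ}

theorem ltensor_lid_succ {m n : ℕ} (f : LinHom m n) (b : ℕ) :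
    ltensor f (lid (b + 1)) = ltensor (ltensor f (lid b)) (lid 1) := by
  rw [← ltensor_lid, ← ltensor_assoc]; rfl

/-- Facts about `f_{n+1}` proved together by induction on `n`. -/
theorem jw_aux (n : ℕ) (hn : n ≤ k) :
    lcomp (delta k) (jw k (n + 1)) (jw k (n + 1)) = jw k (n + 1) ∧
    lcomp (delta k) (jw k (n + 1)) (ltensor (jw k n) (lid 1)) = jw k (n + 1) ∧
    lcomp (delta k) (ltensor (jw k n) (lid 1)) (jw k (n + 1)) = jw k (n + 1) ∧
    lcomp (delta k) (lcomp (delta k) (ltensor (lid n) capCup) (ltensor (jw k (n + 1)) (lid 1)))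
      (ltensor (lid n) capCup) =
      (-(qint k (n + 2) / qint k (n + 1))) •
        lcomp (delta k) (ltensor (jw k n) (lid 2)) (ltensor (lid n) capCup) := by
  induction n with
  | zero =>
    have e : ltensor (lid 0) (lid 1) = (lid 1 : LinHom 1 1) := ltensor_lid
    have e2 : ltensor (lid 1) (lid 1) = (lid 2 : LinHom 2 2) := ltensor_lid
    have e3 : ltensor (lid 0) (lid 2) = (lid 2 : LinHom 2 2) := ltensor_lid
    refine ⟨lid_lcomp _ _, ?_, ?_, ?_⟩
    · exact (congrArg (lcomp (delta k) (lid 1)) e).trans (lid_lcomp _ _)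
    · exact (congrArg (fun x => lcomp (delta k) x (lid 1)) e).trans (lid_lcomp _ _)
    · have h1 := ltensor_lcomp (delta k) (lid 0) capCup (lid 0) capCup
      rw [lid_lcomp, capCup_sq, map_smul] at h1
      change lcomp (delta k) (lcomp (delta k) (ltensor (lid 0) capCup) (ltensor (lid 1) (lid 1))) _
         = _ • lcomp (delta k) (ltensor (lid 0) (lid 2)) _
      rw [ltensor_lid, ltensor_lid]
      refine (congrArg (fun x => lcomp (delta k) x _) (lcomp_lid (delta k) _)).trans ?_
      rw [lid_lcomp, h1, qint_one, delta, div_one]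
  | succ n ih =>
    obtain ⟨ih1, ih2, ih3, ih4⟩ := ih (by omega)
    have hq1 := qint_ne_zero k (n + 1) (by omega) (by omega)
    have hq2 := qint_ne_zero k (n + 2) (by omega) (by omega)
    set g : LinHom (n + 2) (n + 2) := ltensor (jw k (n + 1)) (lid 1) with hg
    set E : LinHom (n + 2) (n + 2) := ltensor (lid n) capCup with hE
    set h : LinHom (n + 2) (n + 2) := ltensor (jw k n) (lid 2) with hh
    set μ := qint k (n + 1) / qint k (n + 2) with hμ
    have hf : jw k (n + 2) = g + μ • lcomp (delta k) (lcomp (delta k) g E) g := rfl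
    have hgg : lcomp (delta k) g g = g := by
      refine (ltensor_lcomp (delta k) (jw k (n + 1)) (lid 1) (jw k (n + 1)) (lid 1)).trans ?_
      rw [ih1, lid_lcomp]
    have hgh : lcomp (delta k) g h = g := by
      have hh' : h = ltensor (ltensor (jw k n) (lid 1)) (lid 1) := ltensor_lid_succ _ 1
      rw [hh']
      refine (ltensor_lcomp (delta k) (jw k (n + 1)) (lid 1) (ltensor (jw k n) (lid 1))
        (lid 1)).trans ?_
      rw [ih2, lid_lcomp]
    have hμc : μ * -(qint k (n + 2) / qint k (n + 1)) = -1 := by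
      rw [hμ]; field_simp
    have hgEgEg : lcomp (delta k) (lcomp (delta k) g E) (lcomp (delta k) g (lcomp (delta k) E g)) =
        (-(qint k (n + 2) / qint k (n + 1))) • lcomp (delta k) g (lcomp (delta k) E g) := by
      have : lcomp (delta k) (lcomp (delta k) g E) (lcomp (delta k) g (lcomp (delta k) E g)) =
        lcomp (delta k) g (lcomp (delta k) (lcomp (delta k) (lcomp (delta k) E g) E) g) := by
        simp only [lcomp_assoc]
      rw [this, ih4]
      simp only [map_smul, LinearMap.smul_apply]
      rw [lcomp_assoc, ← lcomp_assoc _ g h, hgh]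
    have hidem : lcomp (delta k) (jw k (n + 2)) (jw k (n + 2)) = jw k (n + 2) := by
      rw [hf]
      simp only [map_add, LinearMap.add_apply, map_smul, LinearMap.smul_apply, lcomp_assoc, hgg]
      rw [← lcomp_assoc _ g g, hgg]
      have h5 := hgEgEg
      rw [lcomp_assoc] at h5
      have h6 : lcomp (delta k) g (lcomp (delta k) E (lcomp (delta k) g (lcomp (delta k) g
          (lcomp (delta k) E g)))) =
        (-(qint k (n + 2) / qint k (n + 1))) • lcomp (delta k) g (lcomp (delta k) E g) := by
        rw [← lcomp_assoc _ g g, hgg, h5]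
      first
        | rw [h6]
        | rw [h5]
      rw [smul_smul μ, hμc]
      module
    have hl : lcomp (delta k) (jw k (n + 2)) g = jw k (n + 2) := by
      rw [hf]
      simp only [map_add, LinearMap.add_apply, map_smul, LinearMap.smul_apply, lcomp_assoc, hgg]
    have hr : lcomp (delta k) g (jw k (n + 2)) = jw k (n + 2) := by
      rw [hf]
      simp only [map_add, map_smul, hgg]
      rw [← lcomp_assoc, ← lcomp_assoc, hgg]
    refine ⟨hidem, hl, hr, ?_⟩
    -- the partial trace
    set A : LinHom (n + 3) (n + 3) := ltensor g (lid 1) with hA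
    have hA' : ltensor (jw k (n + 1)) (lid 2) = A := ltensor_lid_succ _ _
    set F : LinHom (n + 3) (n + 3) := ltensor (lid (n + 1)) capCup with hF
    have hFA : lcomp (delta k) F A = lcomp (delta k) A F := by
      rw [← hA']
      refine (ltensor_lcomp (delta k) (lid (n + 1)) capCup (jw k (n + 1)) (lid 2)).trans
        (Eq.trans ?_ (ltensor_lcomp (delta k) (jw k (n + 1)) (lid 2) (lid (n + 1)) capCup).symm)
      simp only [lid_lcomp, lcomp_lid]
    have hAA : lcomp (delta k) A A = A := by
      refine (ltensor_lcomp (delta k) g (lid 1) g (lid 1)).trans ?_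
      rw [hgg, lid_lcomp]
    have hFF : lcomp (delta k) F F = delta k • F := by
      refine (ltensor_lcomp (delta k) (lid (n + 1)) capCup (lid (n + 1)) capCup).trans ?_
      rw [lid_lcomp, capCup_sq, map_smul]
    have hF' : F = ltensor (lid n) lineU := by
      have e : lid (n + 1) = ltensor (lid n) (lid 1) := ltensor_lid.symm
      have := ltensor_assoc (lid n) (lid 1) capCup
      rw [hF, e, lineU, ← this]; rfl
    have hE' : ltensor E (lid 1) = ltensor (lid n) uLine := by
      have := ltensor_assoc (lid n) capCup (lid 1)
      rw [hE, uLine, ← this]; rfl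
    have hFEF : lcomp (delta k) (lcomp (delta k) F (ltensor E (lid 1))) F = F := by
      rw [hF', hE']
      have h1 : lcomp (delta k) (ltensor (lid n) lineU) (ltensor (lid n) uLine) =
          ltensor (lid n) (lcomp (delta k) lineU uLine) := by
        rw [ltensor_lcomp, lid_lcomp]
      refine (congrArg (fun x => lcomp (delta k) x (ltensor (lid n) lineU)) h1).trans ?_
      refine (ltensor_lcomp (delta k) (lid n) _ (lid n) lineU).trans ?_
      rw [lineU_uLine_lineU, lid_lcomp]
    have hT : ltensor (jw k (n + 2)) (lid 1) =
        A + μ • lcomp (delta k) (lcomp (delta k) A (ltensor E (lid 1))) A := by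
      rw [hf, map_add, map_smul, LinearMap.add_apply, LinearMap.smul_apply]
      have h1 : lcomp (delta k) A (ltensor E (lid 1)) = ltensor (lcomp (delta k) g E) (lid 1) := by
        refine (ltensor_lcomp (delta k) g (lid 1) E (lid 1)).trans ?_
        rw [lid_lcomp]
      have h2 : lcomp (delta k) (ltensor (lcomp (delta k) g E) (lid 1)) A =
          ltensor (lcomp (delta k) (lcomp (delta k) g E) g) (lid 1) := by
        refine (ltensor_lcomp (delta k) (lcomp (delta k) g E) (lid 1) g (lid 1)).trans ?_
        rw [lid_lcomp]
      rw [h1, h2]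
    rw [hA', hT]
    have e1 : lcomp (delta k) (lcomp (delta k) F A) F = delta k • lcomp (delta k) A F := by
      rw [hFA, lcomp_assoc, hFF, map_smul]
    have e2 : lcomp (delta k) (lcomp (delta k) F (lcomp (delta k) (lcomp (delta k) A
        (ltensor E (lid 1))) A)) F = lcomp (delta k) A F := by
      have : lcomp (delta k) (lcomp (delta k) F (lcomp (delta k) (lcomp (delta k) A
        (ltensor E (lid 1))) A)) F =
          lcomp (delta k) (lcomp (delta k) (lcomp (delta k) F A) (ltensor E (lid 1)))
            (lcomp (delta k) A F) := by
        simp only [lcomp_assoc]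
      rw [this, hFA, ← hFA]
      rw [hFA, ← hFA]
      have h7 : lcomp (delta k) (lcomp (delta k) (lcomp (delta k) A F) (ltensor E (lid 1)))
            (lcomp (delta k) F A) = lcomp (delta k) A (lcomp (delta k)
              (lcomp (delta k) (lcomp (delta k) F (ltensor E (lid 1))) F) A) := by
        simp only [lcomp_assoc]
      nth_rewrite 1 [hFA]
      rw [h7, hFEF, hFA, ← lcomp_assoc, hAA]
    simp only [map_add, LinearMap.add_apply, map_smul, LinearMap.smul_apply]
    rw [e1, e2, ← add_smul]
    congr 1
    have := qint_rec k (n + 1)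
    rw [delta, hμ, eq_neg_iff_add_eq_zero]
    field_simp
    linear_combination -this

end JW
section JW
variable {k : ℕ}

theorem jw_idem {n : ℕ} (hn : n ≤ k + 1) : lcomp (delta k) (jw k n) (jw k n) = jw k n := by
  cases n with
  | zero => exact lid_lcomp _ _
  | succ n => exact (jw_aux n (by omega)).1

/-- A cap-cup below a Jones-Wenzl projection vanishes. -/
theorem capCup_jw (a b : ℕ) (h : a + 2 + b ≤ k + 1) :
    lcomp (delta k) (ltensor (ltensor (lid a) capCup) (lid b)) (jw k (a + 2 + b)) = 0 := by
  induction b with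
  | zero =>
    rw [ltensor_zero]
    obtain ⟨h1, h2, h3, h4⟩ := jw_aux (k := k) a (by omega)
    have hq1 := qint_ne_zero k (a + 1) (by omega) (by omega)
    have hq2 := qint_ne_zero k (a + 2) (by omega) (by omega)
    have hgh : lcomp (delta k) (ltensor (jw k a) (lid 2)) (ltensor (jw k (a + 1)) (lid 1)) =
        ltensor (jw k (a + 1)) (lid 1) := by
      have hh' : ltensor (jw k a) (lid 2) = ltensor (ltensor (jw k a) (lid 1)) (lid 1) :=
        ltensor_lid_succ _ 1
      rw [hh']
      refine (ltensor_lcomp (delta k) (ltensor (jw k a) (lid 1)) (lid 1) (jw k (a + 1))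
        (lid 1)).trans ?_
      rw [h3, lid_lcomp]
    have hc : lcomp (delta k) (ltensor (jw k a) (lid 2)) (ltensor (lid a) capCup) =
        lcomp (delta k) (ltensor (lid a) capCup) (ltensor (jw k a) (lid 2)) := by
      rw [ltensor_lcomp, ltensor_lcomp]
      simp only [lid_lcomp, lcomp_lid]
    have hf : jw k (a + 2) = ltensor (jw k (a + 1)) (lid 1) + (qint k (a + 1) / qint k (a + 2)) •
      lcomp (delta k) (lcomp (delta k) (ltensor (jw k (a + 1)) (lid 1)) (ltensor (lid a) capCup))
        (ltensor (jw k (a + 1)) (lid 1)) := rfl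
    change lcomp (delta k) (ltensor (lid a) capCup) (jw k (a + 2)) = 0
    rw [hf, map_add, map_smul, ← lcomp_assoc, ← lcomp_assoc, h4, map_smul, LinearMap.smul_apply,
      hc]
    rw [lcomp_assoc _ (ltensor (lid a) capCup) (ltensor (jw k a) (lid 2))]
    have e : lcomp (delta k) (ltensor (lid a) capCup) (lcomp (delta k) (ltensor (jw k a) (lid 2))
      (ltensor (jw k (a + 1)) (lid 1))) =
      lcomp (delta k) (ltensor (lid a) capCup) (ltensor (jw k (a + 1)) (lid 1)) :=
      congrArg _ hgh
    refine (congrArg (fun x => _ + _ • _ • x) e).trans ?_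
    rw [smul_smul]
    have : qint k (a + 1) / qint k (a + 2) * -(qint k (a + 2) / qint k (a + 1)) = -1 := by
      field_simp
    rw [this]
    module
  | succ b ih =>
    obtain ⟨h1, h2, h3, h4⟩ := jw_aux (k := k) (a + 2 + b) (by omega)
    have hh' : ltensor (ltensor (lid a) capCup) (lid (b + 1)) =
      ltensor (ltensor (ltensor (lid a) capCup) (lid b)) (lid 1) := ltensor_lid_succ _ b
    change lcomp (delta k) _ (jw k (a + 2 + b + 1)) = 0
    rw [hh', ← h3]
    refine (lcomp_assoc _ _ _ _).symm.trans ?_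
    have e : lcomp (delta k) (ltensor (ltensor (ltensor (lid a) capCup) (lid b)) (lid 1))
        (ltensor (jw k (a + 2 + b)) (lid 1)) = 0 := by
      rw [ltensor_lcomp, ih (by omega)]; simp
    rw [e]; simp

/-- Absorption on the left strands. -/
theorem jw_absorb_left (a b : ℕ) (h : a + b ≤ k + 1) :
    lcomp (delta k) (ltensor (jw k a) (lid b)) (jw k (a + b)) = jw k (a + b) := by
  induction b with
  | zero => rw [ltensor_zero]; exact jw_idem h
  | succ b ih =>
    obtain ⟨h1, h2, h3, h4⟩ := jw_aux (k := k) (a + b) (by omega)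
    have hh' : ltensor (jw k a) (lid (b + 1)) =
      ltensor (ltensor (jw k a) (lid b)) (lid 1) := ltensor_lid_succ _ b
    change lcomp (delta k) _ (jw k (a + b + 1)) = jw k (a + b + 1)
    rw [hh', ← h3]
    refine (lcomp_assoc _ _ _ _).symm.trans ?_
    have e : lcomp (delta k) (ltensor (ltensor (jw k a) (lid b)) (lid 1))
        (ltensor (jw k (a + b)) (lid 1)) = ltensor (jw k (a + b)) (lid 1) := by
      rw [ltensor_lcomp, ih (by omega), lid_lcomp]
    rw [e]

/-- Absorption on the right strands. -/
theorem jw_absorb_right (a b : ℕ) (h : a + b ≤ k + 1) :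
    lcomp (delta k) (ltensor (lid a) (jw k b)) (jw k (a + b)) = jw k (a + b) := by
  induction b with
  | zero =>
    change lcomp (delta k) (ltensor (lid a) (lid 0)) _ = _
    rw [ltensor_lid, lid_lcomp]
  | succ b ih =>
    cases b with
    | zero =>
      change lcomp (delta k) (ltensor (lid a) (lid 1)) _ = _
      rw [ltensor_lid, lid_lcomp]
    | succ b =>
      obtain ⟨h1, h2, h3, h4⟩ := jw_aux (k := k) (a + (b + 1)) (by omega)
      set N := jw k (a + (b + 1) + 1) with hN
      set x : LinHom (b + 2) (b + 2) := ltensor (jw k (b + 1)) (lid 1) with hx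
      have hx' : ltensor (lid a) x = ltensor (ltensor (lid a) (jw k (b + 1))) (lid 1) :=
        (ltensor_assoc (lid a) (jw k (b + 1)) (lid 1)).symm
      have e1 : lcomp (delta k) (ltensor (lid a) x) N = N := by
        rw [hx', ← h3]
        refine (lcomp_assoc _ _ _ _).symm.trans ?_
        have e : lcomp (delta k) (ltensor (ltensor (lid a) (jw k (b + 1))) (lid 1))
            (ltensor (jw k (a + (b + 1))) (lid 1)) = ltensor (jw k (a + (b + 1))) (lid 1) := by
          rw [ltensor_lcomp, ih (by omega), lid_lcomp]
        rw [e]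
      have e2 : lcomp (delta k) (ltensor (lid a) (ltensor (lid b) capCup)) N = 0 := by
        have h5 := capCup_jw (k := k) (a + b) 0 (by omega)
        rw [ltensor_zero, ← ltensor_lid] at h5
        have h6 := ltensor_assoc (lid a) (lid b) capCup
        rw [← h6]
        exact h5
      have hf : jw k (b + 1 + 1) = x + (qint k (b + 1) / qint k (b + 2)) •
        lcomp (delta k) (lcomp (delta k) x (ltensor (lid b) capCup)) x := rfl
      have e3 : ∀ y z : LinHom (b + 2) (b + 2), ltensor (lid a) (lcomp (delta k) y z) =
          lcomp (delta k) (ltensor (lid a) y) (ltensor (lid a) z) := by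
        intro y z; rw [ltensor_lcomp, lid_lcomp]
      change lcomp (delta k) (ltensor (lid a) (jw k (b + 1 + 1))) N = N
      rw [hf, map_add, map_smul, e3, e3, map_add, LinearMap.add_apply, map_smul,
        LinearMap.smul_apply]
      have e4 : lcomp (delta k) (lcomp (delta k) (lcomp (delta k) (ltensor (lid a) x)
        (ltensor (lid a) (ltensor (lid b) capCup))) (ltensor (lid a) x)) N = 0 := by
        refine (lcomp_assoc _ _ _ _).trans ?_
        refine (congrArg _ e1).trans ?_
        refine (lcomp_assoc _ _ _ _).trans ?_
        refine (congrArg _ e2).trans ?_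
        exact map_zero _
      refine (congrArg₂ (fun x y => x + _ • y) e1 e4).trans ?_
      rw [smul_zero, add_zero]

end JW
open CategoryTheory MonoidalCategory

theorem add_lcomp {m n p : ℕ} (δ : ℂ) (f g : LinHom m n) (h : LinHom n p) :
    lcomp δ (f + g) h = lcomp δ f h + lcomp δ g h := by simp

theorem lcomp_add {m n p : ℕ} (δ : ℂ) (f : LinHom m n) (g h : LinHom n p) :
    lcomp δ f (g + h) = lcomp δ f g + lcomp δ f h := by simp

theorem add_ltensor {m n m' n' : ℕ} (f g : LinHom m n) (h : LinHom m' n') :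
    ltensor (f + g) h = ltensor f h + ltensor g h := by simp

theorem ltensor_add {m n m' n' : ℕ} (f : LinHom m n) (g h : LinHom m' n') :
    ltensor f (g + h) = ltensor f g + ltensor f h := by simp

theorem lzero_ltensor {m n m' n' : ℕ} (h : LinHom m' n') :
    ltensor (0 : LinHom m n) h = 0 := by simp

theorem ltensor_lzero {m n m' n' : ℕ} (f : LinHom m n) :
    ltensor f (0 : LinHom m' n') = 0 := by simp

/-- The linear category of planar diagrams in which every loop equals `δ`:
the objects are the natural numbers. -/
structure Strands (k : ℕ) where
  n : ℕ

namespace Strands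
variable {k : ℕ}

noncomputable instance : Category (Strands k) where
  Hom X Y := LinHom X.n Y.n
  id X := lid X.n
  comp f g := lcomp (delta k) f g
  id_comp f := lid_lcomp _ f
  comp_id f := lcomp_lid _ f
  assoc f g h := lcomp_assoc _ f g h

noncomputable instance : Preadditive (Strands k) where
  homGroup X Y := inferInstanceAs (AddCommGroup (LinHom X.n Y.n))
  add_comp _ _ _ f g h := add_lcomp (delta k) f g h
  comp_add _ _ _ f g h := lcomp_add (delta k) f g h

theorem cast_comm {X X' Y Y' : Strands k} (hX : X = X') (hY : Y = Y') (f : X ⟶ Y) (g : X' ⟶ Y')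
    (h : lcast (congrArg n hX) (congrArg n hY) f = g) :
    f ≫ eqToHom hY = eqToHom hX ≫ g := by
  subst hX hY
  rw [eqToHom_refl, eqToHom_refl, Category.comp_id, Category.id_comp]
  exact h

theorem tensor_eqToHom {X X' Y Y' : Strands k} (hX : X = X') (hY : Y = Y') :
    ltensor (eqToHom hX : X ⟶ X') (eqToHom hY : Y ⟶ Y') =
      (eqToHom (congrArg₂ (fun a b => (⟨a.n + b.n⟩ : Strands k)) hX hY) :
        (⟨X.n + Y.n⟩ : Strands k) ⟶ ⟨X'.n + Y'.n⟩) := by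
  subst hX hY
  exact ltensor_lid

noncomputable instance : MonoidalCategory (Strands k) where
  tensorObj X Y := ⟨X.n + Y.n⟩
  tensorUnit := ⟨0⟩
  tensorHom f g := ltensor f g
  whiskerLeft X _ _ f := ltensor (lid X.n) f
  whiskerRight f Y := ltensor f (lid Y.n)
  associator X Y Z := eqToIso (congrArg Strands.mk (Nat.add_assoc _ _ _))
  leftUnitor X := eqToIso (congrArg Strands.mk (Nat.zero_add _))
  rightUnitor X := eqToIso (congrArg Strands.mk (Nat.add_zero _))
  tensorHom_def f g := by
    refine Eq.symm ((ltensor_lcomp (delta k) _ _ _ _).trans ?_)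
    rw [lid_lcomp, lcomp_lid]
  id_tensorHom_id X Y := ltensor_lid
  tensorHom_comp_tensorHom f g h i := ltensor_lcomp (delta k) _ _ _ _
  whiskerLeft_id X Y := ltensor_lid
  id_whiskerRight X Y := ltensor_lid
  associator_naturality f g h :=
    cast_comm (congrArg Strands.mk (Nat.add_assoc _ _ _)) (congrArg Strands.mk (Nat.add_assoc _ _ _)) _ _ (ltensor_assoc f g h)
  leftUnitor_naturality f :=
    cast_comm (congrArg Strands.mk (Nat.zero_add _)) (congrArg Strands.mk (Nat.zero_add _)) _ _ (zero_ltensor f)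
  rightUnitor_naturality f :=
    cast_comm (congrArg Strands.mk (Nat.add_zero _)) (congrArg Strands.mk (Nat.add_zero _)) _ _ (ltensor_zero f)
  pentagon W X Y Z := by
    have e1 := tensor_eqToHom (k := k) (X := ⟨W.n + X.n + Y.n⟩) (X' := ⟨W.n + (X.n + Y.n)⟩)
      (Y := Z) (by rw [Nat.add_assoc]) rfl
    have e2 := tensor_eqToHom (k := k) (Y := ⟨X.n + Y.n + Z.n⟩) (Y' := ⟨X.n + (Y.n + Z.n)⟩)
      (X := W) rfl (by rw [Nat.add_assoc])
    refine (congrArg₂ (fun x y => x ≫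
      eqToHom (congrArg Strands.mk (Nat.add_assoc W.n (X.n + Y.n) Z.n)) ≫ y) e1 e2).trans ?_
    simp
  triangle X Y := by
    have e1 := tensor_eqToHom (k := k) (X := ⟨X.n + 0⟩) (X' := X)
      (Y := Y) rfl rfl
    have e2 := tensor_eqToHom (k := k) (Y := ⟨0 + Y.n⟩) (Y' := Y)
      (X := X) rfl (by rw [Nat.zero_add])
    refine (congrArg (fun x =>
      eqToHom (congrArg Strands.mk (Nat.add_assoc X.n 0 Y.n)) ≫ x) e2).trans (Eq.trans ?_ e1.symm)
    simp

instance : MonoidalPreadditive (Strands k) where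
  whiskerLeft_zero {X Y Z} := ltensor_lzero (lid X.n)
  zero_whiskerRight {X Y Z} := lzero_ltensor (lid X.n)
  whiskerLeft_add {X Y Z} f g := ltensor_add (lid X.n) f g
  add_whiskerRight {X Y Z} f g := add_ltensor f g (lid X.n)

end Strands

/-! ### The monoidal structure on the additive completion -/

namespace MatMonoidal
universe v u
variable {C : Type u} [Category.{v} C] [Preadditive C]

/-- The entries of a morphism in the additive completion. -/
def ent {M N : Mat_ C} (f : M ⟶ N) (i : M.ι) (j : N.ι) : M.X i ⟶ N.X j := f i j

/-- The morphism in the additive completion with given entries. -/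
def ofEnt {M N : Mat_ C} (f : ∀ i j, M.X i ⟶ N.X j) : M ⟶ N := f

theorem ent_ofEnt {M N : Mat_ C} (f : ∀ i j, M.X i ⟶ N.X j) (i j) :
    ent (ofEnt f : M ⟶ N) i j = f i j := rfl

theorem ent_ext {M N : Mat_ C} {f g : M ⟶ N} (h : ∀ i j, ent f i j = ent g i j) : f = g :=
  Mat_.hom_ext f g h

theorem ent_comp {M N K : Mat_ C} (f : M ⟶ N) (g : N ⟶ K) (i k) :
    ent (f ≫ g) i k = ∑ j, ent f i j ≫ ent g j k := rfl

theorem ent_add {M N : Mat_ C} (f g : M ⟶ N) (i j) :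
    ent (f + g) i j = ent f i j + ent g i j := rfl

theorem ent_zero {M N : Mat_ C} (i j) : ent (0 : M ⟶ N) i j = 0 := rfl

/-- `g` has exactly one nonzero entry `φ i` in each row `i`, in the column `e i`. -/
structure IsMono {M N : Mat_ C} (g : M ⟶ N) (e : M.ι → N.ι) (φ : ∀ i, M.X i ⟶ N.X (e i)) :
    Prop where
  self : ∀ i, ent g i (e i) = φ i
  ne : ∀ i j, e i ≠ j → ent g i j = 0

theorem IsMono.ext {M N : Mat_ C} {g g' : M ⟶ N} {e : M.ι → N.ι} {φ : ∀ i, M.X i ⟶ N.X (e i)}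
    (h : IsMono g e φ) (h' : IsMono g' e φ) : g = g' := by
  apply ent_ext
  intro i j
  by_cases hij : e i = j
  · subst hij; rw [h.self, h'.self]
  · rw [h.ne _ _ hij, h'.ne _ _ hij]

theorem IsMono.comp_apply {M N K : Mat_ C} {g : M ⟶ N} {e : M.ι → N.ι}
    {φ : ∀ i, M.X i ⟶ N.X (e i)} (h : IsMono g e φ) (f : N ⟶ K) (i k) :
    ent (g ≫ f) i k = φ i ≫ ent f (e i) k := by
  rw [ent_comp, Finset.sum_eq_single (e i)]
  · rw [h.self]
  · intro j _ hj
    rw [h.ne _ _ hj.symm, Limits.zero_comp]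
  · intro h; exact (h (Finset.mem_univ _)).elim

theorem IsMono.apply_comp {M N K : Mat_ C} {g : M ⟶ N} {e : M.ι → N.ι}
    {φ : ∀ i, M.X i ⟶ N.X (e i)} (h : IsMono g e φ) (he : Function.Injective e) (f : K ⟶ M) (k i) :
    ent (f ≫ g) k (e i) = ent f k i ≫ φ i := by
  rw [ent_comp, Finset.sum_eq_single i]
  · rw [h.self]
  · intro j _ hj
    rw [h.ne _ _ (fun h => hj (he h)), Limits.comp_zero]
  · intro h; exact (h (Finset.mem_univ _)).elim

theorem isMono_id (M : Mat_ C) : IsMono (𝟙 M) (fun i => i) (fun i => 𝟙 (M.X i)) :=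
  ⟨fun i => Mat_.id_apply_self M i, fun i j h => Mat_.id_apply_of_ne M i j h⟩

theorem IsMono.comp {M N K : Mat_ C} {g : M ⟶ N} {e : M.ι → N.ι}
    {φ : ∀ i, M.X i ⟶ N.X (e i)} (h : IsMono g e φ) {g' : N ⟶ K} {e' : N.ι → K.ι}
    {φ' : ∀ i, N.X i ⟶ K.X (e' i)} (h' : IsMono g' e' φ') :
    IsMono (g ≫ g') (fun i => e' (e i)) (fun i => φ i ≫ φ' (e i)) := by
  constructor
  · intro i; rw [h.comp_apply, h'.self]
  · intro i j hij; rw [h.comp_apply, h'.ne _ _ hij, Limits.comp_zero]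

/-- The matrix of a bijection of index sets together with morphisms of the entries. -/
noncomputable def mono {M N : Mat_ C} (e : M.ι → N.ι) (φ : ∀ i, M.X i ⟶ N.X (e i)) : M ⟶ N :=
  open Classical in
  ofEnt fun i j => if h : e i = j then φ i ≫ eqToHom (congrArg N.X h) else 0

theorem isMono_mono {M N : Mat_ C} (e : M.ι → N.ι) (φ : ∀ i, M.X i ⟶ N.X (e i)) :
    IsMono (mono e φ) e φ := by
  constructor
  · intro i; rw [mono, ent_ofEnt, dif_pos rfl, eqToHom_refl, Category.comp_id]
  · intro i j h; rw [mono, ent_ofEnt, dif_neg h]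

/-- A bijection of index sets with isomorphisms of the entries gives an isomorphism. -/
noncomputable def monoIso {M N : Mat_ C} (e : M.ι → N.ι) (e' : N.ι → M.ι)
    (h : ∀ i, e' (e i) = i) (h' : ∀ j, e (e' j) = j) (φ : ∀ i, M.X i ≅ N.X (e i)) : M ≅ N where
  hom := mono e fun i => (φ i).hom
  inv := mono e' fun j => eqToHom (congrArg N.X (h' j).symm) ≫ (φ (e' j)).inv
  hom_inv_id := by
    have key := (isMono_mono e fun i => (φ i).hom).comp
      (isMono_mono e' fun j => eqToHom (congrArg N.X (h' j).symm) ≫ (φ (e' j)).inv)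
    apply ent_ext
    intro i j
    by_cases hij : i = j
    · subst hij
      rw [(isMono_id M).self]
      have h2 : ∀ i' (hi : i' = i), (φ i).hom ≫ eqToHom (by rw [hi]) ≫ (φ i').inv ≫
          eqToHom (congrArg M.X hi) = 𝟙 _ := by
        rintro _ rfl; simp
      rw [(isMono_mono e fun i => (φ i).hom).comp_apply, mono, ent_ofEnt, dif_pos (h i),
        Category.assoc]
      exact h2 _ (h i)
    · rw [(isMono_id M).ne _ _ hij, key.ne _ _ (by rw [h]; exact hij)]
  inv_hom_id := by
    have key := (isMono_mono e' fun j => eqToHom (congrArg N.X (h' j).symm) ≫ (φ (e' j)).inv).comp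
      (isMono_mono e fun i => (φ i).hom)
    apply ent_ext
    intro i j
    by_cases hij : i = j
    · subst hij
      rw [(isMono_id N).self, (isMono_mono e' fun j => eqToHom (congrArg N.X (h' j).symm) ≫
        (φ (e' j)).inv).comp_apply, mono, ent_ofEnt, dif_pos (h' i)]
      simp
    · rw [(isMono_id N).ne _ _ hij, key.ne _ _ (by rw [h']; exact hij)]

variable [MonoidalCategory C] [MonoidalPreadditive C]

/-- Tensor product of objects: all pairwise tensor products. -/
abbrev tobj (M N : Mat_ C) : Mat_ C := ⟨M.ι × N.ι, fun p => M.X p.1 ⊗ N.X p.2⟩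

/-- Tensor product of matrices of morphisms. -/
def tens {M N M' N' : Mat_ C} (f : M ⟶ N) (g : M' ⟶ N') : tobj M M' ⟶ tobj N N' :=
  ofEnt fun p q => ent f p.1 q.1 ⊗ₘ ent g p.2 q.2

theorem ent_tens {M N M' N' : Mat_ C} (f : M ⟶ N) (g : M' ⟶ N') (p q) :
    ent (tens f g) p q = ent f p.1 q.1 ⊗ₘ ent g p.2 q.2 := rfl

theorem tens_comp {M N K M' N' K' : Mat_ C} (f : M ⟶ N) (g : M' ⟶ N') (f' : N ⟶ K) (g' : N' ⟶ K') :
    tens f g ≫ tens f' g' = tens (f ≫ f') (g ≫ g') := by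
  apply ent_ext
  intro p q
  rw [ent_comp, ent_tens, ent_comp, ent_comp, sum_tensor]
  refine (Fintype.sum_prod_type _).trans ?_
  refine Finset.sum_congr rfl fun i _ => ?_
  rw [tensor_sum]
  refine Finset.sum_congr rfl fun j _ => ?_
  exact tensorHom_comp_tensorHom _ _ _ _

theorem IsMono.tens {M N M' N' : Mat_ C} {g : M ⟶ N} {e : M.ι → N.ι}
    {φ : ∀ i, M.X i ⟶ N.X (e i)} (h : IsMono g e φ) {g' : M' ⟶ N'} {e' : M'.ι → N'.ι}
    {φ' : ∀ i, M'.X i ⟶ N'.X (e' i)} (h' : IsMono g' e' φ') :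
    IsMono (tens g g') (fun p => (e p.1, e' p.2)) (fun p => φ p.1 ⊗ₘ φ' p.2) := by
  constructor
  · rintro ⟨i, i'⟩
    rw [ent_tens, h.self, h'.self]
  · rintro ⟨i, i'⟩ ⟨j, j'⟩ hij
    rw [ent_tens]
    by_cases h1 : e i = j
    · have h2 : e' i' ≠ j' := fun h2 => hij (Prod.ext h1 h2)
      rw [h'.ne _ _ h2, MonoidalPreadditive.tensor_zero]
    · rw [h.ne _ _ h1, MonoidalPreadditive.zero_tensor]

theorem isMono_whiskerLeft (L : Mat_ C) {M N : Mat_ C} {g : M ⟶ N} {e : M.ι → N.ι}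
    {φ : ∀ i, M.X i ⟶ N.X (e i)} (h : IsMono g e φ) :
    IsMono (tens (𝟙 L) g) (fun p => (p.1, e p.2)) (fun p => L.X p.1 ◁ φ p.2) := by
  have := (isMono_id L).tens h
  simp only [id_tensorHom] at this
  exact this

theorem isMono_whiskerRight (L : Mat_ C) {M N : Mat_ C} {g : M ⟶ N} {e : M.ι → N.ι}
    {φ : ∀ i, M.X i ⟶ N.X (e i)} (h : IsMono g e φ) :
    IsMono (tens g (𝟙 L)) (fun p => (e p.1, p.2)) (fun p => φ p.1 ▷ L.X p.2) := by
  have := h.tens (isMono_id L)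
  simp only [tensorHom_id] at this
  exact this

theorem tens_id (M M' : Mat_ C) : tens (𝟙 M) (𝟙 M') = 𝟙 (tobj M M') := by
  have h := isMono_whiskerLeft M (isMono_id M')
  simp only [whiskerLeft_id] at h
  exact h.ext (isMono_id _)

/-- The associativity isomorphism. -/
noncomputable def assoc (L M N : Mat_ C) : tobj (tobj L M) N ≅ tobj L (tobj M N) :=
  monoIso (fun p => (p.1.1, (p.1.2, p.2))) (fun p => ((p.1, p.2.1), p.2.2)) (fun _ => rfl)
    (fun _ => rfl) fun _ => α_ _ _ _

/-- The left unit isomorphism. -/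
noncomputable def lunit (M : Mat_ C) : tobj ⟨Unit, fun _ => 𝟙_ C⟩ M ≅ M :=
  monoIso (fun p => p.2) (fun p => ((), p)) (fun _ => rfl) (fun _ => rfl) fun _ => λ_ _

/-- The right unit isomorphism. -/
noncomputable def runit (M : Mat_ C) : tobj M ⟨Unit, fun _ => 𝟙_ C⟩ ≅ M :=
  monoIso (fun p => p.1) (fun p => (p, ())) (fun _ => rfl) (fun _ => rfl) fun _ => ρ_ _

theorem isMono_assoc (L M N : Mat_ C) : IsMono (assoc L M N).hom (fun p => (p.1.1, (p.1.2, p.2)))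
    (fun p => (α_ (L.X p.1.1) (M.X p.1.2) (N.X p.2)).hom) := isMono_mono _ _

theorem isMono_lunit (M : Mat_ C) : IsMono (lunit M).hom (fun p => p.2)
    (fun p => (λ_ (M.X p.2)).hom) := isMono_mono _ _

theorem isMono_runit (M : Mat_ C) : IsMono (runit M).hom (fun p => p.1)
    (fun p => (ρ_ (M.X p.1)).hom) := isMono_mono _ _

theorem ent_id_unit (i j : Unit) :
    ent (𝟙 (⟨Unit, fun _ => 𝟙_ C⟩ : Mat_ C)) i j = 𝟙 (𝟙_ C) :=
  (isMono_id (⟨Unit, fun _ => 𝟙_ C⟩ : Mat_ C)).self i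

theorem assoc_nat {L M N L' M' N' : Mat_ C} (f : L ⟶ L') (g : M ⟶ M') (h : N ⟶ N') :
    tens (tens f g) h ≫ (assoc L' M' N').hom = (assoc L M N).hom ≫ tens f (tens g h) := by
  apply ent_ext
  rintro p ⟨a, b, c⟩
  refine ((isMono_assoc L' M' N').apply_comp ?_ _ p ((a, b), c)).trans
    (Eq.trans ?_ ((isMono_assoc L M N).comp_apply _ _ _).symm)
  · rintro ⟨⟨a, b⟩, c⟩ ⟨⟨a', b'⟩, c'⟩ h
    simp only [Prod.mk.injEq] at h
    obtain ⟨rfl, rfl, rfl⟩ := h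
    rfl
  · exact associator_naturality _ _ _

theorem lunit_nat {M N : Mat_ C} (f : M ⟶ N) :
    tens (𝟙 (⟨Unit, fun _ => 𝟙_ C⟩ : Mat_ C)) f ≫ (lunit N).hom = (lunit M).hom ≫ f := by
  apply ent_ext
  rintro p b
  refine ((isMono_lunit N).apply_comp ?_ _ p ((), b)).trans
    (Eq.trans ?_ ((isMono_lunit M).comp_apply _ _ _).symm)
  · rintro ⟨_, b⟩ ⟨_, b'⟩ h
    simp only at h
    subst h
    rfl
  · rw [ent_tens, ent_id_unit, id_tensorHom]
    exact leftUnitor_naturality _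

theorem runit_nat {M N : Mat_ C} (f : M ⟶ N) :
    tens f (𝟙 (⟨Unit, fun _ => 𝟙_ C⟩ : Mat_ C)) ≫ (runit N).hom = (runit M).hom ≫ f := by
  apply ent_ext
  rintro p b
  refine ((isMono_runit N).apply_comp ?_ _ p (b, ())).trans
    (Eq.trans ?_ ((isMono_runit M).comp_apply _ _ _).symm)
  · rintro ⟨b, _⟩ ⟨b', _⟩ h
    simp only at h
    subst h
    rfl
  · rw [ent_tens, ent_id_unit, tensorHom_id]
    exact rightUnitor_naturality _

theorem pent (W X Y Z : Mat_ C) :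
    tens (assoc W X Y).hom (𝟙 Z) ≫ (assoc W (tobj X Y) Z).hom ≫ tens (𝟙 W) (assoc X Y Z).hom =
      (assoc (tobj W X) Y Z).hom ≫ (assoc W X (tobj Y Z)).hom := by
  have h1 := (isMono_whiskerRight Z (isMono_assoc W X Y)).comp
    ((isMono_assoc W (tobj X Y) Z).comp (isMono_whiskerLeft W (isMono_assoc X Y Z)))
  have h2 := (isMono_assoc (tobj W X) Y Z).comp (isMono_assoc W X (tobj Y Z))
  simp only [pentagon] at h1
  exact h1.ext h2

theorem tri (X Y : Mat_ C) :
    (assoc X ⟨Unit, fun _ => 𝟙_ C⟩ Y).hom ≫ tens (𝟙 X) (lunit Y).hom =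
      tens (runit X).hom (𝟙 Y) := by
  have h1 := (isMono_assoc X ⟨Unit, fun _ => 𝟙_ C⟩ Y).comp (isMono_whiskerLeft X (isMono_lunit Y))
  have h2 := isMono_whiskerRight Y (isMono_runit X)
  simp only [triangle] at h1
  exact h1.ext h2

noncomputable instance : MonoidalCategory (Mat_ C) where
  tensorObj M N := tobj M N
  tensorUnit := ⟨Unit, fun _ => 𝟙_ C⟩
  tensorHom f g := tens f g
  whiskerLeft M _ _ f := tens (𝟙 M) f
  whiskerRight f M := tens f (𝟙 M)
  associator L M N := assoc L M N
  leftUnitor M := lunit M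
  rightUnitor M := runit M
  tensorHom_def f g := by rw [tens_comp, Category.id_comp, Category.comp_id]
  id_tensorHom_id M N := tens_id M N
  tensorHom_comp_tensorHom f g h i := tens_comp f g h i
  whiskerLeft_id M N := tens_id M N
  id_whiskerRight M N := tens_id M N
  associator_naturality f g h := assoc_nat f g h
  leftUnitor_naturality f := lunit_nat f
  rightUnitor_naturality f := runit_nat f
  pentagon W X Y Z := pent W X Y Z
  triangle X Y := tri X Y

theorem tens_add {M N M' N' : Mat_ C} (f : M ⟶ N) (g h : M' ⟶ N') :
    tens f (g + h) = tens f g + tens f h := by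
  apply ent_ext
  intro p q
  rw [ent_tens, ent_add, ent_add, ent_tens, ent_tens, MonoidalPreadditive.tensor_add]

theorem add_tens {M N M' N' : Mat_ C} (f g : M ⟶ N) (h : M' ⟶ N') :
    tens (f + g) h = tens f h + tens g h := by
  apply ent_ext
  intro p q
  rw [ent_tens, ent_add, ent_add, ent_tens, ent_tens, MonoidalPreadditive.add_tensor]

theorem tens_zero {M N M' N' : Mat_ C} (f : M ⟶ N) :
    tens f (0 : M' ⟶ N') = 0 := by
  apply ent_ext
  intro p q
  rw [ent_tens, ent_zero, ent_zero, MonoidalPreadditive.tensor_zero]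

theorem zero_tens {M N M' N' : Mat_ C} (h : M' ⟶ N') :
    tens (0 : M ⟶ N) h = 0 := by
  apply ent_ext
  intro p q
  rw [ent_tens, ent_zero, ent_zero, MonoidalPreadditive.zero_tensor]

instance : MonoidalPreadditive (Mat_ C) where
  whiskerLeft_zero := tens_zero _
  zero_whiskerRight := zero_tens _
  whiskerLeft_add f g := tens_add _ f g
  add_whiskerRight f g := add_tens f g _

end MatMonoidal

/-! ### The monoidal structure on the idempotent completion -/

namespace KaroubiMonoidal
open Idempotents
universe v u
variable {C : Type u} [Category.{v} C]

/-- An isomorphism of underlying objects that commutes with the idempotents. -/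
def karIso {P Q : Karoubi C} (φ : P.X ≅ Q.X) (h : P.p ≫ φ.hom = φ.hom ≫ Q.p) : P ≅ Q where
  hom := ⟨P.p ≫ φ.hom, by rw [Category.assoc, ← h, ← Category.assoc, ← Category.assoc,
    P.idem, P.idem]⟩
  inv := ⟨Q.p ≫ φ.inv, by
    have h' : φ.inv ≫ P.p = Q.p ≫ φ.inv := by
      rw [Iso.inv_comp_eq, ← Category.assoc, ← h, Category.assoc, Iso.hom_inv_id,
        Category.comp_id]
    rw [Category.assoc, h', ← Category.assoc, ← Category.assoc, Q.idem, Q.idem]⟩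
  hom_inv_id := by
    apply Karoubi.hom_ext
    change (P.p ≫ φ.hom) ≫ Q.p ≫ φ.inv = P.p
    rw [Category.assoc, ← Category.assoc φ.hom, ← h, Category.assoc, Iso.hom_inv_id,
      Category.comp_id, P.idem]
  inv_hom_id := by
    have h' : φ.inv ≫ P.p = Q.p ≫ φ.inv := by
      rw [Iso.inv_comp_eq, ← Category.assoc, ← h, Category.assoc, Iso.hom_inv_id,
        Category.comp_id]
    apply Karoubi.hom_ext
    change (Q.p ≫ φ.inv) ≫ P.p ≫ φ.hom = Q.p
    rw [Category.assoc, ← Category.assoc φ.inv, h', Category.assoc, Iso.inv_hom_id,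
      Category.comp_id, Q.idem]

variable [MonoidalCategory C]

/-- Tensor product of formal direct factors. -/
abbrev kobj (P Q : Karoubi C) : Karoubi C :=
  ⟨P.X ⊗ Q.X, P.p ⊗ₘ Q.p, by rw [tensorHom_comp_tensorHom, P.idem, Q.idem]⟩

/-- Tensor product of morphisms between formal direct factors. -/
def khom {P Q P' Q' : Karoubi C} (f : P ⟶ Q) (g : P' ⟶ Q') : kobj P P' ⟶ kobj Q Q' :=
  ⟨f.f ⊗ₘ g.f, by
    rw [tensorHom_comp_tensorHom, tensorHom_comp_tensorHom, f.comm, g.comm]⟩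

/-- The unit object. -/
abbrev kunit : Karoubi C := ⟨𝟙_ C, 𝟙 _, by rw [Category.comp_id]⟩

theorem khom_f {P Q P' Q' : Karoubi C} (f : P ⟶ Q) (g : P' ⟶ Q') :
    (khom f g).f = f.f ⊗ₘ g.f := rfl

/-- The associativity isomorphism. -/
def kassoc (P Q R : Karoubi C) : kobj (kobj P Q) R ≅ kobj P (kobj Q R) :=
  karIso (α_ P.X Q.X R.X) (associator_naturality _ _ _)

/-- The left unit isomorphism. -/
def klunit (P : Karoubi C) : kobj kunit P ≅ P :=
  karIso (λ_ P.X) (by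
    change (𝟙 _ ⊗ₘ P.p) ≫ _ = _
    rw [id_tensorHom]; exact leftUnitor_naturality _)

/-- The right unit isomorphism. -/
def krunit (P : Karoubi C) : kobj P kunit ≅ P :=
  karIso (ρ_ P.X) (by
    change (P.p ⊗ₘ 𝟙 _) ≫ _ = _
    rw [tensorHom_id]; exact rightUnitor_naturality _)

theorem kassoc_f (P Q R : Karoubi C) :
    (kassoc P Q R).hom.f = ((P.p ⊗ₘ Q.p) ⊗ₘ R.p) ≫ (α_ P.X Q.X R.X).hom := rfl

theorem kassoc_f' (P Q R : Karoubi C) :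
    (kassoc P Q R).hom.f = (α_ P.X Q.X R.X).hom ≫ (P.p ⊗ₘ (Q.p ⊗ₘ R.p)) := by
  rw [kassoc_f, associator_naturality]

theorem klunit_f (P : Karoubi C) :
    (klunit P).hom.f = (λ_ P.X).hom ≫ P.p := by
  change (𝟙 _ ⊗ₘ P.p) ≫ _ = _
  rw [id_tensorHom, leftUnitor_naturality]

theorem krunit_f (P : Karoubi C) :
    (krunit P).hom.f = (ρ_ P.X).hom ≫ P.p := by
  change (P.p ⊗ₘ 𝟙 _) ≫ _ = _
  rw [tensorHom_id, rightUnitor_naturality]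

theorem khom_comp {P Q R P' Q' R' : Karoubi C} (f : P ⟶ Q) (g : P' ⟶ Q') (f' : Q ⟶ R)
    (g' : Q' ⟶ R') : khom f g ≫ khom f' g' = khom (f ≫ f') (g ≫ g') := by
  apply Karoubi.hom_ext
  rw [Karoubi.comp_f, khom_f, khom_f, khom_f, tensorHom_comp_tensorHom]
  rfl

theorem kassoc_nat {P Q R P' Q' R' : Karoubi C} (f : P ⟶ P') (g : Q ⟶ Q') (h : R ⟶ R') :
    khom (khom f g) h ≫ (kassoc P' Q' R').hom = (kassoc P Q R).hom ≫ khom f (khom g h) := by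
  apply Karoubi.hom_ext
  rw [Karoubi.comp_f, Karoubi.comp_f, kassoc_f, kassoc_f', khom_f, khom_f, khom_f, khom_f,
    ← Category.assoc, tensorHom_comp_tensorHom, tensorHom_comp_tensorHom, Category.assoc,
    tensorHom_comp_tensorHom, tensorHom_comp_tensorHom]
  rw [Karoubi.comp_p, Karoubi.comp_p, Karoubi.comp_p, Karoubi.p_comp, Karoubi.p_comp,
    Karoubi.p_comp, associator_naturality]

theorem klunit_nat {P Q : Karoubi C} (f : P ⟶ Q) :
    khom (𝟙 kunit) f ≫ (klunit Q).hom = (klunit P).hom ≫ f := by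
  apply Karoubi.hom_ext
  rw [Karoubi.comp_f, Karoubi.comp_f, klunit_f, klunit_f, khom_f]
  change (𝟙 _ ⊗ₘ f.f) ≫ _ = _
  rw [id_tensorHom, ← Category.assoc, leftUnitor_naturality, Category.assoc, Category.assoc,
    Karoubi.comp_p, Karoubi.p_comp]

theorem krunit_nat {P Q : Karoubi C} (f : P ⟶ Q) :
    khom f (𝟙 kunit) ≫ (krunit Q).hom = (krunit P).hom ≫ f := by
  apply Karoubi.hom_ext
  rw [Karoubi.comp_f, Karoubi.comp_f, krunit_f, krunit_f, khom_f]
  change (f.f ⊗ₘ 𝟙 _) ≫ _ = _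
  rw [tensorHom_id, ← Category.assoc, rightUnitor_naturality, Category.assoc, Category.assoc,
    Karoubi.comp_p, Karoubi.p_comp]

theorem kpent (W X Y Z : Karoubi C) :
    khom (kassoc W X Y).hom (𝟙 Z) ≫ (kassoc W (kobj X Y) Z).hom ≫ khom (𝟙 W) (kassoc X Y Z).hom =
      (kassoc (kobj W X) Y Z).hom ≫ (kassoc W X (kobj Y Z)).hom := by
  apply Karoubi.hom_ext
  simp only [Karoubi.comp_f, khom_f, Karoubi.id_f]
  have e1 : (kassoc W X Y).hom.f ⊗ₘ Z.p = (((W.p ⊗ₘ X.p) ⊗ₘ Y.p) ⊗ₘ Z.p) ≫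
      ((α_ W.X X.X Y.X).hom ▷ Z.X) := by
    rw [← tensorHom_id, tensorHom_comp_tensorHom, Category.comp_id, kassoc_f]
  have e2 : W.p ⊗ₘ (kassoc X Y Z).hom.f = (W.p ⊗ₘ ((X.p ⊗ₘ Y.p) ⊗ₘ Z.p)) ≫
      (W.X ◁ (α_ X.X Y.X Z.X).hom) := by
    rw [← id_tensorHom, tensorHom_comp_tensorHom, Category.comp_id, kassoc_f]
  have e3 : (kassoc W (kobj X Y) Z).hom.f = (α_ W.X (X.X ⊗ Y.X) Z.X).hom ≫
    (W.p ⊗ₘ ((X.p ⊗ₘ Y.p) ⊗ₘ Z.p)) := kassoc_f' _ _ _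
  have e4 : (kassoc (kobj W X) Y Z).hom.f =
    (((W.p ⊗ₘ X.p) ⊗ₘ Y.p) ⊗ₘ Z.p) ≫ (α_ (W.X ⊗ X.X) Y.X Z.X).hom := rfl
  have e5 : (kassoc W X (kobj Y Z)).hom.f = (α_ W.X X.X (Y.X ⊗ Z.X)).hom ≫
    (W.p ⊗ₘ (X.p ⊗ₘ (Y.p ⊗ₘ Z.p))) := kassoc_f' _ _ _
  have e6 : (W.p ⊗ₘ ((X.p ⊗ₘ Y.p) ⊗ₘ Z.p)) ≫ (W.X ◁ (α_ X.X Y.X Z.X).hom) =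
      (W.X ◁ (α_ X.X Y.X Z.X).hom) ≫ (W.p ⊗ₘ (X.p ⊗ₘ (Y.p ⊗ₘ Z.p))) := by
    rw [← id_tensorHom, tensorHom_comp_tensorHom, tensorHom_comp_tensorHom,
      associator_naturality, Category.comp_id, Category.id_comp]
  have e7 : (W.p ⊗ₘ (X.p ⊗ₘ (Y.p ⊗ₘ Z.p))) ≫ (W.p ⊗ₘ (X.p ⊗ₘ (Y.p ⊗ₘ Z.p))) =
      (W.p ⊗ₘ (X.p ⊗ₘ (Y.p ⊗ₘ Z.p))) := by
    simp only [tensorHom_comp_tensorHom, Karoubi.idem]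
  rw [e1, e2, e3, e4, e5, e6]
  simp only [Category.assoc]
  rw [← Category.assoc (W.p ⊗ₘ ((X.p ⊗ₘ Y.p) ⊗ₘ Z.p)), e6, Category.assoc, e7]
  rw [← pentagon_assoc]

theorem ktri (X Y : Karoubi C) :
    (kassoc X kunit Y).hom ≫ khom (𝟙 X) (klunit Y).hom = khom (krunit X).hom (𝟙 Y) := by
  apply Karoubi.hom_ext
  simp only [Karoubi.comp_f, khom_f, Karoubi.id_f]
  have e1 : X.p ⊗ₘ (klunit Y).hom.f = (X.X ◁ (λ_ Y.X).hom) ≫ (X.p ⊗ₘ Y.p) := by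
    rw [← id_tensorHom, tensorHom_comp_tensorHom, Category.id_comp, klunit_f]
  have e2 : (krunit X).hom.f ⊗ₘ Y.p = ((ρ_ X.X).hom ▷ Y.X) ≫ (X.p ⊗ₘ Y.p) := by
    rw [← tensorHom_id, tensorHom_comp_tensorHom, Category.id_comp, krunit_f]
  have e3 : (kassoc X kunit Y).hom.f = (α_ X.X (𝟙_ C) Y.X).hom ≫ (X.p ⊗ₘ (𝟙 _ ⊗ₘ Y.p)) :=
    kassoc_f' _ _ _
  have e4 : (X.p ⊗ₘ (𝟙 (𝟙_ C) ⊗ₘ Y.p)) ≫ (X.X ◁ (λ_ Y.X).hom) =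
      (X.X ◁ (λ_ Y.X).hom) ≫ (X.p ⊗ₘ Y.p) := by
    rw [← id_tensorHom X.X, tensorHom_comp_tensorHom, tensorHom_comp_tensorHom, id_tensorHom,
      leftUnitor_naturality, Category.comp_id, Category.id_comp]
  rw [e1, e2, e3, Category.assoc, ← Category.assoc (X.p ⊗ₘ _), e4, Category.assoc,
    tensorHom_comp_tensorHom, X.idem, Y.idem, triangle_assoc]

instance : MonoidalCategory (Karoubi C) where
  tensorObj P Q := kobj P Q
  tensorUnit := kunit
  tensorHom f g := khom f g
  whiskerLeft P _ _ f := khom (𝟙 P) f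
  whiskerRight f P := khom f (𝟙 P)
  associator P Q R := kassoc P Q R
  leftUnitor P := klunit P
  rightUnitor P := krunit P
  tensorHom_def f g := by rw [khom_comp, Category.id_comp, Category.comp_id]
  id_tensorHom_id _ _ := rfl
  tensorHom_comp_tensorHom f g h i := khom_comp f g h i
  whiskerLeft_id _ _ := rfl
  id_whiskerRight _ _ := rfl
  associator_naturality f g h := kassoc_nat f g h
  leftUnitor_naturality f := klunit_nat f
  rightUnitor_naturality f := krunit_nat f
  pentagon W X Y Z := kpent W X Y Z
  triangle X Y := ktri X Y

variable [Preadditive C] [MonoidalPreadditive C]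

theorem khom_add {P Q P' Q' : Karoubi C} (f : P ⟶ Q) (g h : P' ⟶ Q') :
    khom f (g + h) = khom f g + khom f h := by
  apply Karoubi.hom_ext
  exact MonoidalPreadditive.tensor_add _ _ _

theorem add_khom {P Q P' Q' : Karoubi C} (f g : P ⟶ Q) (h : P' ⟶ Q') :
    khom (f + g) h = khom f h + khom g h := by
  apply Karoubi.hom_ext
  exact MonoidalPreadditive.add_tensor _ _ _

theorem khom_zero {P Q P' Q' : Karoubi C} (f : P ⟶ Q) : khom f (0 : P' ⟶ Q') = 0 := by
  apply Karoubi.hom_ext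
  exact MonoidalPreadditive.tensor_zero _

theorem zero_khom {P Q P' Q' : Karoubi C} (h : P' ⟶ Q') : khom (0 : P ⟶ Q) h = 0 := by
  apply Karoubi.hom_ext
  exact MonoidalPreadditive.zero_tensor _

instance : MonoidalPreadditive (Karoubi C) where
  whiskerLeft_zero := khom_zero _
  zero_whiskerRight := zero_khom _
  whiskerLeft_add f g := khom_add _ f g
  add_whiskerRight f g := add_khom f g _

end KaroubiMonoidal

/-! ### Quotient by the tensor ideal generated by a morphism -/

namespace TensorQuotient
universe v u
variable {C : Type u} [Category.{v} C] [Preadditive C] [MonoidalCategory C]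

/-- The ideal of morphisms generated by the morphisms satisfying `S`: the smallest family of
morphisms containing them and closed under addition, under composition with arbitrary morphisms
on both sides and under tensoring with identities on both sides. -/
inductive Ideal (S : ∀ ⦃X Y : C⦄, (X ⟶ Y) → Prop) : ∀ ⦃X Y : C⦄, (X ⟶ Y) → Prop
  | of {X Y : C} (f : X ⟶ Y) : S f → Ideal S f
  | zero (X Y : C) : Ideal S (0 : X ⟶ Y)
  | add {X Y : C} (f g : X ⟶ Y) : Ideal S f → Ideal S g → Ideal S (f + g)
  | precomp {X Y Z : C} (f : X ⟶ Y) (g : Y ⟶ Z) : Ideal S g → Ideal S (f ≫ g)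
  | postcomp {X Y Z : C} (f : X ⟶ Y) (g : Y ⟶ Z) : Ideal S f → Ideal S (f ≫ g)
  | whiskerLeft (X : C) {Y Z : C} (f : Y ⟶ Z) : Ideal S f → Ideal S (X ◁ f)
  | whiskerRight {X Y : C} (f : X ⟶ Y) (Z : C) : Ideal S f → Ideal S (f ▷ Z)

variable (S : ∀ ⦃X Y : C⦄, (X ⟶ Y) → Prop)

/-- Two morphisms are identified if their difference lies in the ideal. -/
def rel : HomRel C := fun _ _ f g => Ideal S (f - g)

variable {S}

theorem Ideal.neg {X Y : C} {f : X ⟶ Y} (h : Ideal S f) : Ideal S (-f) := by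
  have := Ideal.precomp (-𝟙 X) f h
  rwa [Preadditive.neg_comp, Category.id_comp] at this

variable (S)

instance : Congruence (rel S) where
  equivalence :=
    { refl := fun f => by rw [rel, sub_self]; exact Ideal.zero _ _
      symm := fun {f g} h => by rw [rel, ← neg_sub]; exact Ideal.neg h
      trans := fun {f g h} h1 h2 => by
        rw [rel, ← sub_add_sub_cancel f g h]; exact Ideal.add _ _ h1 h2 }
  comp_left f g g' h := by
    rw [rel, ← Preadditive.comp_sub]; exact Ideal.precomp _ _ h
  comp_right g h := by
    rw [rel, ← Preadditive.sub_comp]; exact Ideal.postcomp _ _ h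

theorem rel_add ⦃X Y : C⦄ (f₁ f₂ g₁ g₂ : X ⟶ Y) (h : rel S f₁ f₂) (h' : rel S g₁ g₂) :
    rel S (f₁ + g₁) (f₂ + g₂) := by
  rw [rel, add_sub_add_comm]; exact Ideal.add _ _ h h'

/-- The quotient of a monoidal preadditive category by the ideal generated by `S`. -/
abbrev Quo := CategoryTheory.Quotient (rel S)

noncomputable instance : Preadditive (Quo S) := Quotient.preadditive (rel S) (rel_add S)

/-- The quotient functor. -/
abbrev proj : C ⥤ Quo S := Quotient.functor (rel S)

instance : (proj S).Additive := Quotient.functor_additive (rel S) (rel_add S)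

theorem proj_eq {X Y : C} {f g : X ⟶ Y} : (proj S).map f = (proj S).map g ↔ Ideal S (f - g) :=
  Quotient.functor_map_eq_iff (rel S) f g

variable [MonoidalPreadditive C]

theorem whiskerLeft_sub' (X : C) {Y Z : C} (f g : Y ⟶ Z) : X ◁ (f - g) = X ◁ f - X ◁ g := by
  rw [eq_sub_iff_add_eq, ← MonoidalPreadditive.whiskerLeft_add, sub_add_cancel]

theorem sub_whiskerRight' {X Y : C} (f g : X ⟶ Y) (Z : C) : (f - g) ▷ Z = f ▷ Z - g ▷ Z := by
  rw [eq_sub_iff_add_eq, ← MonoidalPreadditive.add_whiskerRight, sub_add_cancel]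

/-- Left whiskering in the quotient. -/
def wl (X : Quo S) {Y Z : Quo S} (f : Y ⟶ Z) :
    (proj S).obj (X.as ⊗ Y.as) ⟶ (proj S).obj (X.as ⊗ Z.as) :=
  Quot.lift (fun g => (proj S).map (X.as ◁ g)) (by
    intro g g' h
    rw [HomRel.compClosure_iff_self] at h
    rw [proj_eq, ← whiskerLeft_sub']
    exact Ideal.whiskerLeft _ _ h) f

/-- Right whiskering in the quotient. -/
def wr {X Y : Quo S} (f : X ⟶ Y) (Z : Quo S) :
    (proj S).obj (X.as ⊗ Z.as) ⟶ (proj S).obj (Y.as ⊗ Z.as) :=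
  Quot.lift (fun g => (proj S).map (g ▷ Z.as)) (by
    intro g g' h
    rw [HomRel.compClosure_iff_self] at h
    rw [proj_eq, ← sub_whiskerRight']
    exact Ideal.whiskerRight _ _ h) f

theorem wl_map (X : C) {Y Z : C} (f : Y ⟶ Z) :
    wl S ((proj S).obj X) ((proj S).map f) = (proj S).map (X ◁ f) := rfl

theorem wr_map {X Y : C} (f : X ⟶ Y) (Z : C) :
    wr S ((proj S).map f) ((proj S).obj Z) = (proj S).map (f ▷ Z) := rfl

theorem exists_rep {X Y : C} (f : (proj S).obj X ⟶ (proj S).obj Y) :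
    ∃ g : X ⟶ Y, (proj S).map g = f := (proj S).map_surjective f

instance : MonoidalCategory (Quo S) where
  tensorObj X Y := (proj S).obj (X.as ⊗ Y.as)
  tensorUnit := (proj S).obj (𝟙_ C)
  whiskerLeft X _ _ f := wl S X f
  whiskerRight f Y := wr S f Y
  tensorHom f g := wr S f _ ≫ wl S _ g
  associator X Y Z := (proj S).mapIso (α_ X.as Y.as Z.as)
  leftUnitor X := (proj S).mapIso (λ_ X.as)
  rightUnitor X := (proj S).mapIso (ρ_ X.as)
  tensorHom_def _ _ := rfl
  id_tensorHom_id X Y := by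
    have h := congrArg (proj S).map (id_tensorHom_id X.as Y.as)
    rw [MonoidalCategory.tensorHom_def, CategoryTheory.Functor.map_comp, CategoryTheory.Functor.map_id] at h
    exact h
  tensorHom_comp_tensorHom {X₁ Y₁ Z₁ X₂ Y₂ Z₂} f₁ f₂ g₁ g₂ := by
    obtain ⟨f₁, rfl⟩ := exists_rep S (X := X₁.as) (Y := Y₁.as) f₁
    obtain ⟨f₂, rfl⟩ := exists_rep S (X := X₂.as) (Y := Y₂.as) f₂
    obtain ⟨g₁, rfl⟩ := exists_rep S (X := Y₁.as) (Y := Z₁.as) g₁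
    obtain ⟨g₂, rfl⟩ := exists_rep S (X := Y₂.as) (Y := Z₂.as) g₂
    have h := congrArg (proj S).map (tensorHom_comp_tensorHom f₁ f₂ g₁ g₂)
    simp only [MonoidalCategory.tensorHom_def, CategoryTheory.Functor.map_comp] at h
    exact h
  whiskerLeft_id X Y := by
    have h := congrArg (proj S).map (whiskerLeft_id X.as Y.as)
    rw [CategoryTheory.Functor.map_id] at h
    exact h
  id_whiskerRight X Y := by
    have h := congrArg (proj S).map (id_whiskerRight X.as Y.as)
    rw [CategoryTheory.Functor.map_id] at h
    exact h
  associator_naturality {X₁ X₂ X₃ Y₁ Y₂ Y₃} f₁ f₂ f₃ := by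
    obtain ⟨f₁, rfl⟩ := exists_rep S (X := X₁.as) (Y := Y₁.as) f₁
    obtain ⟨f₂, rfl⟩ := exists_rep S (X := X₂.as) (Y := Y₂.as) f₂
    obtain ⟨f₃, rfl⟩ := exists_rep S (X := X₃.as) (Y := Y₃.as) f₃
    have h := congrArg (proj S).map (associator_naturality f₁ f₂ f₃)
    simp only [MonoidalCategory.tensorHom_def] at h
    exact h
  leftUnitor_naturality {X Y} f := by
    obtain ⟨f, rfl⟩ := exists_rep S (X := X.as) (Y := Y.as) f
    have h := congrArg (proj S).map (leftUnitor_naturality f)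
    rw [CategoryTheory.Functor.map_comp, CategoryTheory.Functor.map_comp] at h
    exact h
  rightUnitor_naturality {X Y} f := by
    obtain ⟨f, rfl⟩ := exists_rep S (X := X.as) (Y := Y.as) f
    have h := congrArg (proj S).map (rightUnitor_naturality f)
    rw [CategoryTheory.Functor.map_comp, CategoryTheory.Functor.map_comp] at h
    exact h
  pentagon W X Y Z := by
    have h := congrArg (proj S).map (pentagon W.as X.as Y.as Z.as)
    simp only [CategoryTheory.Functor.map_comp] at h
    exact h
  triangle X Y := by
    have h := congrArg (proj S).map (triangle X.as Y.as)
    simp only [CategoryTheory.Functor.map_comp] at h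
    exact h

instance : MonoidalPreadditive (Quo S) where
  whiskerLeft_zero {X Y Z} := by
    have h := congrArg (proj S).map (MonoidalPreadditive.whiskerLeft_zero (X := X.as) (Y := Y.as) (Z := Z.as))
    exact h
  zero_whiskerRight {X Y Z} := by
    have h := congrArg (proj S).map (MonoidalPreadditive.zero_whiskerRight (X := X.as) (Y := Y.as) (Z := Z.as))
    exact h
  whiskerLeft_add {X Y Z} f g := by
    obtain ⟨f, rfl⟩ := exists_rep S (X := Y.as) (Y := Z.as) f
    obtain ⟨g, rfl⟩ := exists_rep S (X := Y.as) (Y := Z.as) g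
    have h := congrArg (proj S).map (MonoidalPreadditive.whiskerLeft_add (X := X.as) f g)
    exact h
  add_whiskerRight {X Y Z} f g := by
    obtain ⟨f, rfl⟩ := exists_rep S (X := Y.as) (Y := Z.as) f
    obtain ⟨g, rfl⟩ := exists_rep S (X := Y.as) (Y := Z.as) g
    have h := congrArg (proj S).map (MonoidalPreadditive.add_whiskerRight (X := X.as) f g)
    exact h

instance [Limits.HasFiniteBiproducts C] : Limits.HasFiniteBiproducts (Quo S) where
  out n :=
    { has_biproduct := fun F =>
        inferInstanceAs (Limits.HasBiproduct fun i => (proj S).obj (F i).as) }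

end TensorQuotient

/-! ### Graded algebra objects on finite biproducts -/

section Graded
open Limits
universe v u
variable {C : Type u} [Category.{v} C] [Preadditive C] [MonoidalCategory C]
  [MonoidalPreadditive C] [HasFiniteBiproducts C] {N : ℕ} (G : Fin N → C)

/-- The multiplication on `⨁ G` that is the sum of given maps `μ i j : G i ⊗ G j ⟶ G (i + j)`
for `i + j < N` and of zero maps for the other `i` and `j`. -/
noncomputable def gradedMul
    (μ : ∀ (i j : Fin N) (h : (i : ℕ) + j < N), G i ⊗ G j ⟶ G ⟨i + j, h⟩) :
    (⨁ G) ⊗ (⨁ G) ⟶ ⨁ G :=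
  ∑ i : Fin N, ∑ j : Fin N, if h : (i : ℕ) + j < N then
    (biproduct.π G i ⊗ₘ biproduct.π G j) ≫ μ i j h ≫ biproduct.ι G ⟨i + j, h⟩ else 0

variable {G}

theorem ext_left {X Y : C} {f g : (⨁ G) ⊗ X ⟶ Y}
    (h : ∀ i, biproduct.ι G i ▷ X ≫ f = biproduct.ι G i ▷ X ≫ g) : f = g := by
  have e : 𝟙 ((⨁ G) ⊗ X) = ∑ i, biproduct.π G i ▷ X ≫ biproduct.ι G i ▷ X := by
    rw [← id_whiskerRight, ← biproduct.total, sum_whiskerRight]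
    simp only [comp_whiskerRight]
  rw [← Category.id_comp f, ← Category.id_comp g, e, Preadditive.sum_comp, Preadditive.sum_comp]
  simp only [Category.assoc, h]

theorem ext_right {X Y : C} {f g : X ⊗ (⨁ G) ⟶ Y}
    (h : ∀ i, X ◁ biproduct.ι G i ≫ f = X ◁ biproduct.ι G i ≫ g) : f = g := by
  have e : 𝟙 (X ⊗ (⨁ G)) = ∑ i, X ◁ biproduct.π G i ≫ X ◁ biproduct.ι G i := by
    rw [← MonoidalCategory.whiskerLeft_id, ← biproduct.total, whiskerLeft_sum]
    simp only [MonoidalCategory.whiskerLeft_comp]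
  rw [← Category.id_comp f, ← Category.id_comp g, e, Preadditive.sum_comp, Preadditive.sum_comp]
  simp only [Category.assoc, h]

theorem tensor_ι_π (i j a b : Fin N) :
    (biproduct.ι G i ⊗ₘ biproduct.ι G j) ≫ (biproduct.π G a ⊗ₘ biproduct.π G b) =
      if h : i = a ∧ j = b then
        eqToHom (congrArg G h.1) ⊗ₘ eqToHom (congrArg G h.2) else 0 := by
  rw [tensorHom_comp_tensorHom, biproduct.ι_π, biproduct.ι_π]
  by_cases h1 : i = a
  · by_cases h2 : j = b
    · rw [dif_pos h1, dif_pos h2, dif_pos ⟨h1, h2⟩]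
    · rw [dif_neg h2, dif_neg (fun h : i = a ∧ j = b => h2 h.2), MonoidalPreadditive.tensor_zero]
  · rw [dif_neg h1, dif_neg (fun h : i = a ∧ j = b => h1 h.1), MonoidalPreadditive.zero_tensor]

theorem ι_gradedMul (μ : ∀ (i j : Fin N) (h : (i : ℕ) + j < N), G i ⊗ G j ⟶ G ⟨i + j, h⟩)
    (i j : Fin N) :
    (biproduct.ι G i ⊗ₘ biproduct.ι G j) ≫ gradedMul G μ =
      if h : (i : ℕ) + j < N then μ i j h ≫ biproduct.ι G ⟨i + j, h⟩ else 0 := by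
  rw [gradedMul, Preadditive.comp_sum, Finset.sum_eq_single i]
  · rw [Preadditive.comp_sum, Finset.sum_eq_single j]
    · split_ifs with h
      · rw [← Category.assoc, tensor_ι_π, dif_pos ⟨rfl, rfl⟩, eqToHom_refl, eqToHom_refl,
          id_tensorHom_id, Category.id_comp]
      · rw [comp_zero]
    · intro b _ hb
      split_ifs
      · rw [← Category.assoc, tensor_ι_π, dif_neg (fun h => hb h.2.symm), zero_comp]
      · rw [comp_zero]
    · intro h; exact (h (Finset.mem_univ _)).elim
  · intro a _ ha
    rw [Preadditive.comp_sum]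
    refine Finset.sum_eq_zero fun b _ => ?_
    split_ifs
    · rw [← Category.assoc, tensor_ι_π, dif_neg (fun h => ha h.1.symm), zero_comp]
    · rw [comp_zero]
  · intro h; exact (h (Finset.mem_univ _)).elim

theorem eqToHom_ι {a b : Fin N} (h : a = b) :
    eqToHom (congrArg G h) ≫ biproduct.ι G b = biproduct.ι G a := by
  subst h; simp

/-- Associative and unital families of multiplications give an algebra object `⨁ G`. -/
@[reducible] noncomputable def gradedMonObj
    (μ : ∀ (i j : Fin N) (h : (i : ℕ) + j < N), G i ⊗ G j ⟶ G ⟨i + j, h⟩)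
    (h0 : 0 < N) (u : 𝟙_ C ⟶ G ⟨0, h0⟩)
    (one_mul : ∀ (j : Fin N) (h : 0 + (j : ℕ) < N), u ▷ G j ≫ μ ⟨0, h0⟩ j h =
      (λ_ (G j)).hom ≫ eqToHom (congrArg G (Fin.ext (Nat.zero_add _).symm)))
    (mul_one : ∀ (i : Fin N) (h : (i : ℕ) + 0 < N), G i ◁ u ≫ μ i ⟨0, h0⟩ h =
      (ρ_ (G i)).hom ≫ eqToHom (congrArg G (Fin.ext (Nat.add_zero _).symm)))
    (assoc : ∀ (i j l : Fin N) (h : (i : ℕ) + j < N) (h' : (j : ℕ) + l < N)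
      (h1 : (i : ℕ) + j + l < N) (h2 : (i : ℕ) + (j + l) < N),
      μ i j h ▷ G l ≫ μ ⟨i + j, h⟩ l h1 =
        (α_ (G i) (G j) (G l)).hom ≫ G i ◁ μ j l h' ≫ μ i ⟨j + l, h'⟩ h2 ≫
          eqToHom (congrArg G (Fin.ext (Nat.add_assoc _ _ _).symm))) :
    MonObj (⨁ G) where
  one := u ≫ biproduct.ι G ⟨0, h0⟩
  mul := gradedMul G μ
  one_mul := by
    apply ext_right
    intro j
    have hj : (0 : ℕ) + j < N := by rw [Nat.zero_add]; exact j.2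
    have e : 𝟙_ C ◁ biproduct.ι G j ≫ (u ≫ biproduct.ι G ⟨0, h0⟩) ▷ (⨁ G) ≫ gradedMul G μ =
        u ▷ G j ≫ (biproduct.ι G ⟨0, h0⟩ ⊗ₘ biproduct.ι G j) ≫ gradedMul G μ := by
      simp only [MonoidalCategory.tensorHom_def', comp_whiskerRight, Category.assoc]
      rw [whisker_exchange_assoc]
    rw [e, ι_gradedMul, dif_pos hj, ← Category.assoc, one_mul, Category.assoc,
      eqToHom_ι (Fin.ext (Nat.zero_add _).symm), leftUnitor_naturality]
  mul_one := by
    apply ext_left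
    intro i
    have hi : (i : ℕ) + 0 < N := i.2
    have e : biproduct.ι G i ▷ 𝟙_ C ≫ (⨁ G) ◁ (u ≫ biproduct.ι G ⟨0, h0⟩) ≫ gradedMul G μ =
        G i ◁ u ≫ (biproduct.ι G i ⊗ₘ biproduct.ι G ⟨0, h0⟩) ≫ gradedMul G μ := by
      simp only [MonoidalCategory.tensorHom_def, MonoidalCategory.whiskerLeft_comp, Category.assoc]
      rw [whisker_exchange_assoc]
    rw [e, ι_gradedMul, dif_pos hi, ← Category.assoc, mul_one, Category.assoc,
      eqToHom_ι (b := ⟨i + ((⟨0, h0⟩ : Fin N) : ℕ), hi⟩) (Fin.ext (Nat.add_zero _).symm), rightUnitor_naturality]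
  mul_assoc := by
    have key : ∀ i j l : Fin N,
        ((biproduct.ι G i ⊗ₘ biproduct.ι G j) ⊗ₘ biproduct.ι G l) ≫
          gradedMul G μ ▷ (⨁ G) ≫ gradedMul G μ =
        ((biproduct.ι G i ⊗ₘ biproduct.ι G j) ⊗ₘ biproduct.ι G l) ≫
          (α_ (⨁ G) (⨁ G) (⨁ G)).hom ≫ (⨁ G) ◁ gradedMul G μ ≫ gradedMul G μ := by
      intro i j l
      have eL : ((biproduct.ι G i ⊗ₘ biproduct.ι G j) ⊗ₘ biproduct.ι G l) ≫
          gradedMul G μ ▷ (⨁ G) =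
          ((biproduct.ι G i ⊗ₘ biproduct.ι G j) ≫ gradedMul G μ) ⊗ₘ biproduct.ι G l := by
        rw [← tensorHom_id, tensorHom_comp_tensorHom, Category.comp_id]
      have eR : (biproduct.ι G i ⊗ₘ (biproduct.ι G j ⊗ₘ biproduct.ι G l)) ≫
          (⨁ G) ◁ gradedMul G μ =
          biproduct.ι G i ⊗ₘ ((biproduct.ι G j ⊗ₘ biproduct.ι G l) ≫ gradedMul G μ) := by
        rw [← id_tensorHom, tensorHom_comp_tensorHom, Category.comp_id]
      rw [← Category.assoc, eL, associator_naturality_assoc, ← Category.assoc (_ ⊗ₘ (_ ⊗ₘ _)), eR,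
        ι_gradedMul, ι_gradedMul]
      have sL : ∀ h : (i : ℕ) + j < N, (μ i j h ≫ biproduct.ι G ⟨i + j, h⟩) ⊗ₘ biproduct.ι G l =
          μ i j h ▷ G l ≫ (biproduct.ι G ⟨i + j, h⟩ ⊗ₘ biproduct.ι G l) := fun h => by
        rw [← tensorHom_id, tensorHom_comp_tensorHom, Category.id_comp]
      have sR : ∀ h : (j : ℕ) + l < N, biproduct.ι G i ⊗ₘ (μ j l h ≫ biproduct.ι G ⟨j + l, h⟩) =
          G i ◁ μ j l h ≫ (biproduct.ι G i ⊗ₘ biproduct.ι G ⟨j + l, h⟩) := fun h => by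
        rw [← id_tensorHom, tensorHom_comp_tensorHom, Category.id_comp]
      by_cases h : (i : ℕ) + j + l < N
      · have hij : (i : ℕ) + j < N := by omega
        have hjl : (j : ℕ) + l < N := by omega
        have h' : (i : ℕ) + (j + l) < N := by omega
        rw [dif_pos hij, dif_pos hjl, sL, sR, Category.assoc, Category.assoc, ι_gradedMul,
          ι_gradedMul, dif_pos (show ((⟨i + j, hij⟩ : Fin N) : ℕ) + l < N from h),
          dif_pos (show (i : ℕ) + ((⟨j + l, hjl⟩ : Fin N) : ℕ) < N from h'),
          ← Category.assoc (μ i j hij ▷ G l), assoc i j l hij hjl h h']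
        simp only [Category.assoc]
        rw [eqToHom_ι (Fin.ext (Nat.add_assoc _ _ _).symm)]
      · have zL : ((if h : (i : ℕ) + j < N then μ i j h ≫ biproduct.ι G ⟨i + j, h⟩ else 0) ⊗ₘ
            biproduct.ι G l) ≫ gradedMul G μ = 0 := by
          split_ifs with hij
          · rw [sL, Category.assoc, ι_gradedMul,
              dif_neg (show ¬ ((⟨i + j, hij⟩ : Fin N) : ℕ) + l < N from h), comp_zero]
          · rw [MonoidalPreadditive.zero_tensor, zero_comp]
        have zR : (biproduct.ι G i ⊗ₘ
            (if h : (j : ℕ) + l < N then μ j l h ≫ biproduct.ι G ⟨j + l, h⟩ else 0)) ≫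
            gradedMul G μ = 0 := by
          split_ifs with hjl
          · rw [sR, Category.assoc, ι_gradedMul,
              dif_neg (show ¬ (i : ℕ) + ((⟨j + l, hjl⟩ : Fin N) : ℕ) < N from
                fun h' => h (by rw [Nat.add_assoc]; exact h')), comp_zero]
          · rw [MonoidalPreadditive.tensor_zero, zero_comp]
        rw [zL, zR, comp_zero]
    apply ext_right
    intro l
    rw [← cancel_epi (α_ (⨁ G) (⨁ G) (G l)).inv]
    apply ext_left
    intro i
    rw [← cancel_epi (α_ (G i) (⨁ G) (G l)).hom]
    rw [← cancel_epi (𝟙 _ : (G i ⊗ (⨁ G)) ⊗ G l ⟶ _)]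
    have s : ∀ {Y : C} (f g : (G i ⊗ (⨁ G)) ⊗ G l ⟶ Y),
        (∀ j, (G i ◁ biproduct.ι G j) ▷ G l ≫ f = (G i ◁ biproduct.ι G j) ▷ G l ≫ g) → f = g := by
      intro Y f g hfg
      have e : 𝟙 ((G i ⊗ (⨁ G)) ⊗ G l) = ∑ j, (G i ◁ biproduct.π G j) ▷ G l ≫
          (G i ◁ biproduct.ι G j) ▷ G l := by
        rw [← id_whiskerRight, ← MonoidalCategory.whiskerLeft_id, ← biproduct.total,
          whiskerLeft_sum, sum_whiskerRight]
        simp only [MonoidalCategory.whiskerLeft_comp, comp_whiskerRight]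
      rw [← Category.id_comp f, ← Category.id_comp g, e, Preadditive.sum_comp,
        Preadditive.sum_comp]
      simp only [Category.assoc, hfg]
    apply s
    intro j
    have k := key i j l
    have e : ((biproduct.ι G i ⊗ₘ biproduct.ι G j) ⊗ₘ biproduct.ι G l) =
      (G i ◁ biproduct.ι G j) ▷ G l ≫ 𝟙 _ ≫ (α_ (G i) (⨁ G) (G l)).hom ≫
      biproduct.ι G i ▷ ((⨁ G) ⊗ G l) ≫ (α_ (⨁ G) (⨁ G) (G l)).inv ≫
      ((⨁ G) ⊗ (⨁ G)) ◁ biproduct.ι G l := by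
      rw [MonoidalCategory.tensorHom_def _ (biproduct.ι G l), MonoidalCategory.tensorHom_def',
        comp_whiskerRight, whiskerRight_tensor]
      simp only [Category.assoc, Category.id_comp, Iso.hom_inv_id_assoc]
    rw [e] at k
    simpa only [Category.assoc] using k

end Graded

/-! ### The reduced Temperley-Lieb category -/

theorem jw_absorb (k a b : ℕ) (h : a + b ≤ k + 1) :
    lcomp (delta k) (ltensor (jw k a) (jw k b)) (jw k (a + b)) = jw k (a + b) := by
  have e : ltensor (jw k a) (jw k b) =
      lcomp (delta k) (ltensor (jw k a) (lid b)) (ltensor (lid a) (jw k b)) := by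
    refine Eq.symm ((ltensor_lcomp (delta k) _ _ _ _).trans ?_)
    rw [lid_lcomp, lcomp_lid]
  rw [e, lcomp_assoc, jw_absorb_right a b h, jw_absorb_left a b h]

/-- The Temperley-Lieb category at level `k`: the additive and idempotent completion of the
linear category of planar diagrams. -/
abbrev TL (k : ℕ) := Idempotents.Karoubi (Mat_ (Strands k))

/-- The object `i`, as an object of the additive completion. -/
abbrev strandsObj (k i : ℕ) : Mat_ (Strands k) := ⟨Unit, fun _ => ⟨i⟩⟩

open MatMonoidal KaroubiMonoidal

theorem ent_comp_single {C : Type*} [Category C] [Preadditive C] {L M N : Mat_ C} (f : L ⟶ M)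
    (g : M ⟶ N) (i k) (j : M.ι) (h : ∀ j', j' = j) : ent (f ≫ g) i k = ent f i j ≫ ent g j k := by
  rw [ent_comp, Finset.sum_eq_single j]
  · intro j' _ hj; exact (hj (h j')).elim
  · intro h; exact (h (Finset.mem_univ _)).elim

/-- The object `Fᵢ = (i, fᵢ)`. -/
noncomputable def F (k i : ℕ) (h : i ≤ k + 1) : TL k where
  X := strandsObj k i
  p := ofEnt fun _ _ => jw k i
  idem := by
    apply ent_ext
    intro a b
    rw [ent_comp_single _ _ _ _ () (fun _ => rfl)]
    exact jw_idem h

/-- The map `π : Fᵢ ⊗ Fⱼ ⟶ Fᵢ₊ⱼ` given by `fᵢ₊ⱼ ∘ (fᵢ ⊗ fⱼ)`. -/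
noncomputable def piMap (k i j : ℕ) (h : i + j ≤ k + 1) :
    F k i (by omega) ⊗ F k j (by omega) ⟶ F k (i + j) h where
  f := ofEnt fun _ _ => lcomp (delta k) (ltensor (jw k i) (jw k j)) (jw k (i + j))
  comm := by
    apply ent_ext
    rintro ⟨⟨⟩, ⟨⟩⟩ ⟨⟩
    refine (ent_comp_single _ _ _ _ ((), ()) (fun _ => rfl)).trans ?_
    refine (congrArg (fun x => lcomp (delta k) (ltensor (jw k i) (jw k j)) x)
      (ent_comp_single _ _ _ _ () (fun _ => rfl))).trans ?_
    change lcomp (delta k) (ltensor (jw k i) (jw k j)) (lcomp (delta k)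
      (lcomp (delta k) (ltensor (jw k i) (jw k j)) (jw k (i + j))) (jw k (i + j))) =
      lcomp (delta k) (ltensor (jw k i) (jw k j)) (jw k (i + j))
    rw [jw_absorb k i j h, jw_idem h, jw_absorb k i j h]

/-- The identification of the unit object with `F₀`. -/
noncomputable def unitMap (k : ℕ) : 𝟙_ (TL k) ⟶ F k 0 (by omega) where
  f := ofEnt fun _ _ => jw k 0
  comm := by
    apply ent_ext
    rintro ⟨⟩ ⟨⟩
    refine (congrArg (fun x : strandsObj k 0 ⟶ strandsObj k 0 => ent x () ()) (Category.id_comp _)).trans ?_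
    refine (ent_comp_single _ _ _ _ () (fun _ => rfl)).trans ?_
    exact jw_idem (n := 0) (Nat.zero_le _)

theorem F_eq (k : ℕ) {a b : ℕ} (h : a = b) (ha : a ≤ k + 1) (hb : b ≤ k + 1) :
    F k a ha = F k b hb := by subst h; rfl

theorem ent_eqToHom_F (k : ℕ) {a b : ℕ} (h : a = b) (ha : a ≤ k + 1) (hb : b ≤ k + 1) :
    ent (eqToHom (F_eq k h ha hb)).f () () = lcast rfl h (jw k a) := by
  subst h; rfl

theorem eqToHom_comp_strands {k a b c : ℕ} (h : a = b) (g : LinHom b c) :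
    (eqToHom (congrArg Strands.mk h) : (⟨a⟩ : Strands k) ⟶ ⟨b⟩) ≫ (g : (⟨b⟩ : Strands k) ⟶ ⟨c⟩) =
      lcast h.symm rfl g := by
  subst h; exact Category.id_comp _

theorem lcomp_lcast {a b c d : ℕ} (δ : ℂ) (h : c = d) (f : LinHom a b) (g : LinHom b c) :
    lcomp δ f (lcast rfl h g) = lcast rfl h (lcomp δ f g) := by subst h; rfl

theorem lcast_jw (k : ℕ) {a b c : ℕ} (h : a = b) (h' : a = c) (hbc : b = c) :
    lcast h h' (jw k a) = lcast rfl hbc (jw k b) := by subst h h'; rfl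

theorem piMap_ent (k i j : ℕ) (h : i + j ≤ k + 1) (a b) :
    ent (piMap k i j h).f a b = jw k (i + j) := jw_absorb k i j h

theorem piMap_assoc (k i j l : ℕ) (h : i + j + l ≤ k + 1) :
    piMap k i j (by omega) ▷ F k l (by omega) ≫ piMap k (i + j) l h =
      (α_ (F k i (by omega)) (F k j (by omega)) (F k l (by omega))).hom ≫
        F k i (by omega) ◁ piMap k j l (by omega) ≫ piMap k i (j + l) (by omega) ≫
          eqToHom (F_eq k (Nat.add_assoc _ _ _).symm _ _) := by
  apply Idempotents.Karoubi.hom_ext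
  apply ent_ext
  rintro ⟨⟨⟨⟩, ⟨⟩⟩, ⟨⟩⟩ ⟨⟩
  have hL : ent (piMap k i j (by omega) ▷ F k l (by omega) ≫ piMap k (i + j) l h).f
      (((), ()), ()) () = jw k (i + j + l) := by
    refine (ent_comp_single _ _ _ _ ((), ()) (fun _ => rfl)).trans ?_
    refine (congrArg₂ (fun x y => lcomp (delta k) (ltensor x (jw k l)) y)
      (piMap_ent k i j _ ((), ()) ()) (piMap_ent k (i + j) l h ((), ()) ())).trans ?_
    exact jw_absorb k (i + j) l h
  have h' : i + (j + l) ≤ k + 1 := by omega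
  have hR : ent ((F k i (by omega)) ◁ piMap k j l (by omega) ≫ piMap k i (j + l) h' ≫
      eqToHom (F_eq k (Nat.add_assoc _ _ _).symm _ h)).f ((), ((), ())) () =
      lcast rfl (Nat.add_assoc _ _ _).symm (jw k (i + (j + l))) := by
    refine (ent_comp_single _ _ _ _ ((), ()) (fun _ => rfl)).trans ?_
    have e1 : ent (piMap k i (j + l) h' ≫
        eqToHom (F_eq k (Nat.add_assoc _ _ _).symm _ h)).f ((), ()) () =
        lcast rfl (Nat.add_assoc _ _ _).symm (jw k (i + (j + l))) := by
      refine (ent_comp_single _ _ _ _ () (fun _ => rfl)).trans ?_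
      refine (congrArg₂ (fun x y => lcomp (delta k) x y) (piMap_ent k i (j + l) h' ((), ()) ())
        (ent_eqToHom_F k (Nat.add_assoc i j l).symm _ _)).trans ?_
      refine (lcomp_lcast _ _ _ _).trans ?_
      exact congrArg _ (jw_idem h')
    refine (congrArg₂ (fun x y => lcomp (delta k) (ltensor (jw k i) x) y)
      (piMap_ent k j l _ ((), ()) ()) e1).trans ?_
    refine (lcomp_lcast _ _ _ _).trans ?_
    exact congrArg _ (jw_absorb k i (j + l) h')
  refine hL.trans (Eq.symm ?_)
  have hA : ∀ {Y : TL k} (g : kobj (F k i (by omega)) (kobj (F k j (by omega))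
      (F k l (by omega))) ⟶ Y), ((α_ (F k i (by omega)) (F k j (by omega)) (F k l (by omega))).hom ≫ g).f =
      (α_ (strandsObj k i) (strandsObj k j) (strandsObj k l)).hom ≫ g.f := by
    intro Y g
    refine (congrArg (· ≫ g.f) (kassoc_f' _ _ _)).trans ?_
    rw [Category.assoc]
    exact congrArg _ (Idempotents.Karoubi.p_comp g)
  rw [hA]
  refine (ent_comp_single _ _ _ _ ((), ((), ())) (fun _ => rfl)).trans ?_
  refine (congrArg₂ (fun x y => lcomp (delta k) x y)
    ((isMono_assoc (strandsObj k i) (strandsObj k j) (strandsObj k l)).self (((), ()), ())) hR).trans ?_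
  refine (eqToHom_comp_strands (k := k) (Nat.add_assoc i j l) _).trans ?_
  have : ∀ {a b : ℕ} (h : a = b), lcast h rfl (lcast rfl h (jw k a)) = jw k b := by
    intro a b h; subst h; rfl
  exact this (Nat.add_assoc i j l).symm

theorem unit_piMap (k j : ℕ) (h : 0 + j ≤ k + 1) :
    unitMap k ▷ F k j (by omega) ≫ piMap k 0 j h =
      (λ_ (F k j (by omega))).hom ≫ eqToHom (F_eq k (Nat.zero_add _).symm _ _) := by
  apply Idempotents.Karoubi.hom_ext
  apply ent_ext
  rintro ⟨⟨⟩, ⟨⟩⟩ ⟨⟩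
  have hL : ent (unitMap k ▷ F k j (by omega) ≫ piMap k 0 j h).f ((), ()) () = jw k (0 + j) := by
    refine (ent_comp_single _ _ _ _ ((), ()) (fun _ => rfl)).trans ?_
    refine (congrArg (fun y => lcomp (delta k) (ltensor (jw k 0) (jw k j)) y)
      (piMap_ent k 0 j h ((), ()) ())).trans ?_
    exact jw_absorb k 0 j h
  refine hL.trans (Eq.symm ?_)
  have h' : j ≤ k + 1 := by omega
  have hA : ((λ_ (F k j h')).hom ≫ eqToHom (F_eq k (Nat.zero_add _).symm _ h)).f =
      (λ_ (strandsObj k j)).hom ≫ (eqToHom (F_eq k (Nat.zero_add _).symm h' h)).f := by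
    refine (congrArg (· ≫ Idempotents.Karoubi.Hom.f _) (klunit_f _)).trans ?_
    rw [Category.assoc]
    exact congrArg _ (Idempotents.Karoubi.p_comp _)
  rw [hA]
  refine (ent_comp_single _ _ _ _ () (fun _ => rfl)).trans ?_
  refine (congrArg₂ (fun x y => lcomp (delta k) x y)
    ((isMono_lunit (strandsObj k j)).self ((), ())) (ent_eqToHom_F k (Nat.zero_add j).symm _ _)).trans ?_
  refine (eqToHom_comp_strands (k := k) (Nat.zero_add j) _).trans ?_
  have : ∀ {a b : ℕ} (h : a = b), lcast h rfl (lcast rfl h (jw k a)) = jw k b := by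
    intro a b h; subst h; rfl
  exact this (Nat.zero_add j).symm

theorem piMap_unit (k i : ℕ) (h : i + 0 ≤ k + 1) :
    F k i (by omega) ◁ unitMap k ≫ piMap k i 0 h =
      (ρ_ (F k i (by omega))).hom ≫ eqToHom (F_eq k (Nat.add_zero _).symm _ _) := by
  apply Idempotents.Karoubi.hom_ext
  apply ent_ext
  rintro ⟨⟨⟩, ⟨⟩⟩ ⟨⟩
  have hL : ent (F k i (by omega) ◁ unitMap k ≫ piMap k i 0 h).f ((), ()) () = jw k (i + 0) := by
    refine (ent_comp_single _ _ _ _ ((), ()) (fun _ => rfl)).trans ?_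
    refine (congrArg (fun y => lcomp (delta k) (ltensor (jw k i) (jw k 0)) y)
      (piMap_ent k i 0 h ((), ()) ())).trans ?_
    exact jw_absorb k i 0 h
  refine hL.trans (Eq.symm ?_)
  have h' : i ≤ k + 1 := by omega
  have hA : ((ρ_ (F k i h')).hom ≫ eqToHom (F_eq k (Nat.add_zero _).symm _ h)).f =
      (ρ_ (strandsObj k i)).hom ≫ (eqToHom (F_eq k (Nat.add_zero _).symm h' h)).f := by
    refine (congrArg (· ≫ Idempotents.Karoubi.Hom.f _) (krunit_f _)).trans ?_
    rw [Category.assoc]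
    exact congrArg _ (Idempotents.Karoubi.p_comp _)
  rw [hA]
  refine (ent_comp_single _ _ _ _ () (fun _ => rfl)).trans ?_
  refine (congrArg₂ (fun x y => lcomp (delta k) x y)
    ((isMono_runit (strandsObj k i)).self ((), ())) (ent_eqToHom_F k (Nat.add_zero i).symm _ _)).trans ?_
  refine (eqToHom_comp_strands (k := k) (Nat.add_zero i) _).trans ?_
  rfl

/-- The identity morphism of the object `Fₖ₊₁`. -/
inductive IsIdTop (k : ℕ) : ∀ ⦃X Y : TL k⦄, (X ⟶ Y) → Prop
  | id : IsIdTop k (𝟙 (F k (k + 1) le_rfl))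

/-- The reduced Temperley-Lieb category at level `k`: the quotient of the Temperley-Lieb category
by the ideal of morphisms generated by `Fₖ₊₁`. -/
noncomputable abbrev TLred (k : ℕ) := TensorQuotient.Quo (IsIdTop k)

/-- The quotient functor. -/
noncomputable abbrev reduce (k : ℕ) : TL k ⥤ TLred k := TensorQuotient.proj (IsIdTop k)

/-- The objects `Fᵢ` of the reduced Temperley-Lieb category, for `0 ≤ i ≤ k`. -/
noncomputable abbrev Fred (k : ℕ) (i : Fin (k + 1)) : TLred k := (reduce k).obj (F k i (by omega))

/-- The object `Σ = F₀ ⊕ ⋯ ⊕ Fₖ` of the reduced Temperley-Lieb category. -/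
noncomputable abbrev Sig (k : ℕ) : TLred k := ⨁ Fred k

/-- The algebra structure on `Σ`: the unit is the inclusion of `F₀`, and the multiplication is the
sum of the maps `π : Fᵢ ⊗ Fⱼ ⟶ Fᵢ₊ⱼ` over all `i` and `j` with `i + j ≤ k`. -/
noncomputable instance (k : ℕ) : MonObj (Sig k) :=
  gradedMonObj (G := Fred k) (fun i j h => (reduce k).map (piMap k i j (by omega)))
    (Nat.succ_pos k) ((reduce k).map (unitMap k))
    (fun j h => by
      have e := congrArg (reduce k).map (unit_piMap k j (by omega))
      rw [CategoryTheory.Functor.map_comp, CategoryTheory.Functor.map_comp, eqToHom_map] at e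
      exact e)
    (fun i h => by
      have e := congrArg (reduce k).map (piMap_unit k i (by omega))
      rw [CategoryTheory.Functor.map_comp, CategoryTheory.Functor.map_comp, eqToHom_map] at e
      exact e)
    (fun i j l h h' h1 h2 => by
      have e := congrArg (reduce k).map (piMap_assoc k i j l (by omega))
      simp only [CategoryTheory.Functor.map_comp, eqToHom_map] at e
      exact e)

/-! ### Frobenius structures -/

section Frobenius
universe v u
variable {C : Type u} [Category.{v} C] [MonoidalCategory C]

/-- The map `φ : A ⟶ A ⊗ A ⊗ Aᵛ ⟶ W ⊗ Aᵛ` attached to `n : A ⟶ W`, where `Aᵛ` is a left dual of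
the algebra `A`: the coevaluation `𝟙 ⟶ A ⊗ Aᵛ` followed by `n ∘ m`. -/
def frobeniusMap (A : C) [MonObj A] (Ad : C) [ExactPairing A Ad] {W : C} (n : A ⟶ W) :
    A ⟶ W ⊗ Ad :=
  (ρ_ A).inv ≫ A ◁ η_ A Ad ≫ (α_ A A Ad).inv ≫ (MonObj.mul ≫ n) ▷ Ad

/-- `(W, n)` is a Frobenius structure on the algebra `A`: there is a left dual `Aᵛ` of `A`, with
evaluation `Aᵛ ⊗ A ⟶ 𝟙` and coevaluation `𝟙 ⟶ A ⊗ Aᵛ`, for which the map `A ⟶ W ⊗ Aᵛ` is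
invertible. -/
def IsFrobeniusStructure (A : C) [MonObj A] (W : C) (n : A ⟶ W) : Prop :=
  ∃ (Ad : C) (_ : ExactPairing A Ad), IsIso (frobeniusMap A Ad n)

/-- A classical Frobenius structure is a Frobenius structure `(W, n)` in which `W` is the unit
object. -/
def AdmitsClassicalFrobeniusStructure (A : C) [MonObj A] : Prop :=
  ∃ n : A ⟶ 𝟙_ C, IsFrobeniusStructure A (𝟙_ C) n

end Frobenius
end TemperleyLieb

open CategoryTheory MonoidalCategory Limits TemperleyLieb

/-!
The Jones–Wenzl projection `fᵢ` kills every cap-cup. A planar diagram with fewer top dots than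
bottom dots joins two adjacent bottom dots, so up to the factor `δ⁻¹` it factors through a cap-cup;
hence `fᵢ` kills it too, and `Fᵢ` has no nonzero morphism to `𝟙` for `i > 0`. As multiplication by
`F₁` lands in positive degrees, `n ∘ m` and therefore the Frobenius map of any `n : Σ ⟶ 𝟙` vanish
on `F₁`.

It remains to see that `F₁` survives in the quotient. The morphisms that are negligible for the
Markov trace form a tensor ideal. It contains `f_{k+1}`, which kills all diagrams but the identity
and has trace `±[k+2] = 0`, but not `1₁`, whose trace is `δ ≠ 0`.

The loop counts behind the trace identities are read off at loop value `2`, where diagrams act as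
0/1-matrices on `Fin n → Bool` and the number of loops is an exponent of `2`.
-/

namespace TemperleyLieb

/-! ### Partial traces of matrices -/

section PartialTrace

open scoped Kronecker

variable {α β γ R : Type*} [Fintype γ]

/-- The partial trace over the second tensor factor of a matrix indexed by products. -/
def partialTrace [AddCommMonoid R] (A : Matrix (α × γ) (β × γ) R) : Matrix α β R :=
  Matrix.of fun x y => ∑ t, A (x, t) (y, t)

theorem partialTrace_apply [AddCommMonoid R] (A : Matrix (α × γ) (β × γ) R) (x : α) (y : β) :
    partialTrace A x y = ∑ t, A (x, t) (y, t) := rfl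

theorem trace_kronecker_one_mul [Fintype α] [Fintype β] [DecidableEq γ] [Semiring R]
    (M : Matrix α β R) (A : Matrix (β × γ) (α × γ) R) :
    ((M ⊗ₖ (1 : Matrix γ γ R)) * A).trace = (M * partialTrace A).trace := by
  simp only [Matrix.trace, Matrix.diag, Matrix.mul_apply, Fintype.sum_prod_type,
    Matrix.kroneckerMap_apply, Matrix.one_apply, partialTrace_apply, mul_ite, mul_one, mul_zero,
    ite_mul, zero_mul, Finset.sum_ite_eq, Finset.mem_univ, if_true, Finset.mul_sum]
  exact Finset.sum_congr rfl fun x _ => Finset.sum_comm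

theorem trace_submatrix_equiv {α' : Type*} [Fintype α] [Fintype α'] [AddCommMonoid R]
    (A : Matrix α α R) (e : α' ≃ α) : (A.submatrix e e).trace = A.trace :=
  e.sum_comp fun x => A x x

end PartialTrace

/-! ### Concatenated tuples -/

section Append

variable {α : Type*}

theorem sum_append {M : Type*} [Fintype α] [AddCommMonoid M] {a b : ℕ}
    (F : (Fin (a + b) → α) → M) :
    ∑ x, F x = ∑ y : Fin a → α, ∑ z : Fin b → α, F (Fin.append y z) := by
  classical
  rw [← (Fin.appendEquiv a b).sum_comp, Fintype.sum_prod_type]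
  rfl

theorem append_inj {a b : ℕ} {x x' : Fin a → α} {y y' : Fin b → α} :
    Fin.append x y = Fin.append x' y' ↔ x = x' ∧ y = y' :=
  ((Fin.appendEquiv a b).injective.eq_iff (a := (x, y)) (b := (x', y'))).trans Prod.mk_inj

theorem append_one_one (s u : Fin 1 → α) :
    (Fin.append s u : Fin 2 → α) 0 = s 0 ∧ (Fin.append s u : Fin 2 → α) 1 = u 0 :=
  ⟨Fin.append_left s u 0, Fin.append_right s u 0⟩

theorem append_append_one_one {n : ℕ} (w : Fin n → α) (s u : Fin 1 → α) :
    (Fin.append (Fin.append w s) u : Fin (n + 1 + 1) → α) =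
      (Fin.append w (Fin.append s u : Fin 2 → α) : Fin (n + 2) → α) :=
  Fin.append_assoc w s u

end Append

namespace Diagram

variable {m n p r : ℕ}

/-! ### Closures of diagrams -/

theorem compat_sup {X : Type} {s t : Setoid X} {l : X → Bool} :
    Compat (s ⊔ t) l ↔ Compat s l ∧ Compat t l :=
  sup_le_iff (c := Setoid.ker l)

/-- The number of loops of the closure of a diagram, in which each bottom dot is joined with the
top dot above it. -/
noncomputable def closureLoops (f : Diagram n n) : ℕ := Nat.card (Quotient (f.rel ⊔ (id n).rel))

theorem compat_sup_id {f : Diagram n n} {L : Fin n ⊕ Fin n → Bool} :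
    Compat (f.rel ⊔ (id n).rel) L ↔
      ∃ a, Compat f.rel (Sum.elim a a) ∧ L = Sum.elim a a := by
  rw [compat_sup]
  constructor
  · rintro ⟨hf, hid⟩
    rw [← Sum.elim_comp_inl_inr L] at hf hid ⊢
    rw [compat_id] at hid
    rw [← hid] at hf ⊢
    exact ⟨_, hf, rfl⟩
  · rintro ⟨a, ha, rfl⟩
    exact ⟨ha, compat_id.2 rfl⟩

theorem card_compat_univ {T : Type} [Finite T] (S : Setoid T) :
    Nat.card {L : T → Bool // Compat S L} = 2 ^ Nat.card (Quotient S) := by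
  have e : {L : T → Bool // Compat S L} ≃ (Quotient S → Bool) := Setoid.liftEquiv S
  rw [Nat.card_congr e, Nat.card_fun, Nat.card_eq_fintype_card (α := Bool), Fintype.card_bool]

theorem trace_relMat (f : Diagram n n) : (relMat f.rel).trace = 2 ^ closureLoops f := by
  classical
  rw [closureLoops, ← card_compat_univ, Matrix.trace]
  simp only [Matrix.diag, relMat, Finset.sum_boole, Nat.cast_id]
  rw [← Fintype.card_subtype, ← Nat.card_eq_fintype_card]
  refine Nat.card_congr (Equiv.ofBijective
    (fun a => ⟨Sum.elim a.1 a.1, compat_sup_id.2 ⟨a.1, a.2, rfl⟩⟩) ⟨fun a b h => ?_, ?_⟩)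
  · exact Subtype.ext (congrArg (· ∘ Sum.inl) (congrArg Subtype.val h))
  · rintro ⟨L, hL⟩
    obtain ⟨a, ha, rfl⟩ := compat_sup_id.1 hL
    exact ⟨⟨a, ha⟩, rfl⟩

theorem trace_relMat_mul (f : Diagram m n) (g : Diagram n m) :
    (relMat f.rel * relMat g.rel).trace = 2 ^ (loops f g + closureLoops (comp f g)) := by
  rw [relMat_comp, Matrix.trace_smul, trace_relMat, smul_eq_mul, pow_add]

theorem loops_add_closureLoops_comm (f : Diagram m n) (g : Diagram n m) :
    loops f g + closureLoops (comp f g) = loops g f + closureLoops (comp g f) := by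
  refine Nat.pow_right_injective le_rfl ?_
  change 2 ^ _ = 2 ^ _
  rw [← trace_relMat_mul, ← trace_relMat_mul, Matrix.trace_mul_comm]

theorem closureLoops_id_one : closureLoops (id 1) = 1 := by
  refine Nat.pow_right_injective le_rfl ?_
  change 2 ^ _ = 2 ^ 1
  rw [← trace_relMat, relMat_id, Matrix.trace_one]
  simp

/-! ### Closing one strand -/

theorem relMat_cast {m' n' : ℕ} (hm : m = m') (hn : n = n') (f : Diagram m n) (a b) :
    relMat (cast hm hn f).rel a b = relMat f.rel (a ∘ Fin.cast hm) (b ∘ Fin.cast hn) := by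
  subst hm hn; rfl

theorem relMat_tensor_append {m₁ m₂ n₁ n₂ : ℕ} (f : Diagram m₁ n₁) (g : Diagram m₂ n₂)
    (a a' b b') : relMat (tensor f g).rel (Fin.append a a') (Fin.append b b') =
      relMat f.rel a b * relMat g.rel a' b' := by
  simp only [relMat_tensor, Fin.append_left, Fin.append_right]

theorem relMat_comp_comp (f : Diagram m n) (g : Diagram n p) (h : Diagram p r) :
    relMat f.rel * relMat g.rel * relMat h.rel =
      2 ^ (loops f g + loops (comp f g) h) • relMat (comp (comp f g) h).rel := by
  rw [relMat_comp, Matrix.smul_mul, relMat_comp, smul_smul, pow_add]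

theorem relMat_cup_append (a : Fin 0 → Bool) (s u : Fin 1 → Bool) :
    relMat cup.rel a (Fin.append s u : Fin 2 → Bool) = if s = u then 1 else 0 := by
  simp only [relMat_cup, append_one_one, funext_iff, Fin.forall_fin_one]

theorem relMat_cap_append (a : Fin 0 → Bool) (s u : Fin 1 → Bool) :
    relMat cap.rel (Fin.append s u : Fin 2 → Bool) a = if s = u then 1 else 0 := by
  simp only [relMat_cap, append_one_one, funext_iff, Fin.forall_fin_one]

theorem relMat_capCup (s s' : Fin 2 → Bool) :
    relMat (comp cap cup).rel s s' = if s 0 = s 1 ∧ s' 0 = s' 1 then 1 else 0 := by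
  have h := congrFun₂ (relMat_comp cap cup) s s'
  rw [loops_cap_cup, pow_zero, one_smul] at h
  rw [← h, Matrix.mul_apply, Fintype.sum_unique, relMat_cap, relMat_cup, ite_zero_mul_ite_zero,
    one_mul]

theorem relMat_capCup_append (s u s' u' : Fin 1 → Bool) :
    relMat (comp cap cup).rel (Fin.append s u : Fin 2 → Bool) (Fin.append s' u' : Fin 2 → Bool) =
      if s = u ∧ s' = u' then 1 else 0 := by
  simp only [relMat_capCup, append_one_one, funext_iff, Fin.forall_fin_one]

theorem relMat_id_cup (x w : Fin n → Bool) (s u : Fin 1 → Bool) :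
    relMat (tensor (id n) cup).rel x (Fin.append (Fin.append w s) u : Fin (n + 1 + 1) → Bool) =
      if x = w ∧ s = u then 1 else 0 := by
  have h := relMat_tensor_append (id n) cup x Fin.elim0 w (Fin.append s u : Fin 2 → Bool)
  rwa [relMat_id, Matrix.one_apply, relMat_cup_append, ite_zero_mul_ite_zero, one_mul,
    Fin.append_elim0, ← append_append_one_one] at h

theorem relMat_id_cap (x w : Fin n → Bool) (s u : Fin 1 → Bool) :
    relMat (tensor (id n) cap).rel (Fin.append (Fin.append w s) u : Fin (n + 1 + 1) → Bool) x =
      if w = x ∧ s = u then 1 else 0 := by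
  have h := relMat_tensor_append (id n) cap w (Fin.append s u : Fin 2 → Bool) x Fin.elim0
  rwa [relMat_id, Matrix.one_apply, relMat_cap_append, ite_zero_mul_ite_zero, one_mul,
    Fin.append_elim0, ← append_append_one_one] at h

theorem relMat_id_capCup (x y : Fin n → Bool) (s t s' t' : Fin 1 → Bool) :
    relMat (tensor (id n) (comp cap cup)).rel
      (Fin.append (Fin.append x s) t : Fin (n + 1 + 1) → Bool)
      (Fin.append (Fin.append y s') t' : Fin (n + 1 + 1) → Bool) =
        if x = y ∧ s = t ∧ s' = t' then 1 else 0 := by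
  have h := relMat_tensor_append (id n) (comp cap cup) x (Fin.append s t : Fin 2 → Bool)
    y (Fin.append s' t' : Fin 2 → Bool)
  rwa [relMat_id, Matrix.one_apply, relMat_capCup_append, ite_zero_mul_ite_zero, one_mul,
    ← append_append_one_one, ← append_append_one_one] at h

theorem relMat_cup_id (x w : Fin n → Bool) (s u : Fin 1 → Bool) :
    relMat (cast (Nat.zero_add n) (Nat.add_assoc 1 1 n) (tensor cup (id n))).rel x
      (Fin.append s (Fin.append u w)) = if s = u ∧ x = w then 1 else 0 := by
  have h := relMat_tensor_append cup (id n) Fin.elim0 x (Fin.append s u : Fin 2 → Bool) w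
  rw [relMat_id, Matrix.one_apply, relMat_cup_append, ite_zero_mul_ite_zero, one_mul,
    Fin.elim0_append] at h
  rw [relMat_cast, ← h]
  exact congrArg _ (Fin.append_assoc s u w).symm

theorem relMat_cap_id (x w : Fin n → Bool) (s u : Fin 1 → Bool) :
    relMat (cast (Nat.add_assoc 1 1 n) (Nat.zero_add n) (tensor cap (id n))).rel
      (Fin.append s (Fin.append u w)) x = if s = u ∧ w = x then 1 else 0 := by
  have h := relMat_tensor_append cap (id n) (Fin.append s u : Fin 2 → Bool) w Fin.elim0 x
  rw [relMat_id, Matrix.one_apply, relMat_cap_append, ite_zero_mul_ite_zero, one_mul,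
    Fin.elim0_append] at h
  rw [relMat_cast, ← h]
  exact congrArg (relMat _ · _) (Fin.append_assoc s u w).symm

/-- The partial closure on the right: the last bottom dot is joined with the last top dot. -/
def closeLast (A : Matrix (Fin (m + 1) → Bool) (Fin (n + 1) → Bool) ℕ) :
    Matrix (Fin m → Bool) (Fin n → Bool) ℕ :=
  partialTrace (A.submatrix (Fin.appendEquiv m 1) (Fin.appendEquiv n 1))

theorem closeLast_apply (A : Matrix (Fin (m + 1) → Bool) (Fin (n + 1) → Bool) ℕ) (x y) :
    closeLast A x y = ∑ t : Fin 1 → Bool, A (Fin.append x t) (Fin.append y t) := rfl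

/-- The partial closure on the left: the first bottom dot is joined with the first top dot. -/
def closeFirst (A : Matrix (Fin (1 + m) → Bool) (Fin (1 + n) → Bool) ℕ) :
    Matrix (Fin m → Bool) (Fin n → Bool) ℕ :=
  partialTrace (A.submatrix ((Equiv.prodComm _ _).trans (Fin.appendEquiv 1 m))
    ((Equiv.prodComm _ _).trans (Fin.appendEquiv 1 n)))

theorem closeFirst_apply (A : Matrix (Fin (1 + m) → Bool) (Fin (1 + n) → Bool) ℕ) (x y) :
    closeFirst A x y = ∑ t : Fin 1 → Bool, A (Fin.append t x) (Fin.append t y) := rfl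

theorem trace_tensor_id_mul (f : Diagram m n)
    (A : Matrix (Fin (n + 1) → Bool) (Fin (m + 1) → Bool) ℕ) :
    (relMat (tensor f (id 1)).rel * A).trace = (relMat f.rel * closeLast A).trace := by
  rw [closeLast, ← trace_kronecker_one_mul, ← trace_submatrix_equiv _ (Fin.appendEquiv m 1),
    ← Matrix.submatrix_mul_equiv _ _ _ (Fin.appendEquiv n 1)]
  congr 2
  ext ⟨x, s⟩ ⟨y, t⟩
  exact (relMat_tensor_append f (id 1) x s y t).trans (by rw [relMat_id]; rfl)

theorem trace_id_tensor_mul (f : Diagram m n)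
    (A : Matrix (Fin (1 + n) → Bool) (Fin (1 + m) → Bool) ℕ) :
    (relMat (tensor (id 1) f).rel * A).trace = (relMat f.rel * closeFirst A).trace := by
  rw [closeFirst, ← trace_kronecker_one_mul,
    ← trace_submatrix_equiv _ ((Equiv.prodComm _ _).trans (Fin.appendEquiv 1 m)),
    ← Matrix.submatrix_mul_equiv _ _ _ ((Equiv.prodComm _ _).trans (Fin.appendEquiv 1 n))]
  congr 2
  ext ⟨x, s⟩ ⟨y, t⟩
  exact (relMat_tensor_append (id 1) f s x t y).trans (by rw [relMat_id, mul_comm]; rfl)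

theorem exists_closeLast_relMat (g : Diagram (m + 1) (n + 1)) :
    ∃ (e : ℕ) (d : Diagram m n), closeLast (relMat g.rel) = 2 ^ e • relMat d.rel := by
  refine ⟨_, _, Eq.trans ?_ (relMat_comp_comp (m := m) (n := m + 1 + 1) (p := n + 1 + 1) (r := n)
    (tensor (id m) cup) (tensor g (id 1)) (tensor (id n) cap))⟩
  ext x y
  simp only [closeLast_apply, Matrix.mul_apply, sum_append (a := m + 1) (b := 1),
    sum_append (a := n + 1) (b := 1), sum_append (b := 1) (a := m), sum_append (b := 1) (a := n),
    relMat_id_cup, relMat_id_cap, relMat_tensor_append, relMat_id, Matrix.one_apply]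
  simp [ite_and]

theorem exists_closeFirst_relMat (g : Diagram (1 + m) (1 + n)) :
    ∃ (e : ℕ) (d : Diagram m n), closeFirst (relMat g.rel) = 2 ^ e • relMat d.rel := by
  refine ⟨_, _, Eq.trans ?_ (relMat_comp_comp
    (cast (Nat.zero_add m) (Nat.add_assoc 1 1 m) (tensor cup (id m))) (tensor (id 1) g)
    (cast (Nat.add_assoc 1 1 n) (Nat.zero_add n) (tensor cap (id n))))⟩
  ext x y
  simp only [closeFirst_apply, Matrix.mul_apply, sum_append (a := 1) (b := 1 + m),
    sum_append (a := 1) (b := 1 + n), sum_append (a := 1) (b := m), sum_append (a := 1) (b := n),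
    relMat_cup_id, relMat_cap_id, relMat_tensor_append, relMat_id, Matrix.one_apply]
  simp [ite_and]

theorem closeLast_relMat_id :
    closeLast (relMat (id (n + 1)).rel) = 2 ^ 1 • relMat (id n).rel := by
  ext x y
  simp [closeLast_apply, relMat_id, Matrix.one_apply, append_inj]

theorem closeLast_relMat_id_capCup :
    closeLast (m := n + 1) (n := n + 1) (relMat (tensor (id n) (comp cap cup)).rel) =
      relMat (id (n + 1)).rel := by
  ext x y
  obtain ⟨⟨x, s⟩, rfl⟩ := (Fin.appendEquiv n 1).surjective x
  obtain ⟨⟨y, u⟩, rfl⟩ := (Fin.appendEquiv n 1).surjective y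
  calc _ = ∑ t, if x = y ∧ s = t ∧ u = t then 1 else 0 :=
        Finset.sum_congr rfl fun t _ => relMat_id_capCup x y s t u t
    _ = if x = y ∧ s = u then 1 else 0 := by simp [ite_and, eq_comm]
    _ = _ := by rw [relMat_id, Matrix.one_apply]; exact if_congr append_inj.symm rfl rfl

/-! ### Adjacent dots on the same line -/

/-- Two adjacent bottom dots of the diagram lie on the same line. -/
def HasCap (d : Diagram m n) : Prop :=
  ∃ i j : Fin m, (i : ℕ) + 1 = j ∧ d.rel (Sum.inl i) (Sum.inl j)

theorem pos_partner_mem_Ioo (d : Diagram m n) {x y z : Fin m ⊕ Fin n} (h : d.rel x y)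
    (hz : pos z ∈ Set.Ioo (pos x) (pos y)) : pos (d.partner z) ∈ Set.Ioo (pos x) (pos y) := by
  obtain ⟨hxz, hzy⟩ := hz
  have hne : x ≠ y := by rintro rfl; exact hxz.not_gt hzy
  refine ⟨lt_of_le_of_ne (not_lt.1 fun hlt => ?_) fun he => ?_,
    lt_of_le_of_ne (not_lt.1 fun hlt => ?_) fun he => ?_⟩
  · exact d.planar _ _ _ _ hlt hxz hzy (d.rel.symm (d.rel_partner z)) h
  · have hzy' : z = y := by
      rw [eq_partner h hne.symm, pos_injective he, partner_partner]
    exact hzy.ne (congrArg pos hzy')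
  · exact d.planar _ _ _ _ hxz hzy hlt h (d.rel_partner z)
  · have hzx : z = x := by
      rw [eq_partner (d.rel.symm h) hne, ← pos_injective he, partner_partner]
    exact hxz.ne (congrArg pos hzx.symm)

/-- An innermost line joins adjacent dots. -/
theorem hasCap_of_rel_of_lt (d : Diagram m n) {i j : Fin m} (hij : i < j)
    (h : d.rel (Sum.inl i) (Sum.inl j)) : d.HasCap := by
  induction hl : (j : ℕ) - i using Nat.strong_induction_on generalizing i j with
  | _ l ih =>
    rcases eq_or_lt_of_le (Nat.succ_le_of_lt (Fin.lt_def.1 hij)) with hadj | hlt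
    · exact ⟨i, j, hadj, h⟩
    let a : Fin m := ⟨i + 1, by omega⟩
    have ha : pos (Sum.inl a : Fin m ⊕ Fin n) ∈
        Set.Ioo (pos (Sum.inl i : Fin m ⊕ Fin n)) (pos (Sum.inl j : Fin m ⊕ Fin n)) :=
      ⟨Nat.lt_succ_self i, hlt⟩
    obtain ⟨hib, hbj⟩ := d.pos_partner_mem_Ioo h ha
    have hab := d.rel_partner (Sum.inl a)
    have hne := d.partner_ne (Sum.inl a)
    generalize d.partner (Sum.inl a) = b at hib hbj hab hne
    rcases b with b | b
    · have hne' : (b : ℕ) ≠ i + 1 := fun e => hne (congrArg Sum.inl (Fin.ext e))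
      simp only [pos] at hib hbj
      exact ih (b - a) (by simp only [a]; omega) (Fin.lt_def.2 (by simp only [a]; omega)) hab rfl
    · simp only [pos] at hbj
      omega

theorem hasCap_of_rel_of_ne (d : Diagram m n) {i j : Fin m} (hij : i ≠ j)
    (h : d.rel (Sum.inl i) (Sum.inl j)) : d.HasCap :=
  hij.lt_or_gt.elim (d.hasCap_of_rel_of_lt · h) (d.hasCap_of_rel_of_lt · (d.rel.symm h))

theorem hasCap_or_exists_strictMono (d : Diagram m n) :
    d.HasCap ∨ ∃ t : Fin m → Fin n, StrictMono t ∧ ∀ i, d.rel (Sum.inl i) (Sum.inr (t i)) := by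
  refine or_iff_not_imp_left.2 fun hcap => ?_
  have hbot : ∀ i j : Fin m, d.rel (Sum.inl i) (Sum.inl j) → i = j := fun i j h =>
    by_contra fun hij => hcap (d.hasCap_of_rel_of_ne hij h)
  have htop : ∀ i : Fin m, ∃ a : Fin n, d.rel (Sum.inl i) (Sum.inr a) := by
    intro i
    have hrel := d.rel_partner (Sum.inl i)
    have hne := d.partner_ne (Sum.inl i)
    generalize d.partner (Sum.inl i) = y at hrel hne
    rcases y with j | a
    · exact (hne (congrArg _ (hbot _ _ hrel).symm)).elim
    · exact ⟨a, hrel⟩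
  choose t ht using htop
  refine ⟨t, fun i j hij => ?_, ht⟩
  rcases lt_trichotomy (t i) (t j) with h | h | h
  · exact h
  · exact (hij.ne (hbot i j (d.rel.trans (ht i) (h ▸ d.rel.symm (ht j))))).elim
  · refine (d.planar (Sum.inl i) (Sum.inl j) (Sum.inr (t i)) (Sum.inr (t j)) ?_ ?_ ?_
      (ht i) (ht j)).elim <;> simp only [pos] <;> omega

theorem eq_id_of_forall_rel {d : Diagram n n} (h : ∀ i, d.rel (Sum.inl i) (Sum.inr i)) :
    d = id n := by
  refine ext_compat fun a b => ?_
  rw [compat_id]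
  refine ⟨fun hc => funext fun i => hc _ _ (h i), ?_⟩
  rintro rfl x y hxy
  by_cases hne : y = x
  · rw [hne]
  rw [eq_partner hxy hne]
  rcases x with i | i
  · rw [← eq_partner (h i) Sum.inr_ne_inl]; rfl
  · rw [← eq_partner (d.rel.symm (h i)) Sum.inl_ne_inr]; rfl

theorem hasCap_of_lt (d : Diagram m n) (h : n < m) : d.HasCap := by
  refine d.hasCap_or_exists_strictMono.resolve_right ?_
  rintro ⟨t, ht, -⟩
  have := Fintype.card_le_of_injective t ht.injective
  simp only [Fintype.card_fin] at this
  omega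

theorem eq_id_or_hasCap (d : Diagram n n) : d = id n ∨ d.HasCap := by
  refine d.hasCap_or_exists_strictMono.symm.imp_left ?_
  rintro ⟨t, ht, hrel⟩
  have hsurj : Function.Surjective t := Finite.surjective_of_injective ht.injective
  have ht_id : t = _root_.id :=
    (ht.range_inj strictMono_id).1 (by rw [hsurj.range_eq, Set.range_id])
  exact eq_id_of_forall_rel (by simpa only [ht_id, _root_.id] using hrel)

/-! ### Absorbing a cap-cup -/

/-- The cap-cup with `a` strands on its left and `b` strands on its right. -/
def capCupAt (a b : ℕ) : Diagram (a + 2 + b) (a + 2 + b) :=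
  tensor (tensor (id a) (comp cap cup)) (id b)

theorem relMat_capCupAt (a b : ℕ) (x x' : Fin a → Bool) (s s' : Fin 2 → Bool)
    (y y' : Fin b → Bool) :
    relMat (capCupAt a b).rel (Fin.append (Fin.append x s) y)
      (Fin.append (Fin.append x' s') y') =
        if x = x' ∧ (s 0 = s 1 ∧ s' 0 = s' 1) ∧ y = y' then 1 else 0 := by
  rw [capCupAt, relMat_tensor_append, relMat_tensor_append, relMat_id, relMat_id, relMat_capCup,
    Matrix.one_apply, Matrix.one_apply, ite_zero_mul_ite_zero, ite_zero_mul_ite_zero]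
  simp only [mul_one, and_assoc]

theorem compat_of_eq_off_line {d : Diagram m n} {u v : Fin m ⊕ Fin n} (huv : d.rel u v)
    (hne : u ≠ v) {L L' : Fin m ⊕ Fin n → Bool} (hL : Compat d.rel L) (hL' : L' u = L' v)
    (hoff : ∀ w, w ≠ u → w ≠ v → L' w = L w) : Compat d.rel L' := by
  have hpu : v = d.partner u := eq_partner huv hne.symm
  have hpv : u = d.partner v := eq_partner (d.rel.symm huv) hne
  suffices h : ∀ x, L' x = L' (d.partner x) by
    intro x y hxy
    by_cases hyx : y = x
    · rw [hyx]
    · rw [eq_partner hxy hyx, ← h]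
  intro x
  by_cases hxu : x = u
  · rw [hxu, ← hpu, hL']
  by_cases hxv : x = v
  · rw [hxv, ← hpv, hL']
  have hpxu : d.partner x ≠ u := fun h => hxv (by rw [hpu, ← h, partner_partner])
  have hpxv : d.partner x ≠ v := fun h => hxu (by rw [hpv, ← h, partner_partner])
  rw [hoff x hxu hxv, hoff _ hpxu hpxv, hL _ _ (d.rel_partner x)]

section CapCupAt

variable {a b : ℕ} {d : Diagram (a + 2 + b) n}

theorem compat_append_of_rel
    (h : d.rel (Sum.inl (Fin.castAdd b (Fin.natAdd a 0)))
      (Sum.inl (Fin.castAdd b (Fin.natAdd a 1))))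
    (x : Fin a → Bool) (y : Fin b → Bool) (z : Fin n → Bool)
    {s s' : Fin 2 → Bool} (hs' : s' 0 = s' 1)
    (hc : Compat d.rel (Sum.elim (Fin.append (Fin.append x s) y) z)) :
    Compat d.rel (Sum.elim (Fin.append (Fin.append x s') y) z) := by
  refine compat_of_eq_off_line h (by simp [Fin.ext_iff]) hc (by simpa using hs') ?_
  rintro (w | w) hw0 hw1
  · induction w using Fin.addCases with
    | left w =>
      induction w using Fin.addCases with
      | left w => simp
      | right w =>
        fin_cases w
        exacts [absurd rfl hw0, absurd rfl hw1]
    | right w => simp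
  · rfl

theorem sum_relMat_append_of_rel
    (h : d.rel (Sum.inl (Fin.castAdd b (Fin.natAdd a 0)))
      (Sum.inl (Fin.castAdd b (Fin.natAdd a 1))))
    (x : Fin a → Bool) (y : Fin b → Bool) (z : Fin n → Bool)
    (s : Fin 2 → Bool) :
    ∑ s' : Fin 2 → Bool, (if s 0 = s 1 ∧ s' 0 = s' 1 then
      relMat d.rel (Fin.append (Fin.append x s') y) z else 0) =
        2 * relMat d.rel (Fin.append (Fin.append x s) y) z := by
  by_cases hs : s 0 = s 1
  · have hconst : ∀ s' : Fin 2 → Bool, s' 0 = s' 1 →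
        relMat d.rel (Fin.append (Fin.append x s') y) z =
          relMat d.rel (Fin.append (Fin.append x s) y) z := by
      intro s' hs'
      have hiff : Compat d.rel (Sum.elim (Fin.append (Fin.append x s') y) z) ↔
          Compat d.rel (Sum.elim (Fin.append (Fin.append x s) y) z) :=
        ⟨compat_append_of_rel h x y z hs, compat_append_of_rel h x y z hs'⟩
      rw [relMat, relMat, hiff]
    have hcard : (Finset.univ.filter fun s' : Fin 2 → Bool => s' 0 = s' 1).card = 2 := by decide
    simp only [hs, true_and]
    rw [← Finset.sum_filter, Finset.sum_congr rfl fun s' hs' => hconst s' (by simpa using hs'),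
      Finset.sum_const, hcard, smul_eq_mul]
  · have hzero : relMat d.rel (Fin.append (Fin.append x s) y) z = 0 :=
      if_neg fun hc => hs (by simpa using hc _ _ h)
    simp [hs, hzero]

theorem capCupAt_comp
    (h : d.rel (Sum.inl (Fin.castAdd b (Fin.natAdd a 0)))
      (Sum.inl (Fin.castAdd b (Fin.natAdd a 1)))) :
    loops (capCupAt a b) d = 1 ∧ comp (capCupAt a b) d = d := by
  have key : relMat (capCupAt a b).rel * relMat d.rel = 2 ^ 1 • relMat d.rel := by
    ext x z
    obtain ⟨⟨x, y⟩, rfl⟩ := (Fin.appendEquiv (a + 2) b).surjective x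
    obtain ⟨⟨x, s⟩, rfl⟩ := (Fin.appendEquiv a 2).surjective x
    change (relMat (capCupAt a b).rel * relMat d.rel) (Fin.append (Fin.append x s) y) z =
      2 * relMat d.rel (Fin.append (Fin.append x s) y) z
    rw [← sum_relMat_append_of_rel h, Matrix.mul_apply]
    simp [sum_append, relMat_capCupAt, ite_and]
  rw [relMat_comp] at key
  exact ⟨(relMat_smul_cancel key).1, Diagram.ext (relMat_smul_cancel key).2⟩

end CapCupAt
end Diagram

variable {k m n p : ℕ}

/-! ### Morphisms out of Jones–Wenzl projections -/

theorem jw_succ_succ (k n : ℕ) :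
    jw k (n + 2) = ltensor (jw k (n + 1)) (lid 1) + (qint k (n + 1) / qint k (n + 2)) •
      lcomp (delta k) (lcomp (delta k) (ltensor (jw k (n + 1)) (lid 1)) (ltensor (lid n) capCup))
        (ltensor (jw k (n + 1)) (lid 1)) := rfl

theorem jw_ltensor_absorb {a : ℕ} (ha : a ≤ k) :
    lcomp (delta k) (ltensor (jw k (a + 1)) (lid 1)) (ltensor (jw k a) (lid 2)) =
      ltensor (jw k (a + 1)) (lid 1) := by
  rw [ltensor_lid_succ _ 1]
  refine (ltensor_lcomp _ (jw k (a + 1)) (lid 1) (ltensor (jw k a) (lid 1)) (lid 1)).trans ?_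
  rw [(jw_aux a ha).2.1, lid_lcomp]

/-- With `g = fₐ₊₁ ⊗ 1` and `U` the last cap-cup, `U g U = -([a+2]/[a+1]) (fₐ ⊗ 1₂) U`, so the two
terms of `fₐ₊₂ U = g U + ([a+1]/[a+2]) g U g U` cancel. -/
theorem jw_lcomp_last_capCup (a : ℕ) (h : a + 2 ≤ k + 1) :
    lcomp (delta k) (jw k (a + 2)) (ltensor (lid a) capCup) = 0 := by
  obtain ⟨-, -, -, hUgU⟩ := jw_aux (k := k) a (by omega)
  have hq1 := qint_ne_zero k (a + 1) (by omega) (by omega)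
  have hq2 := qint_ne_zero k (a + 2) (by omega) (by omega)
  have absorb : lcomp (delta k) (ltensor (jw k (a + 1)) (lid 1)) (lcomp (delta k)
      (ltensor (jw k a) (lid 2)) (ltensor (lid a) capCup)) =
      lcomp (delta k) (ltensor (jw k (a + 1)) (lid 1)) (ltensor (lid a) capCup) :=
    (lcomp_assoc _ _ _ _).symm.trans
      (congrArg (fun x => lcomp (delta k) x _) (jw_ltensor_absorb (by omega)))
  have hcoeff : qint k (a + 1) / qint k (a + 2) * -(qint k (a + 2) / qint k (a + 1)) = -1 := by
    field_simp
  rw [jw_succ_succ, map_add, map_smul, LinearMap.add_apply, LinearMap.smul_apply, lcomp_assoc,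
    lcomp_assoc, ← lcomp_assoc _ (ltensor (lid a) capCup), hUgU, map_smul]
  refine (congrArg (fun x => _ + _ • _ • x) absorb).trans ?_
  rw [smul_smul, hcoeff]
  module

theorem jw_lcomp_capCup (a b : ℕ) (h : a + 2 + b ≤ k + 1) :
    lcomp (delta k) (jw k (a + 2 + b)) (ltensor (ltensor (lid a) capCup) (lid b)) = 0 := by
  induction b with
  | zero =>
    rw [ltensor_zero]
    exact jw_lcomp_last_capCup a h
  | succ b ih =>
    have absorb : lcomp (delta k) (jw k (a + 2 + b + 1)) (ltensor (jw k (a + 2 + b)) (lid 1)) =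
        jw k (a + 2 + b + 1) := (jw_aux (a + 2 + b) (by omega)).2.1
    have hzero : lcomp (delta k) (ltensor (jw k (a + 2 + b)) (lid 1))
        (ltensor (ltensor (ltensor (lid a) capCup) (lid b)) (lid 1)) = 0 := by
      rw [ltensor_lcomp, ih (by omega), map_zero, LinearMap.zero_apply]
    change lcomp (delta k) (jw k (a + 2 + b + 1)) _ = 0
    rw [ltensor_lid_succ _ b, ← absorb]
    exact (lcomp_assoc _ _ _ _).trans ((congrArg _ hzero).trans (map_zero _))

theorem delta_ne_zero (hk : 1 ≤ k) : delta k ≠ 0 :=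
  neg_ne_zero.2 (qint_ne_zero k 2 (by omega) (by omega))

theorem dg_capCupAt (a b : ℕ) :
    dg (Diagram.capCupAt a b) = ltensor (ltensor (lid a) capCup) (lid b) := by
  rw [lid, lid, capCup, ltensor_dg, ltensor_dg, Diagram.capCupAt]

theorem jw_lcomp_of_hasCap (hm : m ≤ k + 1) {d : Diagram m n} (hd : d.HasCap) :
    lcomp (delta k) (jw k m) (dg d) = 0 := by
  obtain ⟨i, j, hij, h⟩ := hd
  obtain ⟨a, ha⟩ : ∃ a : ℕ, a = i := ⟨i, rfl⟩
  obtain ⟨b, rfl⟩ : ∃ b, m = a + 2 + b := ⟨m - (a + 2), by omega⟩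
  have hi : i = Fin.castAdd b (Fin.natAdd a 0) := Fin.ext (by simp [ha])
  have hj : j = Fin.castAdd b (Fin.natAdd a 1) := Fin.ext (by simp [ha, ← hij])
  rw [hi, hj] at h
  obtain ⟨hloops, hcomp⟩ := Diagram.capCupAt_comp h
  have hdelta : delta k ≠ 0 := delta_ne_zero (by omega)
  have hdg : dg d = (delta k)⁻¹ • lcomp (delta k) (dg (Diagram.capCupAt a b)) (dg d) := by
    rw [lcomp_dg, hloops, hcomp, pow_one, inv_smul_smul₀ hdelta]
  rw [hdg, map_smul, ← lcomp_assoc, dg_capCupAt, jw_lcomp_capCup a b hm, map_zero,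
    LinearMap.zero_apply, smul_zero]

theorem jw_lcomp_of_lt (hm : m ≤ k + 1) (hn : n < m) (f : LinHom m n) :
    lcomp (delta k) (jw k m) f = 0 := by
  induction f using lin_induction with
  | h0 => rw [map_zero]
  | hadd f g hf hg => rw [map_add, hf, hg, add_zero]
  | hs c d => rw [map_smul, jw_lcomp_of_hasCap hm (d.hasCap_of_lt hn), smul_zero]

/-! ### The Markov trace -/

/-- The Markov trace: the closure of a diagram, with every loop replaced by the factor `δ`. -/
noncomputable def ltrace (δ : ℂ) : LinHom n n →ₗ[ℂ] ℂ :=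
  Finsupp.linearCombination ℂ fun f => δ ^ Diagram.closureLoops f

theorem ltrace_dg (δ : ℂ) (f : Diagram n n) : ltrace δ (dg f) = δ ^ Diagram.closureLoops f := by
  simp [ltrace, dg]

theorem ltrace_lcomp_dg (δ : ℂ) (f : Diagram m n) (g : Diagram n m) :
    ltrace δ (lcomp δ (dg f) (dg g)) =
      δ ^ (Diagram.loops f g + Diagram.closureLoops (f.comp g)) := by
  rw [lcomp_dg, map_smul, ltrace_dg, smul_eq_mul, pow_add]

theorem ltrace_lcomp_comm (δ : ℂ) (f : LinHom m n) (g : LinHom n m) :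
    ltrace δ (lcomp δ f g) = ltrace δ (lcomp δ g f) := by
  induction f using lin_induction with
  | h0 => simp
  | hadd f f' hf hf' => simp only [map_add, LinearMap.add_apply, hf, hf']
  | hs c f =>
    induction g using lin_induction with
    | h0 => simp
    | hadd g g' hg hg' => simp only [map_add, LinearMap.add_apply, hg, hg']
    | hs d g =>
      simp only [map_smul, LinearMap.smul_apply, ltrace_lcomp_dg,
        Diagram.loops_add_closureLoops_comm f g, smul_comm c d]

/-- At loop value `2` the trace of a composite of diagrams is the trace of a product of matrices,
so an identity between the latter determines the trace at any loop value. -/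
theorem ltrace_lcomp_dg_eq_of_trace_relMat_mul_eq {m' n' e : ℕ} (δ : ℂ) {f : Diagram m n}
    {g : Diagram n m} {f' : Diagram m' n'} {g' : Diagram n' m'}
    (h : (Diagram.relMat f.rel * Diagram.relMat g.rel).trace =
      2 ^ e * (Diagram.relMat f'.rel * Diagram.relMat g'.rel).trace) :
    ltrace δ (lcomp δ (dg f) (dg g)) = δ ^ e * ltrace δ (lcomp δ (dg f') (dg g')) := by
  rw [Diagram.trace_relMat_mul, Diagram.trace_relMat_mul, ← pow_add] at h
  rw [ltrace_lcomp_dg, ltrace_lcomp_dg, ← pow_add, Nat.pow_right_injective le_rfl h]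

theorem ltrace_ltensor_lid_lcomp_dg (δ : ℂ) (f : LinHom m n) {g : Diagram (n + 1) (m + 1)} {e : ℕ}
    {d : Diagram n m}
    (h : Diagram.closeLast (Diagram.relMat g.rel) = 2 ^ e • Diagram.relMat d.rel) :
    ltrace δ (lcomp δ (ltensor f (lid 1)) (dg g)) = δ ^ e * ltrace δ (lcomp δ f (dg d)) := by
  induction f using lin_induction with
  | h0 => simp
  | hadd f f' hf hf' => simp only [map_add, LinearMap.add_apply, hf, hf', mul_add]
  | hs c f =>
    have hdg : ltrace δ (lcomp δ (dg (f.tensor (Diagram.id 1))) (dg g)) =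
        δ ^ e * ltrace δ (lcomp δ (dg f) (dg d)) :=
      ltrace_lcomp_dg_eq_of_trace_relMat_mul_eq δ (by
        rw [Diagram.trace_tensor_id_mul, h, Matrix.mul_smul, Matrix.trace_smul, smul_eq_mul])
    simp only [map_smul, LinearMap.smul_apply, smul_eq_mul, lid, ltensor_dg, hdg, mul_left_comm]

theorem ltrace_lid_ltensor_lcomp_dg (δ : ℂ) (f : LinHom m n) {g : Diagram (1 + n) (1 + m)} {e : ℕ}
    {d : Diagram n m}
    (h : Diagram.closeFirst (Diagram.relMat g.rel) = 2 ^ e • Diagram.relMat d.rel) :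
    ltrace δ (lcomp δ (ltensor (lid 1) f) (dg g)) = δ ^ e * ltrace δ (lcomp δ f (dg d)) := by
  induction f using lin_induction with
  | h0 => simp
  | hadd f f' hf hf' => simp only [map_add, LinearMap.add_apply, hf, hf', mul_add]
  | hs c f =>
    have hdg : ltrace δ (lcomp δ (dg ((Diagram.id 1).tensor f)) (dg g)) =
        δ ^ e * ltrace δ (lcomp δ (dg f) (dg d)) :=
      ltrace_lcomp_dg_eq_of_trace_relMat_mul_eq δ (by
        rw [Diagram.trace_id_tensor_mul, h, Matrix.mul_smul, Matrix.trace_smul, smul_eq_mul])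
    simp only [map_smul, LinearMap.smul_apply, smul_eq_mul, lid, ltensor_dg, hdg, mul_left_comm]

theorem ltrace_ltensor_lid (δ : ℂ) (f : LinHom n n) :
    ltrace δ (ltensor f (lid 1)) = δ * ltrace δ f := by
  have h := ltrace_ltensor_lid_lcomp_dg δ f (Diagram.closeLast_relMat_id (n := n))
  rwa [← lid, ← lid, lcomp_lid, lcomp_lid, pow_one] at h

theorem ltrace_ltensor_lid_lcomp_capCup (δ : ℂ) (f : LinHom (n + 1) (n + 1)) :
    ltrace δ (lcomp δ (ltensor f (lid 1)) (ltensor (lid n) capCup)) = ltrace δ f := by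
  have h := ltrace_ltensor_lid_lcomp_dg δ f (e := 0)
    (Diagram.closeLast_relMat_id_capCup.trans (one_smul ℕ _).symm)
  rw [← lid, lcomp_lid, pow_zero, one_mul] at h
  rw [← h, capCup, lid, lid, ltensor_dg (Diagram.id n)]

theorem ltrace_lid_one (δ : ℂ) : ltrace δ (lid 1) = δ := by
  rw [lid, ltrace_dg, Diagram.closureLoops_id_one, pow_one]

theorem ltrace_jw_succ_succ (hn : n ≤ k) :
    ltrace (delta k) (jw k (n + 2)) =
      (delta k + qint k (n + 1) / qint k (n + 2)) * ltrace (delta k) (jw k (n + 1)) := by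
  have hgg : lcomp (delta k) (ltensor (jw k (n + 1)) (lid 1)) (ltensor (jw k (n + 1)) (lid 1)) =
      ltensor (jw k (n + 1)) (lid 1) := by
    rw [ltensor_lcomp, jw_idem (by omega), lid_lcomp]
  have hgUg : ltrace (delta k) (lcomp (delta k) (lcomp (delta k) (ltensor (jw k (n + 1)) (lid 1))
      (ltensor (lid n) capCup)) (ltensor (jw k (n + 1)) (lid 1))) =
      ltrace (delta k) (jw k (n + 1)) := by
    refine (ltrace_lcomp_comm _ _ _).trans ?_
    refine (congrArg (ltrace (delta k)) (lcomp_assoc _ _ _ _).symm).trans ?_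
    refine (congrArg (fun x => ltrace (delta k) (lcomp (delta k) x _)) hgg).trans ?_
    exact ltrace_ltensor_lid_lcomp_capCup _ _
  rw [jw_succ_succ, map_add, map_smul, add_mul, ← smul_eq_mul (_ / _)]
  exact congrArg₂ (fun x y => x + (qint k (n + 1) / qint k (n + 2)) • y)
    (ltrace_ltensor_lid _ _) hgUg

theorem ltrace_jw (hn : n ≤ k) :
    ltrace (delta k) (jw k (n + 1)) = (-1) ^ (n + 1) * qint k (n + 2) := by
  induction n with
  | zero => exact (ltrace_lid_one (delta k)).trans (by rw [delta]; ring)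
  | succ n ih =>
    have hq := qint_ne_zero k (n + 2) (by omega) (by omega)
    rw [ltrace_jw_succ_succ (by omega), ih (by omega), delta]
    field_simp
    linear_combination (-1) ^ (n + 2) * qint_rec k (n + 1)

theorem qint_add_two_self (k : ℕ) : qint k (k + 2) = 0 := by
  have hk : (k : ℂ) + 2 ≠ 0 := by exact_mod_cast (k + 1).succ_ne_zero
  have hq : qq k ^ (k + 2) = -1 := by
    rw [qq, ← Complex.exp_nat_mul, ← Complex.exp_pi_mul_I]
    congr 1
    push_cast
    field_simp
  rw [qint, hq]
  norm_num

/-! ### Negligible morphisms -/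

/-- A morphism is negligible if its composite with every morphism in the opposite direction has
Markov trace zero. -/
def Negligible (δ : ℂ) (f : LinHom m n) : Prop := ∀ g : LinHom n m, ltrace δ (lcomp δ f g) = 0

namespace Negligible

variable {δ : ℂ} {m' n' : ℕ}

theorem of_diagrams {f : LinHom m n} (h : ∀ d : Diagram n m, ltrace δ (lcomp δ f (dg d)) = 0) :
    Negligible δ f := by
  intro g
  induction g using lin_induction with
  | h0 => simp
  | hadd g g' hg hg' => rw [map_add, map_add, hg, hg', add_zero]
  | hs c d => rw [map_smul, map_smul, h, smul_zero]

theorem zero : Negligible δ (0 : LinHom m n) := fun g => by simp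

theorem add {f g : LinHom m n} (hf : Negligible δ f) (hg : Negligible δ g) :
    Negligible δ (f + g) := fun h => by
  rw [map_add, LinearMap.add_apply, map_add, hf, hg, add_zero]

theorem sum {ι : Type*} (s : Finset ι) {f : ι → LinHom m n} (hf : ∀ i, Negligible δ (f i)) :
    Negligible δ (∑ i ∈ s, f i) :=
  Finset.sum_induction f (Negligible δ) (fun _ _ => add) zero fun i _ => hf i

theorem lcomp_right {f : LinHom m n} (hf : Negligible δ f) (g : LinHom n p) :
    Negligible δ (lcomp δ f g) := fun h => by
  rw [lcomp_assoc]
  exact hf _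

theorem lcomp_left (f : LinHom m n) {g : LinHom n p} (hg : Negligible δ g) :
    Negligible δ (lcomp δ f g) := fun h => by
  rw [lcomp_assoc, ltrace_lcomp_comm, lcomp_assoc]
  exact hg _

theorem of_lcast {hm : m = m'} {hn : n = n'} {f : LinHom m n}
    (h : Negligible δ (lcast hm hn f)) : Negligible δ f := by
  subst hm hn
  exact h

theorem ltensor_lid_one {f : LinHom m n} (hf : Negligible δ f) :
    Negligible δ (ltensor f (lid 1)) := of_diagrams fun g => by
  obtain ⟨e, d, h⟩ := Diagram.exists_closeLast_relMat g
  rw [ltrace_ltensor_lid_lcomp_dg δ f h, hf, mul_zero]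

theorem lid_one_ltensor {f : LinHom m n} (hf : Negligible δ f) :
    Negligible δ (ltensor (lid 1) f) := of_diagrams fun g => by
  obtain ⟨e, d, h⟩ := Diagram.exists_closeFirst_relMat g
  rw [ltrace_lid_ltensor_lcomp_dg δ f h, hf, mul_zero]

theorem ltensor_lid {f : LinHom m n} (hf : Negligible δ f) (b : ℕ) :
    Negligible δ (ltensor f (lid b)) := by
  induction b with
  | zero => rwa [ltensor_zero]
  | succ b ih =>
    rw [ltensor_lid_succ]
    exact ih.ltensor_lid_one

theorem lid_ltensor {f : LinHom m n} (hf : Negligible δ f) (a : ℕ) :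
    Negligible δ (ltensor (lid a) f) := by
  induction a generalizing m n with
  | zero =>
    apply of_lcast (hm := Nat.zero_add _) (hn := Nat.zero_add _)
    rwa [zero_ltensor]
  | succ a ih =>
    rw [← TemperleyLieb.ltensor_lid]
    apply of_lcast (hm := Nat.add_assoc _ _ _) (hn := Nat.add_assoc _ _ _)
    rw [ltensor_assoc]
    exact ih hf.lid_one_ltensor

theorem ltensor_right {f : LinHom m n} (hf : Negligible δ f) (g : LinHom m' n') :
    Negligible δ (ltensor f g) := by
  have e := ltensor_lcomp δ f (lid m') (lid n) g
  rw [lid_lcomp, lcomp_lid] at e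
  rw [← e]
  exact (hf.ltensor_lid m').lcomp_right _

theorem ltensor_left (g : LinHom m' n') {f : LinHom m n} (hf : Negligible δ f) :
    Negligible δ (ltensor g f) := by
  have e := ltensor_lcomp δ (lid m') f g (lid n)
  rw [lid_lcomp, lcomp_lid] at e
  rw [← e]
  exact (hf.lid_ltensor m').lcomp_right _

end Negligible

theorem negligible_jw (k : ℕ) : Negligible (delta k) (jw k (k + 1)) := by
  refine Negligible.of_diagrams fun d => ?_
  rcases d.eq_id_or_hasCap with rfl | hd
  · rw [← lid, lcomp_lid, ltrace_jw le_rfl, qint_add_two_self, mul_zero]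
  · rw [jw_lcomp_of_hasCap le_rfl hd, map_zero]

theorem not_negligible_lid_one {δ : ℂ} (hδ : δ ≠ 0) : ¬ Negligible δ (lid 1) := fun h => by
  have htrace := h (lid 1)
  rw [lcomp_lid, ltrace_lid_one] at htrace
  exact hδ htrace

/-! ### The reduced Temperley–Lieb category -/

open MatMonoidal

theorem negligible_of_ideal {X Y : TL k} {f : X ⟶ Y} (h : TensorQuotient.Ideal (IsIdTop k) f) :
    ∀ a b, Negligible (delta k) (ent f.f a b) := by
  induction h with
  | of f hf =>
    cases hf
    exact fun _ _ => negligible_jw k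
  | zero X Y => exact fun _ _ => Negligible.zero
  | add f g _ _ hf hg => exact fun a b => (hf a b).add (hg a b)
  | precomp f g _ hg =>
    exact fun a b => Negligible.sum _ fun j => Negligible.lcomp_left _ (hg j b)
  | postcomp f g _ hf =>
    exact fun a b => Negligible.sum _ fun j => (hf a j).lcomp_right _
  | whiskerLeft X f _ hf => exact fun a b => Negligible.ltensor_left _ (hf a.2 b.2)
  | whiskerRight f Z _ hf => exact fun a b => (hf a.1 b.1).ltensor_right _

theorem hom_F_unit_eq_zero {i : ℕ} (hi : i ≤ k + 1) (h0 : 0 < i) (f : F k i hi ⟶ 𝟙_ (TL k)) :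
    f = 0 := by
  apply Idempotents.Karoubi.hom_ext
  rw [← Idempotents.Karoubi.p_comp f]
  apply ent_ext
  rintro ⟨⟩ ⟨⟩
  exact (ent_comp_single _ _ _ _ () fun _ => rfl).trans (jw_lcomp_of_lt hi h0 _)

theorem id_Fred_one_ne_zero (hk : 1 ≤ k) : 𝟙 (Fred k ⟨1, by omega⟩) ≠ 0 := by
  intro h
  have hmap : (reduce k).map (𝟙 (F k 1 (by omega))) = (reduce k).map 0 := by
    rw [CategoryTheory.Functor.map_id, CategoryTheory.Functor.map_zero]
    exact h
  rw [TensorQuotient.proj_eq, sub_zero] at hmap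
  exact not_negligible_lid_one (delta_ne_zero hk) (negligible_of_ideal hmap () ())

theorem ι_comp_eq_zero (n : Sig k ⟶ 𝟙_ (TLred k)) (i : Fin (k + 1)) (hi : 0 < (i : ℕ)) :
    biproduct.ι (Fred k) i ≫ n = 0 := by
  obtain ⟨g, hg⟩ := TensorQuotient.exists_rep (IsIdTop k) (X := F k i (by omega)) (Y := 𝟙_ (TL k))
    (biproduct.ι (Fred k) i ≫ n)
  rw [← hg, hom_F_unit_eq_zero _ hi g]
  exact CategoryTheory.Functor.map_zero _ _ _

theorem ι_whiskerRight_mul_comp_eq_zero (n : Sig k ⟶ 𝟙_ (TLred k)) (i : Fin (k + 1))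
    (hi : 0 < (i : ℕ)) : biproduct.ι (Fred k) i ▷ Sig k ≫ MonObj.mul ≫ n = 0 := by
  apply ext_right
  intro j
  rw [← Category.assoc, ← MonoidalCategory.tensorHom_def', ← Category.assoc, comp_zero]
  refine (congrArg (· ≫ n) (ι_gradedMul _ i j)).trans ?_
  split_ifs with hij
  · rw [Category.assoc, ι_comp_eq_zero n _ (by simp only; omega), comp_zero]
  · rw [zero_comp]

theorem ι_frobeniusMap_eq_zero (Ad : TLred k) [ExactPairing (Sig k) Ad] (n : Sig k ⟶ 𝟙_ (TLred k))
    (i : Fin (k + 1)) (hi : 0 < (i : ℕ)) :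
    biproduct.ι (Fred k) i ≫ frobeniusMap (Sig k) Ad n = 0 := by
  rw [frobeniusMap, rightUnitor_inv_naturality_assoc, ← whisker_exchange_assoc,
    associator_inv_naturality_left_assoc, ← comp_whiskerRight,
    ι_whiskerRight_mul_comp_eq_zero n i hi, MonoidalPreadditive.zero_whiskerRight]
  simp only [comp_zero]

end TemperleyLieb

theorem lemma3p10 (k : ℕ) (hk : 1 ≤ k) :
    (¬ AdmitsClassicalFrobeniusStructure (Sig k)) ∧
      ∀ (n : Sig k ⟶ 𝟙_ (TLred k)) (i : Fin (k + 1)), 0 < (i : ℕ) →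
        biproduct.ι (Fred k) i ≫ n = 0 := by
  refine ⟨?_, ι_comp_eq_zero⟩
  rintro ⟨n, Ad, hAd, hiso⟩
  have hzero := ι_frobeniusMap_eq_zero Ad n ⟨1, by omega⟩ Nat.one_pos
  have hι : biproduct.ι (Fred k) ⟨1, by omega⟩ = 0 := by
    rw [← cancel_mono (frobeniusMap (Sig k) Ad n), hzero, zero_comp]
  apply id_Fred_one_ne_zero hk
  rw [← biproduct.ι_π_self, hι, zero_comp]
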